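/- Let $n\in\mathbb N$, $\kappa\in\mathbb C$, $\operatorname{Im}\tau>0$, $\Lambda=\mathbb Z+\mathbb Z\tau$, let $\sigma(z)=\sigma(z|1,\tau)$ be the Weierstrass $\sigma$-function of $\Lambda$ and $\phi(\mu,z)=\frac{\sigma(z-\mu)}{\sigma(z)\sigma(-\mu)}$. Let $U=\{x\in\mathbb C^n: x_i-x_j\notin\Lambda \text{ for } i\ne j\}$ and let $\mathcal O$ be the algebra of holomorphic functions on $U$. Let $A_0=\mathcal O[p_1,\dots,p_n]$, and let $A_\hbar=\mathcal O[[\hbar]][\hat p_1,\dots,\hat p_n]$ be the algebra in which $\hbar$ is central, the $\hat p_i$ commute with each other and $[\hat p_i,f]=\hbar\,\partial f/\partial x_i$ for $f\in\mathcal O$. The group $S_n$ permutes the $x_i$ and the $p_i$ (or $\hat p_i$) simultaneously; let $A_0*S_n$ and $A_\hbar*S_n$ be the crossed products, $\operatorname{Res}\big(\sum_w a_w w\big)=\sum_w a_w$, and let $\eta_0:A_\hbar\to A_0$ be the classical limit $f\mapsto f$, $\hat p_i\mapsto p_i$, $\hbar\mapsto 0$. Let $s_{ij}$ be the transpositions.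 Consider the Dunkl operators $$y^{r}_{i,c}=p_i-\kappa\sum_{j\ne i}\frac{1}{x_i-x_j}s_{ij},\qquad y_{i,c}(\lambda)=p_i-\kappa\sum_{j\ne i}\phi(\lambda_i-\lambda_j,x_i-x_j)s_{ij},\qquad y_i(\lambda)=\hat p_i-\kappa\sum_{j\ne i}\phi(\lambda_i-\lambda_j,x_i-x_j)s_{ij},$$ where $\lambda\in U$. For a symmetric polynomial $q\in\mathbb C[e_1,\dots,e_n]^{S_n}$ put $L^{r}_{q,c}(x,p)=\operatorname{Res} q(y^{r}_{1,c},\dots,y^r_{n,c})\in A_0$ and $$L_{q,c}=\operatorname{Res}\lim_{\lambda\to0}L^{r}_{q,c}(\lambda,y_c(\lambda))\in A_0,\qquad \mathsf H_q=\operatorname{Res}\lim_{\lambda\to0}L_{q,c}(\lambda,y(\lambda))\in A_\hbar ,$$ where $f(\lambda,y)$ is obtained from $f(x,p)\in A_0$ by putting $x=\lambda$ and replacing the momenta $p_i$ by $y_i$, and limits are taken coefficientwise, at every $x\in U$ and with $\lambda\in U$. The classical Calogero--Moser Hamiltonians are $\mathsf H_{q,c}=\eta_0(\mathsf H_q)$,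 viewed as functions of $(x,p)\in U\times\mathbb C^n$. Let $(x^*,p^*)$ be the point $x_i=\frac in$, $p_i=0$ $(i=1,\dots,n)$; it lies in $U\times\mathbb C^n$. Then for every symmetric polynomial $q$ in the traceless combinations $\xi_i=e_i-\frac1n(e_1+\dots+e_n)$ both limits above exist, and $(x^*,p^*)$ is an equilibrium of $\mathsf H_{q,c}$, that is, $\mathsf H_{q,c}$ is holomorphic near this point and $$\frac{\partial\mathsf H_{q,c}}{\partial x_i}(x^*,p^*)=\frac{\partial\mathsf H_{q,c}}{\partial p_i}(x^*,p^*)=0\qquad(i=1,\dots,n).$$ Thus $(x^*,p^*)$ is a joint equilibrium of all these Hamiltonians, and consequently $\{\mathsf H_{q,c},G\}=0$ at $(x^*,p^*)$ for every function $G(x,p)$ differentiable there, where $\{F,G\}=\sum_i\big(\frac{\partial F}{\partial p_i}\frac{\partial G}{\partial x_i}-\frac{\partial F}{\partial x_i}\frac{\partial G}{\partial p_i}\big)$. -/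

import Mathlib

open Filter Topology

namespace EllipticCM

section Sigma

/-- The Weierstrass `σ`-function of the lattice `L`:
`σ(z) = z ∏_{l ≠ 0} (1 - z/l) exp(z/l + z²/(2 l²))`. -/
noncomputable def sigma (L : PeriodPair) (z : ℂ) : ℂ :=
  z * ∏' l : {l : L.lattice // l ≠ 0},
    (1 - z / (l.1 : ℂ)) * Complex.exp (z / (l.1 : ℂ) + (z / (l.1 : ℂ)) ^ 2 / 2)

theorem factor_bound (u : ℂ) (hu : ‖u‖ ≤ 1 / 2) :
    ‖(1 - u) * Complex.exp (u + u ^ 2 / 2) - 1‖ ≤ 10 * ‖u‖ ^ 3 := by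
  set v := u + u ^ 2 / 2 with hv
  have hv2 : ‖v‖ ≤ 5 / 4 * ‖u‖ := by
    calc ‖v‖ ≤ ‖u‖ + ‖u ^ 2 / 2‖ := norm_add_le _ _
      _ = ‖u‖ + ‖u‖ ^ 2 / 2 := by simp
      _ ≤ _ := by nlinarith [norm_nonneg u]
  have hv1 : ‖v‖ ≤ 1 := by linarith
  have he := Complex.exp_bound hv1 (n := 3) (by norm_num)
  simp [Finset.sum_range_succ, Nat.factorial] at he
  set r := Complex.exp v - (1 + v + v ^ 2 / 2) with hr
  have hE : (1 - u) * Complex.exp v - 1 = (1 - u) * r + (u ^ 4 / 8 - u * v ^ 2 / 2) := by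
    rw [hr, hv]; ring
  rw [hE]
  have h1 : ‖1 - u‖ ≤ 3 / 2 := by
    calc ‖1 - u‖ ≤ ‖(1 : ℂ)‖ + ‖u‖ := norm_sub_le _ _
      _ ≤ _ := by simp; linarith
  have hv3 : ‖v‖ ^ 3 ≤ (5 / 4 * ‖u‖) ^ 3 := by gcongr
  have hv22 : ‖v‖ ^ 2 ≤ (5 / 4 * ‖u‖) ^ 2 := by gcongr
  have hu0 := norm_nonneg u
  have hr' : ‖r‖ ≤ (5 / 4 * ‖u‖) ^ 3 * (4 / 18) := by
    refine he.trans ?_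
    calc _ ≤ (5 / 4 * ‖u‖) ^ 3 * ((3 + 1) / ((1 + 1 + 1) * (1 + 1) * 3)) := by
          gcongr
          norm_num
      _ = _ := by norm_num
  calc _ ≤ ‖(1 - u) * r‖ + ‖u ^ 4 / 8 - u * v ^ 2 / 2‖ := norm_add_le _ _
    _ ≤ ‖(1 - u) * r‖ + (‖u ^ 4 / 8‖ + ‖u * v ^ 2 / 2‖) := by gcongr; exact norm_sub_le _ _
    _ = ‖1 - u‖ * ‖r‖ + (‖u‖ ^ 4 / 8 + ‖u‖ * ‖v‖ ^ 2 / 2) := by simp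
    _ ≤ 3 / 2 * ((5 / 4 * ‖u‖) ^ 3 * (4 / 18)) +
        (‖u‖ ^ 4 / 8 + ‖u‖ * (5 / 4 * ‖u‖) ^ 2 / 2) := by gcongr
    _ ≤ _ := by
      have : ‖u‖ ^ 4 ≤ ‖u‖ ^ 3 := by
        nlinarith [pow_nonneg hu0 3]
      nlinarith [pow_nonneg hu0 3]

theorem summable_lattice (L : PeriodPair) :
    Summable fun l : {l : L.lattice // l ≠ 0} => ‖(l.1 : ℂ)‖⁻¹ ^ 3 := by
  have h := ZLattice.summable_norm_zpow L.lattice (-3) (by simp)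
  refine (h.subtype {l | l ≠ 0}).congr fun l => ?_
  simp

theorem eventually_factor_bound (L : PeriodPair) (r : ℝ) :
    ∀ᶠ l : {l : L.lattice // l ≠ 0} in cofinite, ∀ z ∈ Metric.ball (0 : ℂ) r,
      ‖(1 - z / (l.1 : ℂ)) * Complex.exp (z / (l.1 : ℂ) + (z / (l.1 : ℂ)) ^ 2 / 2) - 1‖
        ≤ 10 * r ^ 3 * ‖(l.1 : ℂ)‖⁻¹ ^ 3 := by
  have hfin : ∀ᶠ l : L.lattice in cofinite, 2 * r < ‖l‖ := by
    have := tendsto_norm_cocompact_atTop (E := L.lattice)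
    rw [Filter.cocompact_eq_cofinite] at this
    exact this.eventually_gt_atTop _
  have hfin2 : ∀ᶠ l : {l : L.lattice // l ≠ 0} in cofinite, 2 * r < ‖(l.1 : ℂ)‖ :=
    (Subtype.val_injective.tendsto_cofinite).eventually hfin
  filter_upwards [hfin2] with l hl z hz
  have hz' : ‖z‖ < r := by simpa using hz
  have hr : 0 < r := (norm_nonneg z).trans_lt hz'
  have hl0 : 0 < ‖(l.1 : ℂ)‖ := by linarith
  have hu : ‖z / (l.1 : ℂ)‖ ≤ 1 / 2 := by
    rw [norm_div, div_le_iff₀ hl0]; linarith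
  refine (factor_bound _ hu).trans ?_
  rw [norm_div, div_eq_mul_inv, mul_pow, mul_assoc]
  gcongr

theorem differentiable_sigma (L : PeriodPair) : Differentiable ℂ (sigma L) := by
  refine differentiable_id.mul ?_
  intro z
  set r := ‖z‖ + 1
  have hz : z ∈ Metric.ball (0 : ℂ) r := by simp [r]
  have h := Summable.hasProdLocallyUniformlyOn_one_add (K := Metric.ball (0 : ℂ) r)
    (f := fun (l : {l : L.lattice // l ≠ 0}) z =>
      (1 - z / (l.1 : ℂ)) * Complex.exp (z / (l.1 : ℂ) + (z / (l.1 : ℂ)) ^ 2 / 2) - 1)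
    Metric.isOpen_ball ((summable_lattice L).mul_left (10 * r ^ 3))
    (eventually_factor_bound L r) (fun i => by fun_prop)
  simp only [add_sub_cancel] at h
  have hd : DifferentiableOn ℂ (fun z => ∏' l : {l : L.lattice // l ≠ 0},
    (1 - z / (l.1 : ℂ)) * Complex.exp (z / (l.1 : ℂ) + (z / (l.1 : ℂ)) ^ 2 / 2))
      (Metric.ball (0 : ℂ) r) := by
    rw [hasProdLocallyUniformlyOn_iff_tendstoLocallyUniformlyOn] at h
    refine h.differentiableOn (Eventually.of_forall fun s => ?_) Metric.isOpen_ball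
    change DifferentiableOn ℂ (fun z => ∏ l ∈ s, _) _
    fun_prop
  exact hd.differentiableAt (Metric.isOpen_ball.mem_nhds hz)

theorem sigma_ne_zero (L : PeriodPair) {z : ℂ} (hz : z ∉ L.lattice) : sigma L z ≠ 0 := by
  have hz0 : z ≠ 0 := fun h => hz (h ▸ L.lattice.zero_mem)
  refine mul_ne_zero hz0 ?_
  have h := tprod_one_add_ne_zero_of_summable
    (f := fun (l : {l : L.lattice // l ≠ 0}) =>
      (1 - z / (l.1 : ℂ)) * Complex.exp (z / (l.1 : ℂ) + (z / (l.1 : ℂ)) ^ 2 / 2) - 1) ?_ ?_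
  · simpa only [add_sub_cancel] using h
  · intro l
    rw [add_sub_cancel]
    refine mul_ne_zero ?_ (Complex.exp_ne_zero _)
    have hl : (l.1 : ℂ) ≠ 0 := by simpa using l.2
    intro h0
    apply hz
    have : z = l.1 := by
      field_simp at h0
      linear_combination -h0
    rw [this]; exact l.1.2
  · refine Summable.of_norm_bounded_eventually
      ((summable_lattice L).mul_left (10 * (‖z‖ + 1) ^ 3)) ?_
    filter_upwards [eventually_factor_bound L (‖z‖ + 1)] with l hl
    simpa using hl z (by simp)

end Sigma

/-! ### Normally ordered differential operators

Let `K` be a commutative algebra with commuting derivations `d_1, …, d_n`. The algebra generated by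
`K` and commuting symbols `p̂_1, …, p̂_n` with `p̂_i f = f p̂_i + d_i(f)` has as its underlying
group the polynomials in the `p̂_i` (every element is uniquely `∑_k f_k p̂^k`). -/

section DiffOp

variable {n : ℕ} {K : Type*} [CommRing K] [Algebra ℂ K]

/-- Apply a map to all the coefficients. -/
noncomputable def coeffMap (δ : K → K) (a : MvPolynomial (Fin n) K) : MvPolynomial (Fin n) K :=
  ∑ k ∈ a.support, MvPolynomial.monomial k (δ (a.coeff k))

theorem coeff_coeffMap (δ : Derivation ℂ K K) (a : MvPolynomial (Fin n) K) (m : Fin n →₀ ℕ) :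
    (coeffMap δ a).coeff m = δ (a.coeff m) := by
  rw [coeffMap, MvPolynomial.coeff_sum]
  simp only [MvPolynomial.coeff_monomial, Finset.sum_ite_eq']
  split_ifs with h
  · rfl
  · rw [MvPolynomial.notMem_support_iff.mp h, map_zero]

/-- A derivation of `K` applied to all the coefficients. -/
noncomputable def coeffDer (δ : Derivation ℂ K K) :
    MvPolynomial (Fin n) K →ₗ[ℂ] MvPolynomial (Fin n) K where
  toFun := coeffMap δ
  map_add' a b := by
    ext m
    rw [coeff_coeffMap, MvPolynomial.coeff_add, MvPolynomial.coeff_add, map_add,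
      coeff_coeffMap, coeff_coeffMap]
  map_smul' c a := by
    ext m
    rw [coeff_coeffMap, RingHom.id_apply, MvPolynomial.coeff_smul, MvPolynomial.coeff_smul,
      coeff_coeffMap, Derivation.map_smul]

theorem coeff_coeffDer (δ : Derivation ℂ K K) (a : MvPolynomial (Fin n) K) (m : Fin n →₀ ℕ) :
    (coeffDer δ a).coeff m = δ (a.coeff m) := coeff_coeffMap δ a m

variable (d : Fin n → Derivation ℂ K K)

/-- Left multiplication by `p̂_i` on normally ordered elements:
`p̂_i (f p̂^k) = f p̂_i p̂^k + d_i(f) p̂^k`. -/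
noncomputable def opD (i : Fin n) : Module.End ℂ (MvPolynomial (Fin n) K) :=
  LinearMap.mulLeft ℂ (MvPolynomial.X i) + coeffDer (d i)

theorem opD_apply (i : Fin n) (a : MvPolynomial (Fin n) K) :
    opD d i a = MvPolynomial.X i * a + coeffDer (d i) a := rfl

theorem coeffDer_X_mul (δ : Derivation ℂ K K) (i : Fin n) (a : MvPolynomial (Fin n) K) :
    coeffDer δ (MvPolynomial.X i * a) = MvPolynomial.X i * coeffDer δ a := by
  ext m
  rw [coeff_coeffDer, MvPolynomial.coeff_X_mul', MvPolynomial.coeff_X_mul']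
  split_ifs
  · rw [coeff_coeffDer]
  · simp

theorem coeffDer_C_mul (δ : Derivation ℂ K K) (f : K) (a : MvPolynomial (Fin n) K) :
    coeffDer δ (MvPolynomial.C f * a)
      = MvPolynomial.C f * coeffDer δ a + MvPolynomial.C (δ f) * a := by
  ext m
  rw [coeff_coeffDer, MvPolynomial.coeff_C_mul, MvPolynomial.coeff_add, MvPolynomial.coeff_C_mul,
    MvPolynomial.coeff_C_mul, coeff_coeffDer, Derivation.leibniz]
  simp only [smul_eq_mul]
  ring

theorem opD_C_mul (i : Fin n) (f : K) (a : MvPolynomial (Fin n) K) :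
    opD d i (MvPolynomial.C f * a)
      = MvPolynomial.C f * opD d i a + MvPolynomial.C (d i f) * a := by
  rw [opD_apply, opD_apply, coeffDer_C_mul]; ring

variable {d}

theorem opD_commute (hd : ∀ i j f, d i (d j f) = d j (d i f)) (i j : Fin n) :
    Commute (opD d i) (opD d j) := by
  refine LinearMap.ext fun a => ?_
  simp only [Module.End.mul_apply, opD_apply, map_add, coeffDer_X_mul]
  have : coeffDer (d i) (coeffDer (d j) a) = coeffDer (d j) (coeffDer (d i) a) := by
    ext m
    simp only [coeff_coeffDer, hd i j]
  rw [this]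
  ring

theorem opD_pow_pairwise (hd : ∀ i j f, d i (d j f) = d j (d i f)) (k : Fin n →₀ ℕ) :
    ((Finset.univ : Finset (Fin n)) : Set (Fin n)).Pairwise
      (Function.onFun Commute fun i => opD d i ^ k i) :=
  fun i _ j _ _ => (opD_commute hd i j).pow_pow _ _

/-- Left multiplication by `p̂^k`. -/
noncomputable def opPow (hd : ∀ i j f, d i (d j f) = d j (d i f)) (k : Fin n →₀ ℕ) :
    Module.End ℂ (MvPolynomial (Fin n) K) :=
  Finset.univ.noncommProd (fun i => opD d i ^ k i)
    (opD_pow_pairwise hd k)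

/-- Left multiplication by `a = ∑_k f_k p̂^k`: the product of `a` and `b` is `opL hd a b`. -/
noncomputable def opL (hd : ∀ i j f, d i (d j f) = d j (d i f)) (a : MvPolynomial (Fin n) K) :
    Module.End ℂ (MvPolynomial (Fin n) K) :=
  ∑ k ∈ a.support, LinearMap.mulLeft ℂ (MvPolynomial.C (a.coeff k)) * opPow hd k

variable (hd : ∀ i j f, d i (d j f) = d j (d i f))

theorem opPow_zero : opPow hd 0 = 1 := by
  rw [opPow]
  refine (Finset.noncommProd_eq_pow_card _ _ _ 1 fun i _ => ?_).trans (one_pow _)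
  simp

theorem opPow_add (k l : Fin n →₀ ℕ) : opPow hd (k + l) = opPow hd k * opPow hd l := by
  rw [opPow, opPow, opPow, ← Finset.noncommProd_mul_distrib]
  · refine Finset.noncommProd_congr rfl (fun i _ => ?_) _
    simp [pow_add]
  · exact fun i _ j _ _ => (opD_commute hd i j).pow_pow _ _

theorem opPow_single (i : Fin n) : opPow hd (Finsupp.single i 1) = opD d i := by
  rw [opPow, ← Finset.mul_noncommProd_erase _ (Finset.mem_univ i)]
  refine (congrArg _ (Finset.noncommProd_eq_pow_card _ _ _ 1 fun j hj => ?_)).trans ?_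
  · rw [Finsupp.single_eq_of_ne (Finset.ne_of_mem_erase hj), pow_zero]
  · simp

theorem opL_eq {a : MvPolynomial (Fin n) K} {s : Finset (Fin n →₀ ℕ)} (hs : a.support ⊆ s) :
    opL hd a = ∑ k ∈ s, LinearMap.mulLeft ℂ (MvPolynomial.C (a.coeff k)) * opPow hd k := by
  refine Finset.sum_subset hs fun k _ hk => ?_
  rw [MvPolynomial.notMem_support_iff.mp hk]
  simp

theorem opL_add (a b : MvPolynomial (Fin n) K) : opL hd (a + b) = opL hd a + opL hd b := by
  rw [opL_eq hd (MvPolynomial.support_add (p := a) (q := b)),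
    opL_eq hd (Finset.subset_union_left (s₁ := a.support) (s₂ := b.support)),
    opL_eq hd (Finset.subset_union_right (s₁ := a.support) (s₂ := b.support)),
    ← Finset.sum_add_distrib]
  refine Finset.sum_congr rfl fun k _ => ?_
  rw [MvPolynomial.coeff_add, map_add, ← add_mul]
  congr 1
  refine LinearMap.ext fun x => ?_
  simp [add_mul]

theorem opL_monomial (k : Fin n →₀ ℕ) (f : K) :
    opL hd (MvPolynomial.monomial k f)
      = LinearMap.mulLeft ℂ (MvPolynomial.C f) * opPow hd k := by
  rw [opL_eq hd MvPolynomial.support_monomial_subset, Finset.sum_singleton,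
    MvPolynomial.coeff_monomial, if_pos rfl]

theorem opL_zero : opL hd (0 : MvPolynomial (Fin n) K) = 0 := by
  simp [opL]

theorem opL_C_mul (f : K) (a : MvPolynomial (Fin n) K) :
    opL hd (MvPolynomial.C f * a) = LinearMap.mulLeft ℂ (MvPolynomial.C f) * opL hd a := by
  induction a using MvPolynomial.induction_on' with
  | monomial k g =>
    rw [MvPolynomial.C_mul_monomial, opL_monomial, opL_monomial, ← mul_assoc]
    congr 1
    refine LinearMap.ext fun x => ?_
    simp
  | add p q hp hq => rw [mul_add, opL_add, opL_add, hp, hq, mul_add]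

theorem opD_monomial (i : Fin n) (k : Fin n →₀ ℕ) (g : K) :
    opD d i (MvPolynomial.monomial k g)
      = MvPolynomial.monomial (Finsupp.single i 1 + k) g + MvPolynomial.monomial k (d i g) := by
  rw [opD_apply, MvPolynomial.X, MvPolynomial.monomial_mul, one_mul]
  congr 1
  ext l
  rw [coeff_coeffDer, MvPolynomial.coeff_monomial, MvPolynomial.coeff_monomial]
  split_ifs <;> simp

theorem opL_opD (i : Fin n) (a : MvPolynomial (Fin n) K) :
    opL hd (opD d i a) = opD d i * opL hd a := by
  induction a using MvPolynomial.induction_on' with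
  | monomial k g =>
    rw [opD_monomial, opL_add, opL_monomial, opL_monomial, opL_monomial, opPow_add, opPow_single]
    refine LinearMap.ext fun x => ?_
    simp only [LinearMap.add_apply, Module.End.mul_apply, LinearMap.mulLeft_apply]
    rw [opD_C_mul]
  | add p q hp hq => rw [map_add, opL_add, opL_add, hp, hq, mul_add]

theorem opL_opPow (k : Fin n →₀ ℕ) (a : MvPolynomial (Fin n) K) :
    opL hd (opPow hd k a) = opPow hd k * opL hd a := by
  induction k using Finsupp.induction_linear generalizing a with
  | zero => simp [opPow_zero]
  | add k l hk hl => rw [opPow_add, Module.End.mul_apply, hk, hl, mul_assoc]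
  | single i m =>
    induction m generalizing a with
    | zero => simp [opPow_zero]
    | succ m ih =>
      rw [Finsupp.single_add, opPow_add, Module.End.mul_apply, ih, opPow_single, opL_opD, mul_assoc]

theorem opL_opL (a b : MvPolynomial (Fin n) K) :
    opL hd (opL hd a b) = opL hd a * opL hd b := by
  induction a using MvPolynomial.induction_on' with
  | monomial k g =>
    rw [opL_monomial, Module.End.mul_apply, LinearMap.mulLeft_apply, opL_C_mul, opL_opPow,
      mul_assoc]
  | add p q hp hq => rw [opL_add, LinearMap.add_apply, opL_add, hp, hq, add_mul]

theorem opPow_one (k : Fin n →₀ ℕ) (l : Fin n →₀ ℕ) :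
    opPow hd k (MvPolynomial.monomial l 1) = MvPolynomial.monomial (k + l) 1 := by
  induction k using Finsupp.induction_linear generalizing l with
  | zero => simp [opPow_zero]
  | add k k' hk hk' => rw [opPow_add, Module.End.mul_apply, hk', hk, add_assoc]
  | single i m =>
    induction m generalizing l with
    | zero => simp [opPow_zero]
    | succ m ih =>
      rw [Finsupp.single_add, opPow_add, Module.End.mul_apply, opPow_single, opD_monomial]
      simp only [Derivation.map_one_eq_zero, map_zero, add_zero, ih, add_assoc]

theorem opL_apply_one (a : MvPolynomial (Fin n) K) : opL hd a 1 = a := by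
  induction a using MvPolynomial.induction_on' with
  | monomial k g =>
    rw [opL_monomial, Module.End.mul_apply, LinearMap.mulLeft_apply, MvPolynomial.one_def,
      opPow_one, MvPolynomial.C_mul_monomial, mul_one, add_zero]
  | add p q hp hq => rw [opL_add, LinearMap.add_apply, hp, hq]

theorem opL_one : opL hd (1 : MvPolynomial (Fin n) K) = 1 := by
  rw [MvPolynomial.one_def, opL_monomial, opPow_zero]
  refine LinearMap.ext fun x => ?_
  simp

theorem opL_add_apply (a b c : MvPolynomial (Fin n) K) :
    opL hd (a + b) c = opL hd a c + opL hd b c := by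
  rw [opL_add]; rfl

theorem opL_zero_apply (a : MvPolynomial (Fin n) K) : opL hd 0 a = 0 := by
  rw [opL_zero]; rfl

theorem opL_one_apply (a : MvPolynomial (Fin n) K) : opL hd 1 a = a := by
  rw [opL_one]; rfl

theorem opL_assoc (a b c : MvPolynomial (Fin n) K) :
    opL hd (opL hd a b) c = opL hd a (opL hd b c) := by
  rw [opL_opL]; rfl

end DiffOp

section PermPoly

variable {n : ℕ} {K : Type*} [CommRing K]

/-- The permutation `w` acts on the coefficients by `α w` and on the symbols by
`p̂_i ↦ p̂_{w(i)}`. -/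
noncomputable def permPoly (α : Equiv.Perm (Fin n) →* (K →+* K)) (w : Equiv.Perm (Fin n)) :
    MvPolynomial (Fin n) K →+* MvPolynomial (Fin n) K :=
  ((MvPolynomial.rename w).toRingHom).comp (MvPolynomial.map (α w))

variable (α : Equiv.Perm (Fin n) →* (K →+* K))

theorem permPoly_C (w : Equiv.Perm (Fin n)) (f : K) :
    permPoly α w (MvPolynomial.C f) = MvPolynomial.C (α w f) := by
  simp [permPoly]

theorem permPoly_X (w : Equiv.Perm (Fin n)) (i : Fin n) :
    permPoly α w (MvPolynomial.X i : MvPolynomial (Fin n) K) = MvPolynomial.X (w i) := by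
  simp [permPoly]

theorem permPoly_one : permPoly α 1 = RingHom.id _ := by
  refine MvPolynomial.ringHom_ext (fun f => ?_) fun i => ?_
  · rw [permPoly_C]; simp
  · rw [permPoly_X]; simp

theorem permPoly_mul (v w : Equiv.Perm (Fin n)) :
    permPoly α (v * w) = (permPoly α v).comp (permPoly α w) := by
  refine MvPolynomial.ringHom_ext (fun f => ?_) fun i => ?_
  · rw [RingHom.comp_apply, permPoly_C, permPoly_C, permPoly_C]; simp
  · rw [RingHom.comp_apply, permPoly_X, permPoly_X, permPoly_X]; simp
theorem permPoly_monomial (w : Equiv.Perm (Fin n)) (k : Fin n →₀ ℕ) (f : K) :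
    permPoly α w (MvPolynomial.monomial k f)
      = MvPolynomial.monomial (k.mapDomain w) (α w f) := by
  simp [permPoly, MvPolynomial.rename_monomial]


theorem permPoly_one_apply (a : MvPolynomial (Fin n) K) : permPoly α 1 a = a := by
  rw [permPoly_one]; rfl

theorem permPoly_mul_apply (v w : Equiv.Perm (Fin n)) (a : MvPolynomial (Fin n) K) :
    permPoly α (v * w) a = permPoly α v (permPoly α w a) := by
  rw [permPoly_mul]; rfl

end PermPoly

section PermDiffOp

variable {n : ℕ} {K : Type*} [CommRing K] [Algebra ℂ K] {d : Fin n → Derivation ℂ K K}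
  (hd : ∀ i j f, d i (d j f) = d j (d i f))

theorem permPoly_opD
    (α : Equiv.Perm (Fin n) →* (K →+* K)) (hα : ∀ w i f, α w (d i f) = d (w i) (α w f))
    (w : Equiv.Perm (Fin n)) (i : Fin n) (a : MvPolynomial (Fin n) K) :
    permPoly α w (opD d i a) = opD d (w i) (permPoly α w a) := by
  induction a using MvPolynomial.induction_on' with
  | monomial k g =>
    rw [opD_monomial, map_add, permPoly_monomial, permPoly_monomial,
      permPoly_monomial, opD_monomial, hα, Finsupp.mapDomain_add, Finsupp.mapDomain_single]
  | add p q hp hq => rw [map_add, map_add, map_add, map_add, hp, hq]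

theorem permPoly_opPow
    (α : Equiv.Perm (Fin n) →* (K →+* K)) (hα : ∀ w i f, α w (d i f) = d (w i) (α w f))
    (w : Equiv.Perm (Fin n)) (k : Fin n →₀ ℕ) (a : MvPolynomial (Fin n) K) :
    permPoly α w (opPow hd k a) = opPow hd (k.mapDomain w) (permPoly α w a) := by
  induction k using Finsupp.induction_linear generalizing a with
  | zero => simp [opPow_zero]
  | add k l hk hl =>
    rw [opPow_add, Module.End.mul_apply, hk, hl, Finsupp.mapDomain_add, opPow_add,
      Module.End.mul_apply]
  | single i m =>
    induction m generalizing a with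
    | zero => simp [opPow_zero]
    | succ m ih =>
      rw [Finsupp.single_add, opPow_add, Module.End.mul_apply, ih, opPow_single,
        permPoly_opD α hα, Finsupp.mapDomain_add, opPow_add, Module.End.mul_apply]
      simp only [Finsupp.mapDomain_single, opPow_single]

theorem permPoly_opL
    (α : Equiv.Perm (Fin n) →* (K →+* K)) (hα : ∀ w i f, α w (d i f) = d (w i) (α w f))
    (w : Equiv.Perm (Fin n)) (a b : MvPolynomial (Fin n) K) :
    permPoly α w (opL hd a b) = opL hd (permPoly α w a) (permPoly α w b) := by
  induction a using MvPolynomial.induction_on' with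
  | monomial k g =>
    rw [permPoly_monomial, opL_monomial, opL_monomial, Module.End.mul_apply,
      Module.End.mul_apply, LinearMap.mulLeft_apply, LinearMap.mulLeft_apply, map_mul,
      permPoly_C, permPoly_opPow hd α hα]
  | add p q hp hq =>
    rw [opL_add, LinearMap.add_apply, map_add, map_add, opL_add, LinearMap.add_apply, hp, hq]

end PermDiffOp

/-! ### Coefficient functions -/

section Functions

open UpperHalfPlane in
/-- The period pair `(1, τ)`; its lattice is `ℤ + ℤτ`. -/
noncomputable def periods (τ : ℍ) : PeriodPair where
  ω₁ := 1
  ω₂ := τ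
  indep := by
    rw [LinearIndependent.pair_iff]
    intro s t h
    have him := congrArg Complex.im h
    have hre := congrArg Complex.re h
    simp at him hre
    have ht : t = 0 := him.resolve_right τ.im_pos.ne'
    subst ht
    simpa using hre

/-- `φ(μ, z) = σ(z - μ) / (σ(z) σ(-μ))`, with `σ(z) = σ(z | 1, τ)`. -/
noncomputable def phi (τ : UpperHalfPlane) (μ z : ℂ) : ℂ :=
  sigma (periods τ) (z - μ) / (sigma (periods τ) z * sigma (periods τ) (-μ))

/-- The points `x` of `ℂⁿ` with `x_i - x_j ∉ ℤ + ℤτ` for `i ≠ j`. -/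
def regSet (n : ℕ) (τ : UpperHalfPlane) : Set (Fin n → ℂ) :=
  {x | ∀ i j, i ≠ j → x i - x j ∉ (periods τ).lattice}

theorem isOpen_regSet (n : ℕ) (τ : UpperHalfPlane) : IsOpen (regSet n τ) := by
  have : regSet n τ = ⋂ i, ⋂ j, {x | i ≠ j → x i - x j ∉ (periods τ).lattice} := by
    ext x; simp [regSet]
  rw [this]
  refine isOpen_iInter_of_finite fun i => isOpen_iInter_of_finite fun j => ?_
  by_cases h : i = j
  · simp [h]
  · have hc : Continuous fun x : Fin n → ℂ => x i - x j := by fun_prop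
    have ho : IsOpen {x : Fin n → ℂ | x i - x j ∉ (periods τ).lattice} :=
      ((periods τ).isClosed_lattice.isOpen_compl).preimage hc
    simpa [h] using ho

variable (n : ℕ) (τ : UpperHalfPlane)

/-- Extension by `0` of a function on the regular points to `ℂⁿ`. -/
noncomputable def extZero {n : ℕ} {τ : UpperHalfPlane} (f : regSet n τ → ℂ) : (Fin n → ℂ) → ℂ :=
  Function.extend Subtype.val f 0

theorem extZero_apply {n : ℕ} {τ : UpperHalfPlane} (f : regSet n τ → ℂ) (x : regSet n τ) :
    extZero f x = f x := Subtype.val_injective.extend_apply _ _ _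

theorem extZero_eventuallyEq {n : ℕ} {τ : UpperHalfPlane} (f : regSet n τ → ℂ)
    (g : (Fin n → ℂ) → ℂ) (h : ∀ x : regSet n τ, f x = g x) {x : Fin n → ℂ} (hx : x ∈ regSet n τ) :
    extZero f =ᶠ[𝓝 x] g := by
  filter_upwards [(isOpen_regSet n τ).mem_nhds hx] with y hy
  exact (extZero_apply f ⟨y, hy⟩).trans (h _)

theorem analytic_extZero {n : ℕ} {τ : UpperHalfPlane} (f : regSet n τ → ℂ)
    (g : (Fin n → ℂ) → ℂ) (h : ∀ x : regSet n τ, f x = g x)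
    (hg : AnalyticOnNhd ℂ g (regSet n τ)) : AnalyticOnNhd ℂ (extZero f) (regSet n τ) :=
  fun x hx => (hg x hx).congr (extZero_eventuallyEq f g h hx).symm

/-- The coefficient algebra: functions of `x` that are holomorphic on the set of regular points
(an `S_n`-stable dense open subset of `ℂⁿ`). It is closed under the partial derivatives and contains
the meromorphic functions on `ℂⁿ` whose poles lie on the hyperplanes `x_i - x_j ∈ ℤ + ℤτ`, in
particular all the coefficients of the rational and elliptic Dunkl operators. -/
noncomputable def Hol : Subalgebra ℂ (regSet n τ → ℂ) where
  carrier := {f | AnalyticOnNhd ℂ (extZero f) (regSet n τ)}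
  mul_mem' {f g} hf hg := analytic_extZero _ (extZero f * extZero g) (by simp [extZero_apply]) (hf.mul hg)
  add_mem' {f g} hf hg := analytic_extZero _ (extZero f + extZero g) (by simp [extZero_apply]) (hf.add hg)
  algebraMap_mem' c := analytic_extZero _ (fun _ => c) (by simp) analyticOnNhd_const

variable {n τ}

/-- The restriction of a function on `ℂⁿ` that is holomorphic at the regular points. -/
noncomputable def Hol.mk (g : (Fin n → ℂ) → ℂ) (hg : AnalyticOnNhd ℂ g (regSet n τ)) :
    Hol n τ :=
  ⟨fun x => g x, analytic_extZero _ g (fun _ => rfl) hg⟩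

theorem Hol.extZero_mk (g : (Fin n → ℂ) → ℂ) (hg : AnalyticOnNhd ℂ g (regSet n τ))
    {x : Fin n → ℂ} (hx : x ∈ regSet n τ) : extZero (Hol.mk (τ := τ) g hg).1 =ᶠ[𝓝 x] g :=
  extZero_eventuallyEq _ _ (fun _ => rfl) hx

/-- `∂F/∂x_i`. -/
noncomputable def partialFun (i : Fin n) (F : (Fin n → ℂ) → ℂ) : (Fin n → ℂ) → ℂ :=
  fun x => fderiv ℂ F x (Pi.single i 1)

theorem analytic_partialFun (i : Fin n) {F : (Fin n → ℂ) → ℂ} {s : Set (Fin n → ℂ)}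
    (hF : AnalyticOnNhd ℂ F s) : AnalyticOnNhd ℂ (partialFun i F) s := by
  intro x hx
  exact ((ContinuousLinearMap.apply ℂ ℂ (Pi.single i (1 : ℂ) : Fin n → ℂ)).analyticAt _).comp
    (hF x hx).fderiv

theorem Hol.differentiableAt (f : Hol n τ) (x : regSet n τ) : DifferentiableAt ℂ (extZero f.1) x.1 :=
  (f.2 x.1 x.2).differentiableAt

theorem Hol.hext {f g : Hol n τ} (h : ∀ x, f.1 x = g.1 x) : f = g := Subtype.ext (funext h)

/-- `∂f/∂x_i` for `f` in `Hol n τ`. -/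
noncomputable def partialHol (i : Fin n) (f : Hol n τ) : Hol n τ :=
  Hol.mk (partialFun i (extZero f.1)) (analytic_partialFun i f.2)

theorem partialHol_apply (i : Fin n) (f : Hol n τ) (g : (Fin n → ℂ) → ℂ)
    (h : ∀ x, f.1 x = g x) (x : regSet n τ) :
    (partialHol i f).1 x = fderiv ℂ g x (Pi.single i 1) := by
  change fderiv ℂ (extZero f.1) x _ = _
  rw [(extZero_eventuallyEq f.1 g h x.2).fderiv_eq]

/-- The derivation `∂/∂x_i` of `Hol n τ`. -/
noncomputable def pderivHol (i : Fin n) : Derivation ℂ (Hol n τ) (Hol n τ) :=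
  Derivation.mk'
    { toFun := partialHol i
      map_add' := fun f g => Hol.hext fun x => by
        rw [partialHol_apply i (f + g) (extZero f.1 + extZero g.1) (by simp [extZero_apply]),
          fderiv_add (Hol.differentiableAt f x) (Hol.differentiableAt g x)]
        rfl
      map_smul' := fun c f => Hol.hext fun x => by
        rw [partialHol_apply i (c • f) (c • extZero f.1) (by simp [extZero_apply]),
          fderiv_const_smul (Hol.differentiableAt f x)]
        rfl }
    fun f g => Hol.hext fun x => by
      change (partialHol i (f * g)).1 x = _
      rw [partialHol_apply i (f * g) (extZero f.1 * extZero g.1) (by simp [extZero_apply]),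
        fderiv_mul (Hol.differentiableAt f x) (Hol.differentiableAt g x), extZero_apply, extZero_apply]
      rfl

theorem pderivHol_apply (i : Fin n) (f : Hol n τ) (x : regSet n τ) :
    (pderivHol i f).1 x = fderiv ℂ (extZero f.1) x (Pi.single i 1) := rfl

theorem pderivHol_comm (i j : Fin n) (f : Hol n τ) :
    pderivHol i (pderivHol j f) = pderivHol j (pderivHol i f) := by
  have key : ∀ (i j : Fin n) (x : regSet n τ), (pderivHol i (pderivHol j f)).1 x
      = fderiv ℂ (fderiv ℂ (extZero f.1)) x (Pi.single i 1) (Pi.single j 1) := by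
    intro i j x
    refine (partialHol_apply i (partialHol j f) (partialFun j (extZero f.1)) (fun _ => rfl) x).trans ?_
    have h : DifferentiableAt ℂ (fderiv ℂ (extZero f.1)) x.1 := (f.2 x.1 x.2).fderiv.differentiableAt
    unfold partialFun
    rw [fderiv_clm_apply h (differentiableAt_const _)]
    simp
  refine Hol.hext fun x => ?_
  rw [key, key]
  have h : ContDiffAt ℂ 2 (extZero f.1) x.1 := (f.2 x.1 x.2).contDiffAt
  exact h.isSymmSndFDerivAt (by simp) _ _

theorem comp_mem_regSet (w : Equiv.Perm (Fin n)) {x : Fin n → ℂ} (hx : x ∈ regSet n τ) :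
    x ∘ w ∈ regSet n τ :=
  fun i j hij => hx (w i) (w j) (w.injective.ne hij)

/-- `x ↦ x ∘ w`, that is, `x ↦ w⁻¹ x` for the permutation action on `ℂⁿ`. -/
noncomputable def permL (w : Equiv.Perm (Fin n)) : (Fin n → ℂ) →L[ℂ] (Fin n → ℂ) :=
  ContinuousLinearMap.pi fun i => ContinuousLinearMap.proj (w i)

/-- `(w.f)(x) = f(w⁻¹ x)`, where `(w⁻¹ x)_i = x_{w(i)}`. -/
noncomputable def permHol : Equiv.Perm (Fin n) →* (Hol n τ →+* Hol n τ) where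
  toFun w :=
    { toFun := fun f => ⟨fun x => f.1 ⟨x.1 ∘ w, comp_mem_regSet w x.2⟩,
        analytic_extZero _ (fun x => extZero f.1 (permL w x))
          (fun x => (extZero_apply f.1 ⟨x.1 ∘ w, comp_mem_regSet w x.2⟩).symm)
          (fun x hx => AnalyticAt.comp (f := permL w) (g := extZero f.1)
            (f.2 (x ∘ w) (comp_mem_regSet w hx)) ((permL w).analyticAt x))⟩
      map_one' := rfl
      map_mul' := fun _ _ => rfl
      map_zero' := rfl
      map_add' := fun _ _ => rfl }
  map_one' := rfl
  map_mul' _ _ := rfl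

theorem permHol_apply (w : Equiv.Perm (Fin n)) (f : Hol n τ) (x : regSet n τ) :
    (permHol w f).1 x = f.1 ⟨x.1 ∘ w, comp_mem_regSet w x.2⟩ := rfl

theorem permHol_pderiv (w : Equiv.Perm (Fin n)) (i : Fin n) (f : Hol n τ) :
    permHol w (pderivHol i f) = pderivHol (w i) (permHol w f) := by
  refine Hol.hext fun x => ?_
  rw [permHol_apply, pderivHol_apply]
  have hd := Hol.differentiableAt f ⟨x.1 ∘ w, comp_mem_regSet w x.2⟩
  have h := partialHol_apply (w i) (permHol w f) (fun x => extZero f.1 (permL w x))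
    (fun x => (extZero_apply f.1 ⟨x.1 ∘ w, comp_mem_regSet w x.2⟩).symm) x
  refine Eq.trans ?_ h.symm
  have hc : HasFDerivAt (fun x => extZero f.1 (permL w x))
      ((fderiv ℂ (extZero f.1) (x.1 ∘ w)).comp (permL w)) x.1 :=
    HasFDerivAt.comp x.1 (f := permL w) (g := extZero f.1) hd.hasFDerivAt (permL w).hasFDerivAt
  rw [hc.fderiv]
  change _ = fderiv ℂ (extZero f.1) (x.1 ∘ w) (permL w (Pi.single (w i) 1))
  congr 1
  ext j
  simp [permL, Pi.single_apply]

end Functions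

/-! ### The classical and the quantum algebras and their crossed products with `S_n` -/

section Algebras

variable (n : ℕ) (τ : UpperHalfPlane)

/-- The classical algebra `A_0`: polynomials in the momenta `p_1, …, p_n` with coefficients in
`Hol n τ`. -/
def A0 : Type := MvPolynomial (Fin n) (Hol n τ)

noncomputable instance : CommRing (A0 n τ) :=
  inferInstanceAs (CommRing (MvPolynomial (Fin n) (Hol n τ)))

noncomputable instance : Module ℂ (A0 n τ) :=
  inferInstanceAs (Module ℂ (MvPolynomial (Fin n) (Hol n τ)))

/-- `S_n` acts on `A_0` by simultaneous permutations of positions and momenta. -/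
noncomputable instance : SMul (Equiv.Perm (Fin n)) (A0 n τ) where
  smul w a := permPoly (K := Hol n τ) permHol w a

noncomputable instance : MulSemiringAction (Equiv.Perm (Fin n)) (A0 n τ) where
  one_smul := permPoly_one_apply (K := Hol n τ) permHol
  mul_smul := permPoly_mul_apply (K := Hol n τ) permHol
  smul_zero w := map_zero (permPoly (K := Hol n τ) permHol w)
  smul_add w := map_add (permPoly (K := Hol n τ) permHol w)
  smul_one w := map_one (permPoly (K := Hol n τ) permHol w)
  smul_mul w := map_mul (permPoly (K := Hol n τ) permHol w)

/-- Coefficients of the quantum algebra: formal power series in `ħ` over `Hol n τ`. -/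
abbrev HolH : Type := PowerSeries (Hol n τ)

variable {n τ}

/-- The derivation `ħ ∂/∂x_i`. -/
noncomputable def hbarPartial (i : Fin n) : Derivation ℂ (HolH n τ) (HolH n τ) :=
  Derivation.mk'
    { toFun := fun f =>
        PowerSeries.X * PowerSeries.mk fun m => pderivHol i (PowerSeries.coeff m f)
      map_add' := fun f g => by
        rw [← mul_add (PowerSeries.X : HolH n τ)]
        congr 1
        ext m : 1
        simp
      map_smul' := fun c f => by
        rw [RingHom.id_apply, ← mul_smul_comm]
        congr 1
        ext m : 1
        simp }
    fun f g => by
      change (PowerSeries.X : HolH n τ) * _ = f * (PowerSeries.X * _) + g * (PowerSeries.X * _)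
      rw [mul_left_comm f, mul_left_comm g, ← mul_add]
      congr 1
      ext m : 1
      rw [map_add, mul_comm g, PowerSeries.coeff_mk, PowerSeries.coeff_mul, PowerSeries.coeff_mul,
        PowerSeries.coeff_mul, map_sum, ← Finset.sum_add_distrib]
      refine Finset.sum_congr rfl fun p _ => ?_
      rw [Derivation.leibniz, PowerSeries.coeff_mk, PowerSeries.coeff_mk, smul_eq_mul,
        smul_eq_mul, mul_comm (PowerSeries.coeff p.2 g)]

theorem hbarPartial_apply (i : Fin n) (f : HolH n τ) :
    hbarPartial i f
      = PowerSeries.X * PowerSeries.mk fun m => pderivHol i (PowerSeries.coeff m f) := rfl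

theorem coeff_hbarPartial (i : Fin n) (f : HolH n τ) (m : ℕ) :
    PowerSeries.coeff (m + 1) (hbarPartial i f) = pderivHol i (PowerSeries.coeff m f) := by
  rw [hbarPartial_apply, PowerSeries.coeff_succ_X_mul, PowerSeries.coeff_mk]

theorem coeff_zero_hbarPartial (i : Fin n) (f : HolH n τ) :
    PowerSeries.coeff 0 (hbarPartial i f) = 0 := by
  rw [hbarPartial_apply, PowerSeries.coeff_zero_X_mul]

theorem hbarPartial_comm (i j : Fin n) (f : HolH n τ) :
    hbarPartial i (hbarPartial j f) = hbarPartial j (hbarPartial i f) := by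
  ext m : 1
  rcases m with _ | _ | m
  · simp only [coeff_zero_hbarPartial]
  · simp only [coeff_hbarPartial, coeff_zero_hbarPartial, map_zero]
  · simp only [coeff_hbarPartial, pderivHol_comm i j]

/-- `S_n` acts on power series in `ħ` coefficientwise. -/
noncomputable def permHolH : Equiv.Perm (Fin n) →* (HolH n τ →+* HolH n τ) where
  toFun w := PowerSeries.map (permHol w)
  map_one' := by
    refine RingHom.ext fun f => ?_
    ext m : 1
    simp
  map_mul' v w := by
    refine RingHom.ext fun f => ?_
    ext m : 1
    simp

theorem permHolH_hbarPartial (w : Equiv.Perm (Fin n)) (i : Fin n) (f : HolH n τ) :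
    permHolH w (hbarPartial i f) = hbarPartial (w i) (permHolH w f) := by
  change PowerSeries.map (permHol w) _ = hbarPartial (w i) (PowerSeries.map (permHol w) f)
  ext m : 1
  rcases m with _ | m
  · rw [PowerSeries.coeff_map, coeff_zero_hbarPartial, coeff_zero_hbarPartial, map_zero]
  · rw [PowerSeries.coeff_map, coeff_hbarPartial, coeff_hbarPartial, PowerSeries.coeff_map,
      permHol_pderiv]

variable (n τ)

/-- The quantum algebra `A_ħ`. An element is written in the unique normally ordered form
`∑_k f_k p̂^k` with `f_k` a power series in `ħ` over `Hol n τ`; the underlying additive group is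
therefore that of the polynomials in the symbols `p̂_i`. The product (see below) is
determined by `p̂_i p̂_j = p̂_j p̂_i` and `p̂_i f = f p̂_i + ħ ∂_i f`. -/
def Ah : Type := MvPolynomial (Fin n) (HolH n τ)

noncomputable instance : AddCommGroup (Ah n τ) :=
  inferInstanceAs (AddCommGroup (MvPolynomial (Fin n) (HolH n τ)))

noncomputable instance : Module ℂ (Ah n τ) :=
  inferInstanceAs (Module ℂ (MvPolynomial (Fin n) (HolH n τ)))

noncomputable instance : Mul (Ah n τ) where
  mul a b := opL (K := HolH n τ) (d := hbarPartial) hbarPartial_comm a b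

noncomputable instance : One (Ah n τ) where
  one := (1 : MvPolynomial (Fin n) (HolH n τ))

noncomputable instance : Ring (Ah n τ) where
  __ := (inferInstance : AddCommGroup (Ah n τ))
  left_distrib a b c := map_add (opL (K := HolH n τ) (d := hbarPartial) hbarPartial_comm a) b c
  right_distrib := opL_add_apply (K := HolH n τ) (d := hbarPartial) hbarPartial_comm
  zero_mul := opL_zero_apply (K := HolH n τ) (d := hbarPartial) hbarPartial_comm
  mul_zero a := map_zero (opL (K := HolH n τ) (d := hbarPartial) hbarPartial_comm a)
  mul_assoc := opL_assoc (K := HolH n τ) (d := hbarPartial) hbarPartial_comm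
  one_mul := opL_one_apply (K := HolH n τ) (d := hbarPartial) hbarPartial_comm
  mul_one := opL_apply_one (K := HolH n τ) (d := hbarPartial) hbarPartial_comm

/-- `S_n` acts on `A_ħ` by simultaneous permutations of positions and momenta. -/
noncomputable instance : SMul (Equiv.Perm (Fin n)) (Ah n τ) where
  smul w a := permPoly (K := HolH n τ) permHolH w a

noncomputable instance : MulSemiringAction (Equiv.Perm (Fin n)) (Ah n τ) where
  one_smul := permPoly_one_apply (K := HolH n τ) permHolH
  mul_smul := permPoly_mul_apply (K := HolH n τ) permHolH
  smul_zero w := map_zero (permPoly (K := HolH n τ) permHolH w)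
  smul_add w := map_add (permPoly (K := HolH n τ) permHolH w)
  smul_one w := map_one (permPoly (K := HolH n τ) permHolH w)
  smul_mul := permPoly_opL (K := HolH n τ) (d := hbarPartial) hbarPartial_comm permHolH permHolH_hbarPartial

/-- The crossed product `A_0 * S_n`. -/
abbrev A0S : Type := SkewMonoidAlgebra (A0 n τ) (Equiv.Perm (Fin n))

/-- The crossed product `A_ħ * S_n`. -/
abbrev AhS : Type := SkewMonoidAlgebra (Ah n τ) (Equiv.Perm (Fin n))

variable {n τ}

/-- The momentum `p_i ∈ A_0`. -/
noncomputable def A0.p (i : Fin n) : A0 n τ :=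
  (MvPolynomial.X i : MvPolynomial (Fin n) (Hol n τ))

/-- A function of the positions as an element of `A_0`. -/
noncomputable def A0.ofHol (f : Hol n τ) : A0 n τ :=
  (MvPolynomial.C f : MvPolynomial (Fin n) (Hol n τ))

/-- The coefficient of `p^k`. -/
noncomputable def A0.coeff (a : A0 n τ) (k : Fin n →₀ ℕ) : Hol n τ :=
  MvPolynomial.coeff (R := Hol n τ) k a

/-- The quantum momentum `p̂_i = ħ ∂_i ∈ A_ħ`. -/
noncomputable def Ah.p (i : Fin n) : Ah n τ :=
  (MvPolynomial.X i : MvPolynomial (Fin n) (HolH n τ))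

/-- The central element `ħ ∈ A_ħ`. -/
noncomputable def Ah.hbar : Ah n τ :=
  (MvPolynomial.C PowerSeries.X : MvPolynomial (Fin n) (HolH n τ))

/-- A function of the positions as an element of `A_ħ`. -/
noncomputable def Ah.ofHol (f : Hol n τ) : Ah n τ :=
  (MvPolynomial.C (PowerSeries.C f) : MvPolynomial (Fin n) (HolH n τ))

/-- The coefficient of `ħ^m p̂^k` in the normally ordered form. -/
noncomputable def Ah.coeff (a : Ah n τ) (k : Fin n →₀ ℕ) (m : ℕ) : Hol n τ :=
  PowerSeries.coeff m (MvPolynomial.coeff (R := HolH n τ) k a)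

/-- The classical limit `η_0 : A_ħ → A_0`, `f ↦ f`, `p̂_i ↦ p_i`, `ħ ↦ 0`. -/
noncomputable def eta0 (a : Ah n τ) : A0 n τ :=
  MvPolynomial.map (R := HolH n τ) (PowerSeries.constantCoeff (R := Hol n τ)) a

theorem coeffDer_C {K : Type*} [CommRing K] [Algebra ℂ K] (δ : Derivation ℂ K K) (f : K) :
    coeffDer δ (MvPolynomial.C f : MvPolynomial (Fin n) K) = MvPolynomial.C (δ f) := by
  have h := coeffDer_C_mul δ f (1 : MvPolynomial (Fin n) K)
  have h1 : coeffDer δ (1 : MvPolynomial (Fin n) K) = 0 := by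
    ext k
    rw [coeff_coeffDer, MvPolynomial.coeff_one]
    split_ifs <;> simp
  rwa [mul_one, mul_one, h1, mul_zero, zero_add] at h

theorem hbarPartial_C (i : Fin n) (f : Hol n τ) :
    hbarPartial i (PowerSeries.C f : HolH n τ)
      = PowerSeries.X * PowerSeries.C (pderivHol i f) := by
  rw [hbarPartial_apply]
  congr 1
  ext m : 1
  rw [PowerSeries.coeff_mk, PowerSeries.coeff_C, PowerSeries.coeff_C]
  split_ifs <;> simp

theorem Ah.p_mul_ofHol (i : Fin n) (f : Hol n τ) :
    Ah.p i * Ah.ofHol f = Ah.ofHol f * Ah.p i + Ah.hbar * Ah.ofHol (pderivHol i f) := by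
  have h1 : @Eq (Ah n τ) (Ah.p i * Ah.ofHol f)
      (opD (K := HolH n τ) hbarPartial i (MvPolynomial.C (PowerSeries.C f))) := by
    refine Eq.trans (b := opL (K := HolH n τ) (d := hbarPartial) hbarPartial_comm
      (MvPolynomial.monomial (Finsupp.single i 1) 1) (MvPolynomial.C (PowerSeries.C f))) rfl ?_
    rw [opL_monomial, opPow_single, Module.End.mul_apply, LinearMap.mulLeft_apply, map_one, one_mul]
  have h2 : @Eq (Ah n τ) (Ah.ofHol f * Ah.p i)
      (MvPolynomial.C (PowerSeries.C f) * MvPolynomial.X i :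
          MvPolynomial (Fin n) (HolH n τ)) := by
    refine Eq.trans (b := opL (K := HolH n τ) (d := hbarPartial) hbarPartial_comm
      (MvPolynomial.monomial 0 (PowerSeries.C f)) (MvPolynomial.X i)) rfl ?_
    rw [opL_monomial, opPow_zero, Module.End.mul_apply, LinearMap.mulLeft_apply,
      Module.End.one_apply]
  have h3 : @Eq (Ah n τ) (Ah.hbar * Ah.ofHol (pderivHol i f))
      (MvPolynomial.C PowerSeries.X * MvPolynomial.C (PowerSeries.C (pderivHol i f)) :
          MvPolynomial (Fin n) (HolH n τ)) := by
    refine Eq.trans (b := opL (K := HolH n τ) (d := hbarPartial) hbarPartial_comm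
      (MvPolynomial.monomial 0 PowerSeries.X)
      (MvPolynomial.C (PowerSeries.C (pderivHol i f)))) rfl ?_
    rw [opL_monomial, opPow_zero, Module.End.mul_apply, LinearMap.mulLeft_apply,
      Module.End.one_apply]
  rw [h1, h2, h3]
  refine (opD_apply _ _ _).trans ?_
  rw [coeffDer_C, hbarPartial_C, map_mul, mul_comm (MvPolynomial.X i)]
  rfl

theorem eta0_mul (a b : Ah n τ) : eta0 (a * b) = eta0 a * eta0 b := by
  let φ : MvPolynomial (Fin n) (HolH n τ) →+* MvPolynomial (Fin n) (Hol n τ) :=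
    MvPolynomial.map (PowerSeries.constantCoeff (R := Hol n τ))
  have hX : ∀ i : Fin n, φ (MvPolynomial.X i) = MvPolynomial.X i := fun i =>
    MvPolynomial.map_X _ _
  have hD : ∀ (i : Fin n) (b : MvPolynomial (Fin n) (HolH n τ)),
      φ (opD (K := HolH n τ) hbarPartial i b) = MvPolynomial.X i * φ b := by
    intro i b
    have h0 : φ (coeffDer (K := HolH n τ) (hbarPartial i) b) = 0 := by
      refine MvPolynomial.ext _ _ fun k => ?_
      refine (MvPolynomial.coeff_map _ _ _).trans ?_
      rw [coeff_coeffDer, ← PowerSeries.coeff_zero_eq_constantCoeff_apply,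
        coeff_zero_hbarPartial, MvPolynomial.coeff_zero]
    rw [opD_apply, map_add, map_mul, h0, hX, add_zero]
  have hP : ∀ (k : Fin n →₀ ℕ) (b : MvPolynomial (Fin n) (HolH n τ)),
      φ (opPow (K := HolH n τ) (d := hbarPartial) hbarPartial_comm k b)
        = MvPolynomial.monomial k 1 * φ b := by
    intro k
    induction k using Finsupp.induction_linear with
    | zero =>
      intro b
      rw [opPow_zero, Module.End.one_apply, ← MvPolynomial.one_def, one_mul]
    | add k l hk hl =>
      intro b
      rw [opPow_add, Module.End.mul_apply, hk, hl, ← mul_assoc, MvPolynomial.monomial_mul, one_mul]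
    | single i m =>
      induction m with
      | zero =>
        intro b
        rw [Finsupp.single_zero, opPow_zero, Module.End.one_apply, ← MvPolynomial.one_def, one_mul]
      | succ m ih =>
        intro b
        rw [Finsupp.single_add, opPow_add, Module.End.mul_apply, ih, opPow_single, hD,
          MvPolynomial.X, ← mul_assoc, MvPolynomial.monomial_mul, one_mul]
  have key : ∀ a b : MvPolynomial (Fin n) (HolH n τ),
      φ (opL (K := HolH n τ) (d := hbarPartial) hbarPartial_comm a b) = φ a * φ b := by
    intro a b
    induction a using MvPolynomial.induction_on' with
    | monomial k g =>
      have hm : φ (MvPolynomial.monomial k g)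
          = MvPolynomial.C (PowerSeries.constantCoeff g) * MvPolynomial.monomial k 1 := by
        rw [MvPolynomial.C_mul_monomial, mul_one]
        exact MvPolynomial.map_monomial _ _ _
      have hc : φ (MvPolynomial.C g) = MvPolynomial.C (PowerSeries.constantCoeff g) :=
        MvPolynomial.map_C _ _
      rw [opL_monomial, Module.End.mul_apply, LinearMap.mulLeft_apply, map_mul, hP, hm, hc,
        mul_assoc]
    | add p q hp hq => rw [opL_add_apply, map_add, hp, hq, map_add, add_mul]
  exact key a b

/-- The map `Res : R * S_n → R`, `∑ a_w w ↦ ∑ a_w`. -/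
noncomputable def res {R : Type*} [AddCommMonoid R]
    (a : SkewMonoidAlgebra R (Equiv.Perm (Fin n))) : R :=
  ∑ w : Equiv.Perm (Fin n), a.coeff w

/-- Substitution of elements `y_1, …, y_n` of a (noncommutative) algebra for the variables of a
polynomial. Each monomial is sent to the product in the order `y_1^{k_1} ⋯ y_n^{k_n}`; for
pairwise commuting `y_i` this is the usual algebra map. -/
noncomputable def subst {B : Type*} [Ring B] [Module ℂ B] (y : Fin n → B)
    (f : MvPolynomial (Fin n) ℂ) : B :=
  ∑ k ∈ f.support, f.coeff k • (List.ofFn fun i => y i ^ k i).prod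

end Algebras

section Hamiltonians

variable {n : ℕ} {τ : UpperHalfPlane}

theorem sub_ne_zero_of_mem {x : Fin n → ℂ} (hx : x ∈ regSet n τ) {i j : Fin n} (h : i ≠ j) :
    x i - x j ≠ 0 :=
  fun h0 => hx i j h (h0 ▸ (periods τ).lattice.zero_mem)

theorem analytic_coord_sub (i j : Fin n) (s : Set (Fin n → ℂ)) :
    AnalyticOnNhd ℂ (fun x : Fin n → ℂ => x i - x j) s := fun x _ =>
  (ContinuousLinearMap.analyticAt (ContinuousLinearMap.proj (R := ℂ) (φ := fun _ => ℂ) i) x).sub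
    (ContinuousLinearMap.analyticAt (ContinuousLinearMap.proj (R := ℂ) (φ := fun _ => ℂ) j) x)

theorem analytic_inv_sub {i j : Fin n} (h : j ≠ i) :
    AnalyticOnNhd ℂ (fun x : Fin n → ℂ => 1 / (x i - x j)) (regSet n τ) := fun x hx =>
  analyticAt_const.div (analytic_coord_sub i j _ x hx) (sub_ne_zero_of_mem hx h.symm)

theorem analyticAt_sigma (L : PeriodPair) (z : ℂ) : AnalyticAt ℂ (sigma L) z :=
  (differentiable_sigma L).analyticAt z

theorem analytic_phi (l : regSet n τ) {i j : Fin n} (h : j ≠ i) :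
    AnalyticOnNhd ℂ (fun x : Fin n → ℂ => phi τ (l.1 i - l.1 j) (x i - x j)) (regSet n τ) := by
  intro x hx
  have h1 : AnalyticAt ℂ (fun x : Fin n → ℂ => x i - x j) x := analytic_coord_sub i j _ x hx
  have h2 : AnalyticAt ℂ (fun x : Fin n → ℂ => sigma (periods τ) (x i - x j)) x :=
    (analyticAt_sigma _ _).comp h1
  have h3 : AnalyticAt ℂ
      (fun x : Fin n → ℂ => sigma (periods τ) (x i - x j - (l.1 i - l.1 j))) x :=
    AnalyticAt.comp (g := sigma (periods τ)) (f := fun x : Fin n → ℂ => x i - x j - (l.1 i - l.1 j))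
      (analyticAt_sigma _ _) (h1.sub analyticAt_const)
  refine h3.div (h2.mul analyticAt_const)
    (mul_ne_zero (sigma_ne_zero _ (hx i j h.symm)) (sigma_ne_zero _ fun hl => ?_))
  exact l.2 i j h.symm (by simpa using (periods τ).lattice.neg_mem hl)

/-- The classical rational Dunkl operators `p_i - κ ∑_{j ≠ i} (x_i - x_j)⁻¹ s_{ij}`. -/
noncomputable def ratDunkl (κ : ℂ) (i : Fin n) : A0S n τ :=
  SkewMonoidAlgebra.single 1 (A0.p i) - κ • ∑ j : {j : Fin n // j ≠ i},
    SkewMonoidAlgebra.single (Equiv.swap i j.1)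
      (A0.ofHol (Hol.mk (fun x => 1 / (x i - x j.1)) (analytic_inv_sub j.2)))

/-- The classical elliptic Dunkl operators
`p_i - κ ∑_{j ≠ i} φ(λ_i - λ_j, x_i - x_j) s_{ij}`. -/
noncomputable def ellDunklC (κ : ℂ) (l : regSet n τ) (i : Fin n) : A0S n τ :=
  SkewMonoidAlgebra.single 1 (A0.p i) - κ • ∑ j : {j : Fin n // j ≠ i},
    SkewMonoidAlgebra.single (Equiv.swap i j.1)
      (A0.ofHol (Hol.mk (fun x => phi τ (l.1 i - l.1 j.1) (x i - x j.1)) (analytic_phi l j.2)))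

/-- The quantum elliptic Dunkl operators
`ħ ∂_i - κ ∑_{j ≠ i} φ(λ_i - λ_j, x_i - x_j) s_{ij}`. -/
noncomputable def ellDunkl (κ : ℂ) (l : regSet n τ) (i : Fin n) : AhS n τ :=
  SkewMonoidAlgebra.single 1 (Ah.p i) - κ • ∑ j : {j : Fin n // j ≠ i},
    SkewMonoidAlgebra.single (Equiv.swap i j.1)
      (Ah.ofHol (Hol.mk (fun x => phi τ (l.1 i - l.1 j.1) (x i - x j.1)) (analytic_phi l j.2)))

/-- Evaluation of a holomorphic function at a regular point. -/
noncomputable def Hol.eval (l : regSet n τ) : Hol n τ →+* ℂ :=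
  (Pi.evalRingHom (fun _ => ℂ) l).comp (Hol n τ).subtype

/-- Putting `x = λ` in `f ∈ A_0` gives a polynomial in the momenta. -/
noncomputable def A0.evalAt (l : regSet n τ) (f : A0 n τ) : MvPolynomial (Fin n) ℂ :=
  MvPolynomial.map (R := Hol n τ) (Hol.eval l) f

/-- `λ → 0` inside the set of regular spectral parameters. -/
noncomputable def toZero (n : ℕ) (τ : UpperHalfPlane) : Filter (regSet n τ) :=
  comap Subtype.val (𝓝 0)

/-- `lim_{λ → 0} F(λ) = a` in `A_0 * S_n`: all coefficients converge at every regular `x`. -/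
def HasLimitC (F : regSet n τ → A0S n τ) (a : A0S n τ) : Prop :=
  ∀ (w : Equiv.Perm (Fin n)) (k : Fin n →₀ ℕ) (x : regSet n τ),
    Tendsto (fun l => (((F l).coeff w).coeff k).1 x) (toZero n τ)
      (𝓝 (((a.coeff w).coeff k).1 x))

/-- `lim_{λ → 0} F(λ) = a` in `A_ħ * S_n`: all coefficients (of `ħ^m p̂^k w`, in normally
ordered form) converge at every regular `x`. -/
def HasLimit (F : regSet n τ → AhS n τ) (a : AhS n τ) : Prop :=
  ∀ (w : Equiv.Perm (Fin n)) (k : Fin n →₀ ℕ) (m : ℕ) (x : regSet n τ),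
    Tendsto (fun l => (((F l).coeff w).coeff k m).1 x) (toZero n τ)
      (𝓝 (((a.coeff w).coeff k m).1 x))

instance toZero_neBot : (toZero n τ).NeBot := by
  rw [toZero, comap_neBot_iff]
  intro t ht
  let c : ℝ → (Fin n → ℂ) := fun s i => ((s * i : ℝ) : ℂ)
  have hc : Tendsto c (𝓝[>] 0) (𝓝 0) := by
    have : Continuous c := by fun_prop
    have h0 : c 0 = 0 := by ext i; simp [c]
    exact (h0 ▸ this.tendsto 0).mono_left nhdsWithin_le_nhds
  have hsmall : ∀ᶠ s : ℝ in 𝓝[>] 0, s * (n + 1) < 1 ∧ 0 < s := by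
    refine Filter.Eventually.and ?_ self_mem_nhdsWithin
    have : Tendsto (fun s : ℝ => s * (n + 1)) (𝓝[>] 0) (𝓝 0) := by
      have h : Continuous fun s : ℝ => s * ((n : ℝ) + 1) := by fun_prop
      have := h.tendsto 0
      rw [zero_mul] at this
      exact this.mono_left nhdsWithin_le_nhds
    exact this.eventually_lt_const one_pos
  obtain ⟨s, hst, hs1, hs0⟩ := ((hc.eventually ht).and hsmall).exists
  refine ⟨⟨c s, fun i j hij hmem => ?_⟩, hst⟩
  obtain ⟨a, b, hab⟩ := PeriodPair.mem_lattice.mp hmem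
  have him := congrArg Complex.im hab
  have hre := congrArg Complex.re hab
  simp [periods, c] at him hre
  have hb : b = 0 := him.resolve_right τ.im_pos.ne'
  subst hb
  simp only [Int.cast_zero, zero_mul, add_zero, ← mul_sub] at hre
  have hij' : ((i : ℕ) : ℝ) - (j : ℕ) ≠ 0 := by
    rw [sub_ne_zero]; exact_mod_cast fun h => hij (Fin.ext h)
  have hi : ((i : ℕ) : ℝ) < n := by exact_mod_cast i.2
  have hj : ((j : ℕ) : ℝ) < n := by exact_mod_cast j.2
  have hi0 : (0 : ℝ) ≤ (i : ℕ) := by positivity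
  have hj0 : (0 : ℝ) ≤ (j : ℕ) := by positivity
  have hlt : |(a : ℝ)| < 1 := by
    rw [hre, abs_lt]; constructor <;> nlinarith
  have ha : a = 0 := by
    rw [← Int.cast_abs] at hlt
    exact Int.abs_lt_one_iff.mp (by exact_mod_cast hlt)
  rw [ha, Int.cast_zero] at hre
  exact (mul_ne_zero hs0.ne' hij') hre.symm

theorem HasLimitC.unique {F : regSet n τ → A0S n τ} {a b : A0S n τ} (ha : HasLimitC F a)
    (hb : HasLimitC F b) : a = b := by
  refine SkewMonoidAlgebra.ext fun w => ?_
  refine MvPolynomial.ext (R := Hol n τ) _ _ fun k => Hol.hext fun x => ?_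
  exact tendsto_nhds_unique (ha w k x) (hb w k x)

theorem HasLimit.unique {F : regSet n τ → AhS n τ} {a b : AhS n τ} (ha : HasLimit F a)
    (hb : HasLimit F b) : a = b := by
  refine SkewMonoidAlgebra.ext fun w => ?_
  refine MvPolynomial.ext (R := HolH n τ) _ _ fun k => ?_
  refine PowerSeries.ext fun m => Hol.hext fun x => ?_
  exact tendsto_nhds_unique (ha w k m x) (hb w k m x)

open Classical in
/-- The limit at `λ = 0` in `A_0 * S_n` (and `0` if there is none). -/
noncomputable def limC (F : regSet n τ → A0S n τ) : A0S n τ :=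
  if h : ∃ a, HasLimitC F a then h.choose else 0

open Classical in
/-- The limit at `λ = 0` in `A_ħ * S_n` (and `0` if there is none). -/
noncomputable def limQ (F : regSet n τ → AhS n τ) : AhS n τ :=
  if h : ∃ a, HasLimit F a then h.choose else 0

variable (τ) (κ : ℂ) (q : MvPolynomial (Fin n) ℂ)

/-- The classical rational Calogero–Moser Hamiltonian `Res q(y_1, …, y_n) ∈ A_0`, with
`y_i` the classical rational Dunkl operators. -/
noncomputable def ratHam : A0 n τ := res (subst (ratDunkl κ) q)

/-- The rational Hamiltonian of `q` at `x = λ`, with the classical elliptic Dunkl operators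
`y_i(λ)` substituted for the momenta. -/
noncomputable def ellFamily (l : regSet n τ) : A0S n τ :=
  subst (ellDunklC κ l) ((ratHam τ κ q).evalAt l)

/-- The classical elliptic Calogero–Moser Hamiltonian `L_{q,c} = Res lim_{λ → 0}` of
`ellFamily`. -/
noncomputable def ellHam : A0 n τ := res (limC (ellFamily τ κ q))

/-- `L_{q,c}(λ, y)`: the elliptic Hamiltonian of `q` at `x = λ`, with the quantum elliptic Dunkl
operators `y_i(λ)` substituted for the momenta. -/
noncomputable def quantFamily (l : regSet n τ) : AhS n τ :=
  subst (ellDunkl κ l) ((ellHam τ κ q).evalAt l)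

/-- `H_q = Res lim_{λ → 0} L_{q,c}(λ, y) ∈ A_ħ`. -/
noncomputable def quantHam : Ah n τ := res (limQ (quantFamily τ κ q))

end Hamiltonians

section Equilibrium

variable {n : ℕ} {τ : UpperHalfPlane}

/-- The phase space: pairs `(x, p)` of positions and momenta. -/
abbrev Phase (n : ℕ) : Type := (Fin n → ℂ) × (Fin n → ℂ)

open Classical in
/-- An element of `A_0` as a function of `(x, p)`, `x` regular (extended by `0`). -/
noncomputable def A0.toFun (F : A0 n τ) (z : Phase n) : ℂ :=
  if h : z.1 ∈ regSet n τ then MvPolynomial.eval z.2 (F.evalAt ⟨z.1, h⟩) else 0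

/-- `∂F/∂x_i`. -/
noncomputable def dx (i : Fin n) (F : Phase n → ℂ) (z : Phase n) : ℂ :=
  fderiv ℂ F z (Pi.single i 1, 0)

/-- `∂F/∂p_i`. -/
noncomputable def dp (i : Fin n) (F : Phase n → ℂ) (z : Phase n) : ℂ :=
  fderiv ℂ F z (0, Pi.single i 1)

/-- The Poisson bracket, normalised by `{p_i, x_i} = 1`. -/
noncomputable def poisson (F G : Phase n → ℂ) (z : Phase n) : ℂ :=
  ∑ i, (dp i F z * dx i G z - dx i F z * dp i G z)

/-- `z` is an equilibrium of the Hamiltonian `F`: the Hamiltonian vector field of `F` is defined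
at `z` and vanishes there. -/
def IsEquilibrium (F : Phase n → ℂ) (z : Phase n) : Prop :=
  DifferentiableAt ℂ F z ∧ ∀ i, dx i F z = 0 ∧ dp i F z = 0

/-- `(x^*, p^*)`: `x_i = i/n` for `i = 1, …, n` and `p_i = 0`. -/
noncomputable def equilibriumPoint (n : ℕ) : Phase n :=
  (fun i => ((i : ℕ) + 1 : ℂ) / n, 0)

/-- The traceless combination `ξ_i = e_i - (e_1 + ⋯ + e_n) / n`. -/
noncomputable def xi (i : Fin n) : MvPolynomial (Fin n) ℂ :=
  MvPolynomial.X i - MvPolynomial.C (1 / (n : ℂ)) * ∑ j, MvPolynomial.X j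

/-- The symmetric polynomials in `ξ_1, …, ξ_n`. -/
noncomputable def tracelessSymmetric (n : ℕ) : Subalgebra ℂ (MvPolynomial (Fin n) ℂ) :=
  (MvPolynomial.symmetricSubalgebra (Fin n) ℂ).map (MvPolynomial.aeval xi)

end Equilibrium

end EllipticCM

/-!
# Equilibria of the elliptic Calogero–Moser Hamiltonians

*Existence of the limits.* Both limits have the form `lim_{λ → 0} F(λ, y(λ))` with `F ∈ A_0`
symmetric, and the point is that `F(λ, y(λ))` has no singularity at `λ = 0` although every `y_i(λ)`
has poles along the hyperplanes `λ_i = λ_j`. The algebra `A_0 * S_n` acts on functions `G(λ)` with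
values in `A_ħ * S_n` (`actFun`): a function of `(x, p)` acts as multiplication by its value at
`(λ, y(λ))`, a permutation `w` as `G(λ) ↦ w G(w⁻¹ λ)`. This is an action because the `y_i(λ)`
commute (`ellDunkl_commute`), which in turn comes from the three-term identity of the σ-function
(`sigma_three_term`, `phi_fay`). A Dunkl operator in the variable `λ`, that is
`p_i - κ ∑_j k(λ_i - λ_j) s_{ij}` with a kernel `k(μ) = 1/μ + …`, acts without creating poles: the
pole of `y_i(λ)` at `λ_i = λ_j` is cancelled by that of the kernel (`preservesAnalytic_dunkl`). On
equivariant functions an element `h` of `A_0 * S_n` acts as multiplication by `F(λ, y(λ))` with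
`F = Res h` (`actFun_of_equivariant`). So, when `h` is a polynomial in Dunkl operators,
multiplication by `F(λ, y(λ))` maps analytic equivariant functions to analytic functions. Near a
generic point of a hyperplane `λ_a = λ_b`, two such functions suffice to see that `F(λ, y(λ))`
extends over the hyperplane (`exists_local_extension`). The remaining singularities have codimension
two. They are removed by replacing `F(λ, y(λ))` with its mean over the circles
`λ + s v`, `|s| = 1`, which for a suitable `v` avoid all singularities when `λ` is small
(`exists_extension_at_zero`).

For the first limit `F` is the rational Hamiltonian, the residue of a polynomial in the rational
Dunkl operators. The resulting elliptic Hamiltonian is a circle mean of residues of polynomials in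
the classical elliptic Dunkl operators, so the same argument applies to it and gives the second
limit (`exists_hasLimitC_ellFamily`, `exists_hasLimit_quantFamily`).

*Symmetries.* The classical limit `H` of the Hamiltonian is invariant under simultaneous permutations
of positions and momenta. When some positions are translated by the period `1`, the coefficients of
the elliptic Dunkl operators acquire factors that tend to `1` as `λ → 0`, so `H` is periodic
(`evalAt_addReg_of_hasLimitC`). It depends on differences of positions only. Since the symmetric
polynomial is one in traceless combinations, `∑ ∂/∂p_i` kills `H` (`A0S.der_subst`).

*Equilibrium.* The cyclic permutation of the particles followed by a translation fixes the point
`x_i = i/n`, `p_i = 0`, and `H` is invariant under it. Hence all `∂H/∂x_i` agree at this point,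
and so do all `∂H/∂p_i`. The sums of both families vanish by translation invariance in
`x` and in `p` (`isEquilibrium_of_invariant`).
-/

namespace EllipticCM

/-! ### Quasi-periodicity and the three-term identity of the σ-function -/

section SigmaFunction

variable (L : PeriodPair)

/-- The entire function `σ(z) / z`. -/
noncomputable def sigmaTail (z : ℂ) : ℂ :=
  ∏' l : {l : L.lattice // l ≠ 0},
    (1 - z / (l.1 : ℂ)) * Complex.exp (z / (l.1 : ℂ) + (z / (l.1 : ℂ)) ^ 2 / 2)

theorem sigma_eq_mul_sigmaTail (z : ℂ) : sigma L z = z * sigmaTail L z := rfl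

theorem sigmaTail_zero : sigmaTail L 0 = 1 := by simp [sigmaTail]

theorem sigmaTail_neg (z : ℂ) : sigmaTail L (-z) = sigmaTail L z := by
  let e : {l : L.lattice // l ≠ 0} ≃ {l : L.lattice // l ≠ 0} :=
    (Equiv.neg L.lattice).subtypeEquiv fun l => by simp
  rw [sigmaTail, sigmaTail, ← e.tprod_eq]
  refine tprod_congr fun l => ?_
  have : ((e l).1 : ℂ) = -(l.1 : ℂ) := by simp [e]
  rw [this]
  ring_nf

theorem sigma_neg (z : ℂ) : sigma L (-z) = -sigma L z := by
  rw [sigma_eq_mul_sigmaTail, sigma_eq_mul_sigmaTail, sigmaTail_neg]; ring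

theorem tendstoLocallyUniformlyOn_sigmaTail (r : ℝ) :
    TendstoLocallyUniformlyOn (fun (s : Finset {l : L.lattice // l ≠ 0}) z =>
      ∏ l ∈ s, (1 - z / (l.1 : ℂ)) * Complex.exp (z / (l.1 : ℂ) + (z / (l.1 : ℂ)) ^ 2 / 2))
      (sigmaTail L) atTop (Metric.ball 0 r) := by
  have h := Summable.hasProdLocallyUniformlyOn_one_add (K := Metric.ball (0 : ℂ) r)
    (f := fun (l : {l : L.lattice // l ≠ 0}) z =>
      (1 - z / (l.1 : ℂ)) * Complex.exp (z / (l.1 : ℂ) + (z / (l.1 : ℂ)) ^ 2 / 2) - 1)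
    Metric.isOpen_ball ((summable_lattice L).mul_left (10 * r ^ 3))
    (eventually_factor_bound L r) (fun i => by fun_prop)
  simp only [add_sub_cancel] at h
  rw [hasProdLocallyUniformlyOn_iff_tendstoLocallyUniformlyOn] at h
  exact h

theorem differentiable_sigmaTail : Differentiable ℂ (sigmaTail L) := by
  intro z
  have hz : z ∈ Metric.ball (0 : ℂ) (‖z‖ + 1) := by simp
  refine ((tendstoLocallyUniformlyOn_sigmaTail L (‖z‖ + 1)).differentiableOn
    (Eventually.of_forall fun s => ?_) Metric.isOpen_ball).differentiableAt
    (Metric.isOpen_ball.mem_nhds hz)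
  fun_prop

theorem analyticAt_sigmaTail (z : ℂ) : AnalyticAt ℂ (sigmaTail L) z :=
  (differentiable_sigmaTail L).analyticAt z

theorem sigmaTail_ne_zero {z : ℂ} (hz : z ∈ L.lattice → z = 0) : sigmaTail L z ≠ 0 := by
  by_cases h : z = 0
  · rw [h, sigmaTail_zero]; exact one_ne_zero
  · have := sigma_ne_zero L (z := z) fun h' => h (hz h')
    rw [sigma_eq_mul_sigmaTail] at this
    exact right_ne_zero_of_mul this

theorem sigma_zero : sigma L 0 = 0 := by rw [sigma_eq_mul_sigmaTail, zero_mul]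

theorem deriv_sigma_zero : deriv (sigma L) 0 = 1 := by
  have h : HasDerivAt (fun z => z * sigmaTail L z) (1 * sigmaTail L 0 + 0 * deriv (sigmaTail L) 0) 0 :=
    (hasDerivAt_id (0 : ℂ)).mul (differentiable_sigmaTail L 0).hasDerivAt
  rw [sigmaTail_zero, one_mul, zero_mul, add_zero] at h
  exact h.deriv

theorem countable_lattice : (L.lattice : Set ℂ).Countable :=
  Set.countable_coe_iff.mp (inferInstanceAs (Countable L.lattice))

theorem isOpen_compl_lattice : IsOpen (L.lattice : Set ℂ)ᶜ := L.isClosed_lattice.isOpen_compl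

theorem isPreconnected_compl_lattice : IsPreconnected (L.lattice : Set ℂ)ᶜ :=
  ((countable_lattice L).isPathConnected_compl_of_one_lt_rank
    (by rw [Complex.rank_real_complex]; norm_num)).isConnected.isPreconnected

theorem deriv_logDeriv_of_analyticAt {f : ℂ → ℂ} {z : ℂ} (hf : AnalyticAt ℂ f z) (h0 : f z ≠ 0) :
    deriv (logDeriv f) z = (deriv (deriv f) z * f z - deriv f z ^ 2) / f z ^ 2 := by
  have := hf.deriv.differentiableAt.hasDerivAt.div hf.differentiableAt.hasDerivAt h0
  rw [show logDeriv f = deriv f / f from rfl, this.deriv]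
  ring

/-- The second logarithmic derivative of `σ` is `-℘`: it is computed for the finite partial products
of `σ(z)/z`, and the derivatives converge along with the products. -/
theorem deriv_logDeriv_sigma {z : ℂ} (hz : z ∉ L.lattice) :
    deriv (logDeriv (sigma L)) z = -L.weierstrassP z := by
  have hz0 : z ≠ 0 := fun h => hz (h ▸ L.lattice.zero_mem)
  set r := ‖z‖ + 1
  have hzr : z ∈ Metric.ball (0 : ℂ) r := by simp [r]
  set f : Finset {l : L.lattice // l ≠ 0} → ℂ → ℂ := fun s z =>
      ∏ l ∈ s, (1 - z / (l.1 : ℂ)) * Complex.exp (z / (l.1 : ℂ) + (z / (l.1 : ℂ)) ^ 2 / 2) with hf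
  have hd : ∀ s, Differentiable ℂ (f s) := fun s => by simp only [hf]; fun_prop
  have hne : ∀ (l : {l : L.lattice // l ≠ 0}) (w : ℂ), w ∉ L.lattice →
      (l.1 : ℂ) ≠ 0 ∧ (l.1 : ℂ) - w ≠ 0 := by
    intro l w hw
    refine ⟨by simpa using l.2, fun h => hw ?_⟩
    rw [← sub_eq_zero.mp h]; exact l.1.2
  have h0 := tendstoLocallyUniformlyOn_sigmaTail L r
  have h1 := h0.deriv (Eventually.of_forall fun s => (hd s).differentiableOn) Metric.isOpen_ball
  have h2 := h1.deriv (Eventually.of_forall fun s => fun w _ =>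
    ((hd s).analyticAt w).deriv.differentiableAt.differentiableWithinAt) Metric.isOpen_ball
  have ht0 : sigmaTail L z ≠ 0 := sigmaTail_ne_zero L fun h => absurd h hz
  have hlim : Tendsto (fun s => deriv (logDeriv (f s)) z) atTop
      (𝓝 (deriv (logDeriv (sigmaTail L)) z)) := by
    rw [deriv_logDeriv_of_analyticAt (analyticAt_sigmaTail L z) ht0]
    refine Tendsto.congr' ?_ ((((h2.tendsto_at hzr).mul (h0.tendsto_at hzr)).sub
      ((h1.tendsto_at hzr).pow 2)).div ((h0.tendsto_at hzr).pow 2) (pow_ne_zero 2 ht0))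
    filter_upwards [(h0.tendsto_at hzr).eventually_ne ht0] with s hs
    rw [deriv_logDeriv_of_analyticAt ((hd s).analyticAt z) hs]
    rfl
  have hfin : ∀ s, deriv (logDeriv (f s)) z
      = ∑ l ∈ s, -(1 / (z - (l.1 : ℂ)) ^ 2 - 1 / (l.1 : ℂ) ^ 2) := by
    intro s
    have hlog : ∀ w ∉ L.lattice, logDeriv (f s) w
        = ∑ l ∈ s, (1 / (w - (l.1 : ℂ)) + 1 / (l.1 : ℂ) + w / (l.1 : ℂ) ^ 2) := by
      intro w hw
      rw [hf]
      refine (logDeriv_prod ?_ ?_).trans ?_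
      rotate_left 2
      · refine Finset.sum_congr rfl fun l _ => ?_
        obtain ⟨hl, hlw⟩ := hne l w hw
        have hA : HasDerivAt (fun z : ℂ => 1 - z / (l.1 : ℂ)) (-(1 / (l.1 : ℂ))) w := by
          simpa using ((hasDerivAt_id w).div_const (l.1 : ℂ)).const_sub 1
        have hB : HasDerivAt (fun z : ℂ => z / (l.1 : ℂ) + (z / (l.1 : ℂ)) ^ 2 / 2)
            (1 / (l.1 : ℂ) + w / (l.1 : ℂ) ^ 2) w := by
          have h1 := (hasDerivAt_id w).div_const (l.1 : ℂ)
          have := h1.add ((h1.pow 2).div_const 2)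
          refine this.congr_deriv ?_
          simp only [id, Nat.add_one_sub_one, pow_one, Nat.cast_ofNat]
          field_simp
        have hAB := hA.mul hB.cexp
        rw [logDeriv_apply]
        erw [hAB.deriv]
        have h1w : 1 - w / (l.1 : ℂ) ≠ 0 := by
          rw [one_sub_div hl]; exact div_ne_zero hlw hl
        have hwl : w - (l.1 : ℂ) ≠ 0 := by rw [← neg_sub]; exact neg_ne_zero.mpr hlw
        have hE := Complex.exp_ne_zero (w / (l.1 : ℂ) + (w / (l.1 : ℂ)) ^ 2 / 2)
        rw [div_eq_iff (mul_ne_zero h1w hE)]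
        generalize Complex.exp (w / (l.1 : ℂ) + (w / (l.1 : ℂ)) ^ 2 / 2) = E at hE
        field_simp
        ring
      · intro l _
        obtain ⟨hl, hlw⟩ := hne l w hw
        refine mul_ne_zero ?_ (Complex.exp_ne_zero _)
        rw [one_sub_div hl]; exact div_ne_zero hlw hl
      · intro l _; fun_prop
    have hev : logDeriv (f s) =ᶠ[𝓝 z]
        fun w => ∑ l ∈ s, (1 / (w - (l.1 : ℂ)) + 1 / (l.1 : ℂ) + w / (l.1 : ℂ) ^ 2) := by
      filter_upwards [(isOpen_compl_lattice L).mem_nhds hz] with w hw using hlog w hw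
    rw [hev.deriv_eq]
    have : HasDerivAt (fun w => ∑ l ∈ s, (1 / (w - (l.1 : ℂ)) + 1 / (l.1 : ℂ) + w / (l.1 : ℂ) ^ 2))
        (∑ l ∈ s, -(1 / (z - (l.1 : ℂ)) ^ 2 - 1 / (l.1 : ℂ) ^ 2)) z := by
      refine HasDerivAt.fun_sum fun l _ => ?_
      obtain ⟨hl, hlw⟩ := hne l z hz
      have hzl : z - (l.1 : ℂ) ≠ 0 := by rw [← neg_sub]; exact neg_ne_zero.mpr hlw
      have h1 := (((hasDerivAt_id z).sub_const (l.1 : ℂ)).fun_inv hzl)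
      have := (h1.add_const (1 / (l.1 : ℂ))).add ((hasDerivAt_id z).div_const ((l.1 : ℂ) ^ 2))
      refine (this.congr_of_eventuallyEq (Eventually.of_forall fun w => ?_)).congr_deriv ?_
      · simp
      · simp only [id]; ring
    exact this.deriv
  -- in the series for `℘` the term of the zero lattice vector is `1/z²`; the others are summed here
  have hP : Tendsto (fun s : Finset {l : L.lattice // l ≠ 0} =>
      ∑ l ∈ s, -(1 / (z - (l.1 : ℂ)) ^ 2 - 1 / (l.1 : ℂ) ^ 2)) atTop
      (𝓝 (-(L.weierstrassP z - 1 / z ^ 2))) := by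
    have h := (L.hasSum_weierstrassP z)
    have h' : HasSum (fun l : {l : L.lattice // l ≠ 0} =>
        1 / (z - (l.1 : ℂ)) ^ 2 - 1 / (l.1 : ℂ) ^ 2) (L.weierstrassP z - 1 / z ^ 2) := by
      have := (h.update 0 0)
      simp only [ZeroMemClass.coe_zero, sub_zero, zero_sub] at this
      have h2 := (hasSum_subtype_iff_of_support_subset (s := {l : L.lattice | l ≠ 0}) ?_).mpr this
      · have e : -(1 / z ^ 2 - 1 / (0 : ℂ) ^ 2) + L.weierstrassP z
            = L.weierstrassP z - 1 / z ^ 2 := by simp; ring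
        rw [e] at h2
        have e2 := funext fun l : {l : L.lattice // l ≠ 0} => (Function.update_of_ne l.2 (0 : ℂ)
          fun l : L.lattice => 1 / (z - (l : ℂ)) ^ 2 - 1 / (l : ℂ) ^ 2)
        exact (show HasSum _ _ from e2 ▸ h2)
      · intro l hl h0
        rw [h0] at hl
        simp at hl
    exact h'.neg
  have key : deriv (logDeriv (sigmaTail L)) z = -(L.weierstrassP z - 1 / z ^ 2) := by
    refine tendsto_nhds_unique hlim (hP.congr fun s => (hfin s).symm)
  have hlogev : logDeriv (sigma L) =ᶠ[𝓝 z] fun w => 1 / w + logDeriv (sigmaTail L) w := by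
    filter_upwards [(isOpen_compl_lattice L).mem_nhds hz] with w hw
    have hw0 : w ≠ 0 := fun h => hw (h ▸ L.lattice.zero_mem)
    have := logDeriv_mul (f := id) (g := sigmaTail L) w hw0
      (sigmaTail_ne_zero L fun h => absurd h hw) differentiableAt_id (differentiable_sigmaTail L w)
    rw [logDeriv_id] at this
    exact this
  rw [hlogev.deriv_eq]
  have hlt : DifferentiableAt ℂ (logDeriv (sigmaTail L)) z :=
    ((analyticAt_sigmaTail L z).deriv.div (analyticAt_sigmaTail L z) ht0).differentiableAt
  have := ((hasDerivAt_inv hz0).add hlt.hasDerivAt)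
  have h3 : HasDerivAt (fun w => 1 / w + logDeriv (sigmaTail L) w)
      (-(z ^ 2)⁻¹ + deriv (logDeriv (sigmaTail L)) z) z :=
    this.congr_of_eventuallyEq (Eventually.of_forall fun w => by simp)
  rw [h3.deriv, key]
  ring

/-- Quasi-periodicity: `σ(z + ω) = c e^{ηz} σ(z)` for every period `ω`. Since `℘` is periodic, the
logarithmic derivative of `σ` changes by a constant `η` under translation by `ω`, and then
`σ(z + ω) / (e^{ηz} σ(z))` has derivative zero. -/
theorem exists_sigma_add_period {ω : ℂ} (hω : ω ∈ L.lattice) :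
    ∃ c η : ℂ, c ≠ 0 ∧ ∀ z, sigma L (z + ω) = c * Complex.exp (η * z) * sigma L z := by
  set s : Set ℂ := (L.lattice : Set ℂ)ᶜ
  have hs : IsOpen s := isOpen_compl_lattice L
  have hmem : ∀ z ∈ s, z + ω ∈ s := fun z hz h => hz ((add_mem_cancel_right hω).mp h)
  have han : ∀ z ∈ s, AnalyticAt ℂ (logDeriv (sigma L)) z := fun z hz =>
    (analyticAt_sigma L z).deriv.div (analyticAt_sigma L z) (sigma_ne_zero L hz)
  have hshift : ∀ z ∈ s, HasDerivAt (fun z => logDeriv (sigma L) (z + ω))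
      (deriv (logDeriv (sigma L)) (z + ω)) z := fun z hz =>
    (han _ (hmem z hz)).differentiableAt.hasDerivAt.comp_add_const z ω
  -- `logDeriv σ` changes by a constant, its derivative `-℘` being periodic
  obtain ⟨η, hη⟩ := hs.exists_is_const_of_deriv_eq_zero (isPreconnected_compl_lattice L)
    (f := fun z => logDeriv (sigma L) (z + ω) - logDeriv (sigma L) z)
    (fun z hz => ((hshift z hz).differentiableAt.sub
      (han z hz).differentiableAt).differentiableWithinAt)
    (fun z hz => by
      have h := (hshift z hz).sub (han z hz).differentiableAt.hasDerivAt
      refine h.deriv.trans ?_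
      rw [deriv_logDeriv_sigma L hz, deriv_logDeriv_sigma L (hmem z hz),
        L.weierstrassP_add_coe z ⟨ω, hω⟩, sub_self, Pi.zero_apply])
  have hd1 : ∀ z, HasDerivAt (fun z => sigma L (z + ω)) (deriv (sigma L) (z + ω)) z := fun z =>
    (differentiable_sigma L _).hasDerivAt.comp_add_const z ω
  have hd2 : ∀ z, HasDerivAt (fun z => Complex.exp (η * z) * sigma L z)
      (Complex.exp (η * z) * (η * 1) * sigma L z + Complex.exp (η * z) * deriv (sigma L) z) z :=
    fun z => (((hasDerivAt_id z).const_mul η).cexp).mul (differentiable_sigma L z).hasDerivAt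
  have hne2 : ∀ z ∈ s, Complex.exp (η * z) * sigma L z ≠ 0 := fun z hz =>
    mul_ne_zero (Complex.exp_ne_zero _) (sigma_ne_zero L hz)
  -- hence `σ(z + ω) / (e^{ηz} σ(z))` is constant off the lattice
  obtain ⟨c, hc⟩ := hs.exists_is_const_of_deriv_eq_zero (isPreconnected_compl_lattice L)
    (f := fun z => sigma L (z + ω) / (Complex.exp (η * z) * sigma L z))
    (fun z hz => ((hd1 z).differentiableAt.div (hd2 z).differentiableAt
      (hne2 z hz)).differentiableWithinAt)
    (fun z hz => by
      refine ((hd1 z).fun_div (hd2 z) (hne2 z hz)).deriv.trans ?_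
      have h1 := hη z hz
      simp only [logDeriv_apply] at h1
      have h2 := sigma_ne_zero L hz
      have h3 := sigma_ne_zero L (hmem z hz)
      have hE := Complex.exp_ne_zero (η * z)
      rw [div_sub_div _ _ h3 h2, div_eq_iff (mul_ne_zero h3 h2)] at h1
      rw [Pi.zero_apply, div_eq_zero_iff]
      left
      linear_combination Complex.exp (η * z) * h1)
  have heq : ∀ z ∈ s, sigma L (z + ω) = c * Complex.exp (η * z) * sigma L z := fun z hz => by
    have := hc z hz
    rw [div_eq_iff (hne2 z hz)] at this
    rw [this]; ring
  have hdense : Dense s := (countable_lattice L).dense_compl ℂ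
  have hcont := (differentiable_sigma L).continuous
  refine ⟨c, η, ?_, fun z => congrFun (Continuous.ext_on hdense
    (f := fun z => sigma L (z + ω)) (g := fun z => c * Complex.exp (η * z) * sigma L z)
    (by fun_prop) (by fun_prop) heq) z⟩
  rintro rfl
  obtain ⟨z, hz⟩ := hdense.nonempty
  have := heq z hz
  simp only [zero_mul] at this
  exact sigma_ne_zero L (hmem z hz) this

theorem sigma_eq_zero_iff {z : ℂ} : sigma L z = 0 ↔ z ∈ L.lattice := by
  refine ⟨fun h => by_contra fun hz => sigma_ne_zero L hz h, fun hz => ?_⟩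
  obtain ⟨c, η, -, h⟩ := exists_sigma_add_period L hz
  have := h 0
  rwa [sigma_zero, mul_zero, zero_add] at this

/-- The zeros of `σ` are simple, by quasi-periodicity from `σ'(0) = 1`. -/
theorem deriv_sigma_ne_zero {z : ℂ} (hz : z ∈ L.lattice) : deriv (sigma L) z ≠ 0 := by
  obtain ⟨c, η, hc, h⟩ := exists_sigma_add_period L hz
  have h1 : HasDerivAt (fun w => sigma L (w + z)) (deriv (sigma L) (0 + z)) 0 :=
    (differentiable_sigma L _).hasDerivAt.comp_add_const 0 z
  have h2 : HasDerivAt (fun w => c * Complex.exp (η * w) * sigma L w)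
      (c * (Complex.exp (η * 0) * (η * 1)) * sigma L 0
        + c * Complex.exp (η * 0) * deriv (sigma L) 0) 0 :=
    ((((hasDerivAt_id (0 : ℂ)).const_mul η).cexp).const_mul c).mul
      (differentiable_sigma L 0).hasDerivAt
  have h3 := h1.unique (h2.congr_of_eventuallyEq (Eventually.of_forall h))
  rw [zero_add, sigma_zero, deriv_sigma_zero, mul_zero η, Complex.exp_zero] at h3
  rw [h3]
  simpa using hc

/-- An entire function that vanishes at the zeros of an entire function with simple zeros is
divisible by it. -/
theorem exists_entire_quotient {f g : ℂ → ℂ} (hf : Differentiable ℂ f) (hg : Differentiable ℂ g)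
    (hg0 : ∀ z, g z = 0 → f z = 0 ∧ deriv g z ≠ 0) :
    ∃ Q : ℂ → ℂ, Differentiable ℂ Q ∧ ∀ z, f z = Q z * g z := by
  -- the value of the quotient at a zero of `g` is given by the rule of de l'Hôpital
  refine ⟨fun z => if g z = 0 then deriv f z / deriv g z else f z / g z, fun z => ?_, fun z => ?_⟩
  · by_cases hz : g z = 0
    · obtain ⟨hfz, hgz⟩ := hg0 z hz
      have hdf : DifferentiableAt ℂ (dslope f z) z :=
        ((Complex.differentiableOn_dslope (c := z) Filter.univ_mem).mpr
          hf.differentiableOn).differentiableAt Filter.univ_mem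
      have hdg : DifferentiableAt ℂ (dslope g z) z :=
        ((Complex.differentiableOn_dslope (c := z) Filter.univ_mem).mpr
          hg.differentiableOn).differentiableAt Filter.univ_mem
      have hgz' : dslope g z z ≠ 0 := by rwa [dslope_same]
      refine (hdf.div hdg hgz').congr_of_eventuallyEq ?_
      filter_upwards [hdg.continuousAt.eventually_ne hgz'] with w hw
      by_cases hwz : w = z
      · subst hwz
        rw [if_pos hz, Pi.div_apply, dslope_same, dslope_same]
      · have h1 : g w = (w - z) * dslope g z w := by
          have := sub_smul_dslope g z w
          rw [hz, sub_zero, smul_eq_mul] at this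
          exact this.symm
        have h2 : f w = (w - z) * dslope f z w := by
          have := sub_smul_dslope f z w
          rw [hfz, sub_zero, smul_eq_mul] at this
          exact this.symm
        have h3 : w - z ≠ 0 := sub_ne_zero.mpr hwz
        rw [if_neg (by rw [h1]; exact mul_ne_zero h3 hw), Pi.div_apply, h1, h2,
          mul_div_mul_left _ _ h3]
    · refine ((hf z).div (hg z) hz).congr_of_eventuallyEq ?_
      filter_upwards [(hg z).continuousAt.eventually_ne hz] with w hw
      rw [if_neg hw]; rfl
  · by_cases hz : g z = 0
    · rw [(hg0 z hz).1, hz, mul_zero]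
    · simp only [if_neg hz]
      rw [div_mul_cancel₀ _ hz]

/-- Liouville's theorem for doubly periodic entire functions. -/
theorem apply_eq_apply_of_periodic {Q : ℂ → ℂ} (hQ : Differentiable ℂ Q)
    (hper : ∀ z, ∀ ω ∈ L.lattice, Q (z + ω) = Q z) (z w : ℂ) : Q z = Q w := by
  refine hQ.apply_eq_apply_of_bounded ?_ z w
  have hb := (ZSpan.fundamentalDomain_isBounded L.basis).isCompact_closure
  refine (hb.image hQ.continuous).isBounded.subset ?_
  rintro _ ⟨z, rfl⟩
  refine ⟨ZSpan.fract L.basis z, subset_closure (ZSpan.fract_mem_fundamentalDomain _ _), ?_⟩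
  have hfl : ((ZSpan.floor L.basis z : Submodule.span ℤ (Set.range L.basis)) : ℂ) ∈ L.lattice := by
    rw [L.lattice_eq_span_range_basis]; exact (ZSpan.floor L.basis z).2
  have := hper (ZSpan.fract L.basis z) _ hfl
  rw [← this, ZSpan.fract_apply, sub_add_cancel]

/-- The Weierstrass three-term identity for `σ`. As functions of `a`, the left-hand side and
`σ(a + b) σ(a - b)` have the same multipliers under translation by periods, and for generic `b` the
first vanishes at the (simple) zeros of the second. The quotient is therefore a constant, which is
zero because the left-hand side vanishes at `a = c`. -/
theorem sigma_three_term (a b c d : ℂ) :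
    sigma L (a + b) * sigma L (a - b) * (sigma L (c + d) * sigma L (c - d))
      + sigma L (b + c) * sigma L (b - c) * (sigma L (a + d) * sigma L (a - d))
      + sigma L (c + a) * sigma L (c - a) * (sigma L (b + d) * sigma L (b - d)) = 0 := by
  have hσ := differentiable_sigma L
  have hcont := hσ.continuous
  have hodd : ∀ u v : ℂ, sigma L (u - v) = -sigma L (v - u) := fun u v => by
    rw [← sigma_neg, neg_sub]
  have generic : ∀ b : ℂ, 2 * b ∉ L.lattice → c + b ∉ L.lattice → c - b ∉ L.lattice →
      sigma L (a + b) * sigma L (a - b) * (sigma L (c + d) * sigma L (c - d))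
      + sigma L (b + c) * sigma L (b - c) * (sigma L (a + d) * sigma L (a - d))
      + sigma L (c + a) * sigma L (c - a) * (sigma L (b + d) * sigma L (b - d)) = 0 := by
    intro b hb hcb hcb'
    set E : ℂ → ℂ := fun a =>
      sigma L (a + b) * sigma L (a - b) * (sigma L (c + d) * sigma L (c - d))
      + sigma L (b + c) * sigma L (b - c) * (sigma L (a + d) * sigma L (a - d))
      + sigma L (c + a) * sigma L (c - a) * (sigma L (b + d) * sigma L (b - d)) with hE
    set g : ℂ → ℂ := fun a => sigma L (a + b) * sigma L (a - b) with hg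
    have hEd : Differentiable ℂ E := by simp only [hE]; fun_prop
    have hgd : Differentiable ℂ g := by simp only [hg]; fun_prop
    -- `E` and `g` are multiplied by the same factor `e`
    have hper : ∀ ω ∈ L.lattice, ∃ e : ℂ → ℂ, (∀ a, e a ≠ 0) ∧
        (∀ a, E (a + ω) = e a * E a) ∧ ∀ a, g (a + ω) = e a * g a := by
      intro ω hω
      obtain ⟨k, η, hk, h⟩ := exists_sigma_add_period L hω
      have hmul : ∀ a t : ℂ, sigma L (a + ω + t) * sigma L (a + ω - t)
          = k ^ 2 * Complex.exp (2 * η * a) * (sigma L (a + t) * sigma L (a - t)) := by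
        intro a t
        rw [show a + ω + t = (a + t) + ω by ring, show a + ω - t = (a - t) + ω by ring, h, h,
          show 2 * η * a = η * (a + t) + η * (a - t) by ring, Complex.exp_add]
        ring
      refine ⟨fun a => k ^ 2 * Complex.exp (2 * η * a), fun a =>
        mul_ne_zero (pow_ne_zero 2 hk) (Complex.exp_ne_zero _), fun a => ?_, fun a => hmul a b⟩
      have h1 := hmul a b
      have h2 := hmul a d
      have h3 := hmul a c
      simp only [hE]
      rw [h1, h2, hodd c (a + ω), hodd c a, add_comm c (a + ω), add_comm c a]
      linear_combination (-(sigma L (b + d) * sigma L (b - d))) * h3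
    -- modulo periods, `b` and `-b` are the only zeros of `g`
    have hEb : ∀ t, t = b ∨ t = -b → E t = 0 := by
      rintro t (rfl | rfl)
      · simp only [hE]
        rw [sub_self, sigma_zero, hodd t c, add_comm c t]; ring
      · simp only [hE]
        rw [neg_add_cancel, sigma_zero, sub_neg_eq_add, ← sub_eq_add_neg,
          show -b + d = -(b - d) by ring, show -b - d = -(b + d) by ring, sigma_neg, sigma_neg,
          hodd b c, add_comm b c]
        ring
    have hzero : ∀ t, g t = 0 → E t = 0 ∧ deriv g t ≠ 0 := by
      intro t ht
      have hder : deriv g t = deriv (sigma L) (t + b) * sigma L (t - b)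
          + sigma L (t + b) * deriv (sigma L) (t - b) :=
        (((hσ _).hasDerivAt.comp_add_const t b).mul ((hσ _).hasDerivAt.comp_sub_const t b)).deriv
      rcases mul_eq_zero.mp ht with h | h
      · have hl := (sigma_eq_zero_iff L).mp h
        have hl' : t - b ∉ L.lattice := fun h' => hb (by
          have := sub_mem hl h'
          rwa [show t + b - (t - b) = 2 * b by ring] at this)
        obtain ⟨e, -, he, -⟩ := hper _ hl
        constructor
        · have := he (-b)
          rwa [hEb _ (Or.inr rfl), mul_zero, show -b + (t + b) = t by ring] at this
        · rw [hder, h, zero_mul, add_zero]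
          exact mul_ne_zero (deriv_sigma_ne_zero L hl) (sigma_ne_zero L hl')
      · have hl := (sigma_eq_zero_iff L).mp h
        have hl' : t + b ∉ L.lattice := fun h' => hb (by
          have := sub_mem h' hl
          rwa [show t + b - (t - b) = 2 * b by ring] at this)
        obtain ⟨e, -, he, -⟩ := hper _ hl
        constructor
        · have := he b
          rwa [hEb _ (Or.inl rfl), mul_zero, show b + (t - b) = t by ring] at this
        · rw [hder, h, mul_zero, zero_add]
          exact mul_ne_zero (sigma_ne_zero L hl') (deriv_sigma_ne_zero L hl)
    obtain ⟨Q, hQ, hQe⟩ := exists_entire_quotient hEd hgd hzero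
    have hQper : ∀ z, ∀ ω ∈ L.lattice, Q (z + ω) = Q z := by
      intro z ω hω
      obtain ⟨e, he0, heE, heg⟩ := hper ω hω
      have hdense : Dense {z | g z ≠ 0} := by
        have h1 : {z | g z ≠ 0} = ((fun z => z + b) ⁻¹' (L.lattice : Set ℂ) ∪
            (fun z => z - b) ⁻¹' (L.lattice : Set ℂ))ᶜ := by
          ext z
          simp [hg, sigma_eq_zero_iff]
        rw [h1]
        exact Set.Countable.dense_compl ℂ
          (((countable_lattice L).preimage (add_left_injective b)).union
            ((countable_lattice L).preimage (sub_left_injective (b := b))))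
      have hQc := hQ.continuous
      refine congrFun (Continuous.ext_on hdense (f := fun z => Q (z + ω)) (g := Q)
        (by fun_prop) hQc fun z hz => ?_) z
      have h1 := hQe (z + ω)
      rw [heE, heg, hQe z] at h1
      have : e z * g z ≠ 0 := mul_ne_zero (he0 z) hz
      refine (mul_right_cancel₀ this ?_).symm
      linear_combination h1
    have hc0 : E c = 0 := by
      simp only [hE]
      rw [sub_self, sigma_zero, hodd b c, add_comm b c]; ring
    have hQc0 : Q c = 0 := by
      have h1 := hQe c
      rw [hc0] at h1
      exact (mul_eq_zero.mp h1.symm).resolve_right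
        (mul_ne_zero (sigma_ne_zero L hcb) (sigma_ne_zero L hcb'))
    have := hQe a
    rw [apply_eq_apply_of_periodic L hQ hQper a c, hQc0, zero_mul] at this
    exact this
  -- the excluded `b` form a countable set, so the identity extends by continuity
  have hdense : Dense ((fun b : ℂ => 2 * b) ⁻¹' (L.lattice : Set ℂ) ∪
      ((fun b => c + b) ⁻¹' (L.lattice : Set ℂ) ∪ (fun b => c - b) ⁻¹' (L.lattice : Set ℂ)))ᶜ :=
    Set.Countable.dense_compl ℂ
      (((countable_lattice L).preimage (mul_right_injective₀ two_ne_zero)).union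
        (((countable_lattice L).preimage (add_right_injective c)).union
          ((countable_lattice L).preimage (sub_right_injective (b := c)))))
  refine congrFun (Continuous.ext_on hdense (f := fun b =>
      sigma L (a + b) * sigma L (a - b) * (sigma L (c + d) * sigma L (c - d))
      + sigma L (b + c) * sigma L (b - c) * (sigma L (a + d) * sigma L (a - d))
      + sigma L (c + a) * sigma L (c - a) * (sigma L (b + d) * sigma L (b - d)))
    (g := fun _ => 0) (by fun_prop) continuous_const fun b hb => ?_) b
  simp only [Set.mem_compl_iff, Set.mem_union, Set.mem_preimage, SetLike.mem_coe, not_or] at hb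
  exact generic b hb.1 hb.2.1 hb.2.2

end SigmaFunction

/-! ### The function φ -/

section Phi

variable (τ : UpperHalfPlane)

theorem phi_neg_neg (μ z : ℂ) : phi τ (-μ) (-z) = -phi τ μ z := by
  simp only [phi]
  rw [show -z - -μ = -(z - μ) by ring, sigma_neg, sigma_neg, sigma_neg, sigma_neg]
  rw [← neg_div]
  congr 1
  ring

/-- The addition formula of Fay type behind the commutativity of the elliptic Dunkl operators; after
clearing denominators it is the three-term identity for `σ`. -/
theorem phi_fay {a b x y : ℂ} (ha : a ∉ (periods τ).lattice) (hb : b ∉ (periods τ).lattice)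
    (hab : a + b ∉ (periods τ).lattice) (hx : x ∉ (periods τ).lattice)
    (hy : y ∉ (periods τ).lattice) (hxy : x + y ∉ (periods τ).lattice) :
    phi τ a x * phi τ b (x + y) - phi τ b y * phi τ (a + b) x
      - phi τ (a + b) (x + y) * phi τ a (-y) = 0 := by
  -- the arguments solve the linear system for the twelve sums and differences listed below
  have h := sigma_three_term (periods τ) (x + (y - a - b) / 2) ((y - b + a) / 2)
    ((y + a + b) / 2) ((y - a - b) / 2)
  rw [show x + (y - a - b) / 2 + (y - b + a) / 2 = x + y - b by ring,
    show x + (y - a - b) / 2 - (y - b + a) / 2 = x - a by ring,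
    show (y + a + b) / 2 + (y - a - b) / 2 = y by ring,
    show (y + a + b) / 2 - (y - a - b) / 2 = a + b by ring,
    show (y - b + a) / 2 + (y + a + b) / 2 = y + a by ring,
    show (y - b + a) / 2 - (y + a + b) / 2 = -b by ring,
    show x + (y - a - b) / 2 + (y - a - b) / 2 = x + y - (a + b) by ring,
    show x + (y - a - b) / 2 - (y - a - b) / 2 = x by ring,
    show (y + a + b) / 2 + (x + (y - a - b) / 2) = x + y by ring,
    show (y + a + b) / 2 - (x + (y - a - b) / 2) = -(x - (a + b)) by ring,
    show (y - b + a) / 2 + (y - a - b) / 2 = y - b by ring,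
    show (y - b + a) / 2 - (y - a - b) / 2 = a by ring, sigma_neg, sigma_neg] at h
  have hs : ∀ {u}, u ∉ (periods τ).lattice → sigma (periods τ) u ≠ 0 :=
    fun hu => sigma_ne_zero _ hu
  have ha := hs ha
  have hb := hs hb
  have hab := hs hab
  have hx := hs hx
  have hy := hs hy
  have hxy := hs hxy
  simp only [phi]
  rw [show -y - a = -(y + a) by ring]
  simp only [sigma_neg]
  field_simp
  linear_combination h

/-- Quasi-periodicity of `φ(μ, z)` in `z`; the multiplier tends to `1` as `μ → 0`. -/
theorem exists_phi_add_period {ω : ℂ} (hω : ω ∈ (periods τ).lattice) :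
    ∃ η : ℂ, ∀ μ z, phi τ μ (z + ω) = Complex.exp (-η * μ) * phi τ μ z := by
  obtain ⟨c, η, hc, h⟩ := exists_sigma_add_period (periods τ) hω
  refine ⟨η, fun μ z => ?_⟩
  simp only [phi]
  rw [show z + ω - μ = (z - μ) + ω by ring, h, h,
    show η * (z - μ) = -η * μ + η * z by ring, Complex.exp_add]
  have hE := Complex.exp_ne_zero (η * z)
  rw [show c * (Complex.exp (-η * μ) * Complex.exp (η * z)) * sigma (periods τ) (z - μ) =
      (c * Complex.exp (η * z)) * (Complex.exp (-η * μ) * sigma (periods τ) (z - μ)) by ring,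
    show c * Complex.exp (η * z) * sigma (periods τ) z * sigma (periods τ) (-μ) =
      (c * Complex.exp (η * z)) * (sigma (periods τ) z * sigma (periods τ) (-μ)) by ring,
    mul_div_mul_left _ _ (mul_ne_zero hc hE), mul_div_assoc]

end Phi

/-! ### Integrals depending analytically on parameters -/

section ParametricIntegrals

variable {K F E : Type*} [TopologicalSpace K] [CompactSpace K]
  [NormedAddCommGroup F] [NormedSpace ℂ F] [NormedAddCommGroup E] [NormedSpace ℂ E]

/-- A continuous multilinear map applied pointwise to continuous functions on a compact space. -/
noncomputable def superposeMultilinear {m : ℕ} (p : F [×m]→L[ℂ] ℂ) :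
    C(K, F) [×m]→L[ℂ] C(K, ℂ) :=
  have hupd : ∀ [DecidableEq (Fin m)] (h : Fin m → C(K, F)) (i : Fin m) (g : C(K, F)) (t : K),
      (fun j => Function.update h i g j t) = Function.update (fun j => h j t) i (g t) := by
    intro _ h i g t
    ext j
    by_cases hj : j = i
    · subst hj; simp
    · simp [hj]
  MultilinearMap.mkContinuous
    { toFun := fun h => ⟨fun t => p fun i => h i t,
        p.cont.comp (continuous_pi fun i => (h i).continuous)⟩
      map_update_add' := fun h i a b => by
        ext t
        simp only [ContinuousMap.coe_mk, ContinuousMap.add_apply, hupd]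
        exact p.map_update_add _ _ _ _
      map_update_smul' := fun h i c a => by
        ext t
        simp only [ContinuousMap.coe_mk, ContinuousMap.smul_apply, hupd]
        exact p.map_update_smul _ _ _ _ }
    ‖p‖ fun h => by
      refine (ContinuousMap.norm_le _ (by positivity)).mpr fun t => ?_
      refine (p.le_opNorm _).trans ?_
      gcongr with i
      exact (h i).norm_coe_le_norm t

theorem norm_superposeMultilinear_le {m : ℕ} (p : F [×m]→L[ℂ] ℂ) :
    ‖(superposeMultilinear p : C(K, F) [×m]→L[ℂ] C(K, ℂ))‖ ≤ ‖p‖ := by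
  refine ContinuousMultilinearMap.opNorm_le_bound (norm_nonneg _) fun h => ?_
  refine (ContinuousMap.norm_le _ (by positivity)).mpr fun t => ?_
  refine (p.le_opNorm _).trans ?_
  gcongr with i
  exact (h i).norm_coe_le_norm t

/-- Superposition with an analytic function is analytic on spaces of continuous functions: apply the
power series of `f` at `z₀` pointwise. The radius `r` is the same for all compact spaces. -/
theorem exists_analyticAt_superposition {f : F → ℂ} {z₀ : F} (hf : AnalyticAt ℂ f z₀) :
    ∃ r > 0, ∀ (K : Type) [TopologicalSpace K] [CompactSpace K], ∃ G : C(K, F) → C(K, ℂ),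
      ∀ h : C(K, F), (∀ t, dist (h t) z₀ < r) → AnalyticAt ℂ G h ∧ ∀ t, G h t = f (h t) := by
  obtain ⟨p, R, hp⟩ := hf
  obtain ⟨r, hr0, hrR⟩ := ENNReal.lt_iff_exists_nnreal_btwn.mp hp.r_pos
  have hr : 0 < r := by exact_mod_cast hr0
  refine ⟨r, hr, fun K _ _ => ?_⟩
  let P : FormalMultilinearSeries ℂ C(K, F) C(K, ℂ) := fun m => superposeMultilinear (p m)
  have hrad : (r : ENNReal) < P.radius := by
    obtain ⟨r', hr', hr'R⟩ := ENNReal.lt_iff_exists_nnreal_btwn.mp hrR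
    refine hr'.trans_le ?_
    obtain ⟨C, -, hC⟩ := p.norm_mul_pow_le_of_lt_radius (hr'R.trans_le hp.r_le)
    refine P.le_radius_of_bound C fun m => ?_
    refine le_trans ?_ (hC m)
    gcongr
    exact norm_superposeMultilinear_le _
  have hP := P.hasFPowerSeriesOnBall (hr0.trans hrad)
  refine ⟨fun h => P.sum (h - ContinuousMap.const K z₀), fun h hh => ?_⟩
  have hmem : h - ContinuousMap.const K z₀ ∈ Metric.eball 0 P.radius := by
    have : ‖h - ContinuousMap.const K z₀‖ ≤ r :=
      (ContinuousMap.norm_le _ hr.le).mpr fun t => by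
        rw [ContinuousMap.sub_apply, ContinuousMap.const_apply, ← dist_eq_norm]
        exact (hh t).le
    rw [mem_eball_zero_iff]
    refine lt_of_le_of_lt ?_ hrad
    rw [enorm_eq_nnnorm]
    exact_mod_cast this
  constructor
  · exact AnalyticAt.comp (g := P.sum) (hP.analyticAt_of_mem hmem) (analyticAt_id.sub analyticAt_const)
  · intro t
    have h1 := hP.hasSum hmem
    rw [zero_add] at h1
    have h2 := h1.mapL (ContinuousMap.evalCLM ℂ t)
    have h3 := hp.hasSum (y := h t - z₀) (by
      rw [mem_eball_zero_iff]
      refine lt_trans ?_ hrR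
      rw [enorm_eq_nnnorm]
      have := hh t
      rw [dist_eq_norm] at this
      exact_mod_cast this)
    rw [add_sub_cancel] at h3
    exact h2.unique h3

/-- The integral over `[u, v]` as a continuous linear functional. -/
noncomputable def integralIccCLM {u v : ℝ} (huv : u ≤ v) : C(Set.Icc u v, ℂ) →L[ℂ] ℂ :=
  have hint : ∀ g : C(Set.Icc u v, ℂ),
      IntervalIntegrable (fun θ => g (Set.projIcc u v huv θ)) MeasureTheory.volume u v := fun g =>
    (g.continuous.comp continuous_projIcc).intervalIntegrable _ _
  LinearMap.mkContinuous
    { toFun := fun g => ∫ θ in u..v, g (Set.projIcc u v huv θ)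
      map_add' := fun g h => intervalIntegral.integral_add (hint g) (hint h)
      map_smul' := fun c g => intervalIntegral.integral_smul c _ }
    |v - u| fun g => by
      rw [mul_comm]
      exact intervalIntegral.norm_integral_le_of_norm_le_const fun θ _ => g.norm_coe_le_norm _

theorem integralIccCLM_apply {u v : ℝ} (huv : u ≤ v) (g : C(Set.Icc u v, ℂ)) :
    integralIccCLM huv g = ∫ θ in u..v, g (Set.projIcc u v huv θ) := rfl

/-- Integrals along short paths of an analytic function are analytic functions of the path. Paths
form the Banach space `C([u, v], F)`, and the integral is a continuous linear functional of the
superposition, so no differentiation under the integral sign is needed. -/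
theorem exists_analyticAt_integral {f : F → ℂ} {z₀ : F} (hf : AnalyticAt ℂ f z₀) :
    ∃ r > 0, ∀ (u v : ℝ) (huv : u ≤ v) (c : E → C(Set.Icc u v, F)) (x₀ : E), AnalyticAt ℂ c x₀ →
      (∀ t, dist (c x₀ t) z₀ < r) →
      AnalyticAt ℂ (fun x => ∫ θ in u..v, f (c x (Set.projIcc u v huv θ))) x₀ := by
  obtain ⟨r, hr, H⟩ := exists_analyticAt_superposition hf
  refine ⟨r, hr, fun u v huv c x₀ hc hd => ?_⟩
  obtain ⟨G, hG⟩ := H (Set.Icc u v)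
  have h1 : AnalyticAt ℂ (fun x => integralIccCLM huv (G (c x))) x₀ :=
    AnalyticAt.comp (g := integralIccCLM huv) ((integralIccCLM huv).analyticAt _)
      (AnalyticAt.comp (g := G) (hG _ hd).1 hc)
  refine h1.congr ?_
  have hev : ∀ᶠ x in 𝓝 x₀, ∀ t, dist (c x t) z₀ < r := by
    have hcomp : ∃ r' < r, ∀ t, dist (c x₀ t) z₀ ≤ r' := by
      have : Nonempty (Set.Icc u v) := ⟨⟨u, le_rfl, huv⟩⟩
      obtain ⟨t, -, ht⟩ := isCompact_univ.exists_isMaxOn (Set.univ_nonempty (α := Set.Icc u v))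
        (f := fun t => dist (c x₀ t) z₀)
        (((c x₀).continuous.dist continuous_const).continuousOn)
      exact ⟨_, hd t, fun t' => ht (Set.mem_univ t')⟩
    obtain ⟨r', hr', hle⟩ := hcomp
    filter_upwards [hc.continuousAt (Metric.ball_mem_nhds _ (sub_pos.mpr hr'))] with x hx t
    have h2 : dist (c x t) (c x₀ t) ≤ dist (c x) (c x₀) := ContinuousMap.dist_apply_le_dist t
    have h3 : dist (c x) (c x₀) < r - r' := hx
    linarith [dist_triangle (c x t) (c x₀ t) z₀, hle t]
  filter_upwards [hev] with x hx
  rw [integralIccCLM_apply]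
  exact intervalIntegral.integral_congr fun θ _ => (hG _ hx).2 _

/-- Integrals over a compact interval of an analytic function are analytic in the parameters. -/
theorem analyticAt_intervalIntegral {f : ℂ × E → ℂ} {γ : ℝ → ℂ} (hγ : Continuous γ) {a b : ℝ}
    (hab : a ≤ b) {x₀ : E} (hf : ∀ θ ∈ Set.Icc a b, AnalyticAt ℂ f (γ θ, x₀)) :
    AnalyticAt ℂ (fun x => ∫ θ in a..b, f (γ θ, x)) x₀ := by
  -- by compactness, finitely many short pieces `[t k, t (k + 1)]` cover `[a, b]`
  choose r hr H using fun θ : Set.Icc a b => exists_analyticAt_integral (E := E) (hf θ.1 θ.2)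
  obtain ⟨t, ht0, htm, ⟨m, hm⟩, htc⟩ := exists_monotone_Icc_subset_open_cover_Icc hab
    (c := fun θ : Set.Icc a b => {s : Set.Icc a b | dist (γ s) (γ θ) < r θ})
    (fun θ => isOpen_lt ((hγ.comp continuous_subtype_val).dist continuous_const) continuous_const)
    (fun θ _ => Set.mem_iUnion.mpr ⟨θ, by simpa using hr θ⟩)
  have hpiece : ∀ k, AnalyticAt ℂ (fun x => ∫ θ in (t k : ℝ)..t (k + 1), f (γ θ, x)) x₀ := by
    intro k
    obtain ⟨θ₀, hθ₀⟩ := htc k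
    have hle : (t k : ℝ) ≤ t (k + 1) := htm (Nat.le_succ k)
    let A : C(Set.Icc (t k : ℝ) (t (k + 1)), ℂ × E) :=
      ⟨fun θ => (γ θ, 0), (hγ.comp continuous_subtype_val).prodMk continuous_const⟩
    let B : E →L[ℂ] C(Set.Icc (t k : ℝ) (t (k + 1)), ℂ × E) :=
      LinearMap.mkContinuous
        { toFun := fun x => ContinuousMap.const _ (0, x)
          map_add' := fun x y => by ext t <;> simp
          map_smul' := fun c x => by ext t <;> simp } 1 fun x => by
        rw [one_mul]
        refine (ContinuousMap.norm_le _ (norm_nonneg _)).mpr fun t => ?_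
        simp [Prod.norm_def]
    have hval : ∀ x θ, (A + B x) θ = (γ θ, x) := fun x θ => by
      change ((γ θ, 0) : ℂ × E) + (0, x) = _
      simp
    have := H θ₀ (t k) (t (k + 1)) hle (fun x => A + B x) x₀
      (analyticAt_const.add (B.analyticAt x₀)) (fun θ => by
        have hθ : a ≤ (θ : ℝ) ∧ (θ : ℝ) ≤ b :=
          ⟨(t k).2.1.trans θ.2.1, θ.2.2.trans (t (k + 1)).2.2⟩
        have hin := hθ₀ (show (⟨θ, hθ⟩ : Set.Icc a b) ∈ Set.Icc (t k) (t (k + 1)) from θ.2)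
        rw [hval, Prod.dist_eq, dist_self, max_lt_iff]
        exact ⟨hin, hr _⟩)
    refine this.congr (Eventually.of_forall fun x => ?_)
    refine intervalIntegral.integral_congr fun θ hθ => ?_
    rw [Set.uIcc_of_le hle] at hθ
    simp only [hval]
    rw [Set.projIcc_of_mem hle hθ]
  have hsum : AnalyticAt ℂ (fun x => ∑ k ∈ Finset.range m,
      ∫ θ in (t k : ℝ)..t (k + 1), f (γ θ, x)) x₀ :=
    Finset.analyticAt_fun_sum _ fun k _ => hpiece k
  refine hsum.congr ?_
  have hcont : ∀ᶠ x in 𝓝 x₀, ∀ θ ∈ Set.Icc a b, AnalyticAt ℂ f (γ θ, x) := by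
    refine (isCompact_Icc).eventually_forall_of_forall_eventually fun θ hθ => ?_
    have h1 := (hf θ hθ).eventually_analyticAt
    have h2 : Continuous fun z : E × ℝ => (γ z.2, z.1) := by fun_prop
    exact h2.continuousAt.eventually h1
  filter_upwards [hcont] with x hx
  have hint : ∀ k < m, IntervalIntegrable (fun θ => f (γ θ, x)) MeasureTheory.volume
      (t k : ℝ) (t (k + 1)) := fun k _ => by
    refine ContinuousOn.intervalIntegrable fun θ hθ => ?_
    have hle : (t k : ℝ) ≤ t (k + 1) := htm (Nat.le_succ k)
    rw [Set.uIcc_of_le hle] at hθ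
    have h1 := (hx θ ⟨(t k).2.1.trans hθ.1, hθ.2.trans (t (k + 1)).2.2⟩).continuousAt
    have h2 : Continuous fun θ : ℝ => (γ θ, x) := by fun_prop
    exact (ContinuousAt.comp (f := fun θ : ℝ => (γ θ, x)) h1 h2.continuousAt).continuousWithinAt
  rw [intervalIntegral.sum_integral_adjacent_intervals (a := fun k => (t k : ℝ)) hint]
  rw [ht0, hm m le_rfl]

/-- The circle average of an analytic function is analytic in the remaining variables. -/
theorem analyticAt_circleAverage {f : ℂ × E → ℂ} {x₀ : E}
    (hf : ∀ s ∈ Metric.sphere (0 : ℂ) 1, AnalyticAt ℂ f (s, x₀)) :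
    AnalyticAt ℂ (fun x => Real.circleAverage (fun s => f (s, x)) 0 1) x₀ := by
  have := analyticAt_intervalIntegral (f := f) (γ := circleMap 0 1) (continuous_circleMap 0 1)
    Real.two_pi_pos.le (x₀ := x₀) (fun θ _ => hf _ (circleMap_mem_sphere 0 zero_le_one θ))
  refine (analyticAt_const.mul this : AnalyticAt ℂ (fun x => (((2 * Real.pi)⁻¹ : ℝ) : ℂ) *
    ∫ θ in (0 : ℝ)..2 * Real.pi, f (circleMap 0 1 θ, x)) x₀).congr
    (Eventually.of_forall fun x => ?_)
  exact Complex.real_smul.symm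

/-! ### Division by linear forms -/

/-- An analytic function that vanishes on a hyperplane is locally divisible by its equation. The
quotient is `∫_0^1 ∂_v f(z + (t - 1) ℓ(z) v) dt`: the path of integration joins the projection
`z - ℓ(z) v` of `z` to the hyperplane with `z`. -/
theorem AnalyticAt.exists_eq_mul_of_hyperplane {f : E → ℂ} {ℓ : E →L[ℂ] ℂ} {v : E} (hv : ℓ v = 1)
    {z₀ : E} (hz₀ : ℓ z₀ = 0) (hf : AnalyticAt ℂ f z₀) (h0 : ∀ᶠ z in 𝓝 z₀, ℓ z = 0 → f z = 0) :
    ∃ g : E → ℂ, AnalyticAt ℂ g z₀ ∧ ∀ᶠ z in 𝓝 z₀, f z = ℓ z * g z := by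
  have hf' : AnalyticAt ℂ (fun z => fderiv ℂ f z v) z₀ :=
    ((ContinuousLinearMap.apply ℂ ℂ v).analyticAt _).comp hf.fderiv
  obtain ⟨r, hr, H⟩ := exists_analyticAt_integral (E := E) hf'
  let k : C(Set.Icc (0 : ℝ) 1, E) := ⟨fun t => (((t : ℝ) : ℂ) - 1) • v, by fun_prop⟩
  let A : E →L[ℂ] C(Set.Icc (0 : ℝ) 1, E) :=
      LinearMap.mkContinuous
        { toFun := fun x => ContinuousMap.const _ x
          map_add' := fun x y => by ext t; simp
          map_smul' := fun c x => by ext t; simp } 1 fun x => by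
        rw [one_mul]
        exact (ContinuousMap.norm_le _ (norm_nonneg _)).mpr fun t => le_rfl
  let c : E → C(Set.Icc (0 : ℝ) 1, E) := fun z => A z + ℓ z • k
  have hc : ∀ z t, c z t = z + ((((t : ℝ) : ℂ) - 1) * ℓ z) • v := fun z t => by
    change z + ℓ z • ((((t : ℝ) : ℂ) - 1) • v) = _
    rw [smul_smul, mul_comm]
  have hca : AnalyticAt ℂ c z₀ :=
    (A.analyticAt z₀).add ((ℓ.analyticAt z₀).smul analyticAt_const)
  refine ⟨_, H 0 1 zero_le_one c z₀ hca fun t => ?_, ?_⟩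
  · rw [hc, hz₀, mul_zero, zero_smul, add_zero, dist_self]; exact hr
  have hev : ∀ᶠ z in 𝓝 z₀, ∀ t ∈ Set.Icc (0 : ℝ) 1,
      AnalyticAt ℂ f (z + (((t : ℂ) - 1) * ℓ z) • v) := by
    refine (isCompact_Icc).eventually_forall_of_forall_eventually fun t ht => ?_
    have h2 : Continuous fun z : E × ℝ => z.1 + (((z.2 : ℂ) - 1) * ℓ z.1) • v := by fun_prop
    have h3 := h2.tendsto (z₀, t)
    simp only [hz₀, mul_zero, zero_smul, add_zero] at h3
    exact h3.eventually hf.eventually_analyticAt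
  have hev0 : ∀ᶠ z in 𝓝 z₀, f (z + (-1 * ℓ z) • v) = 0 := by
    have h2 : Continuous fun z : E => z + (-1 * ℓ z) • v := by fun_prop
    have h3 := h2.tendsto z₀
    simp only [hz₀, mul_zero, zero_smul, add_zero] at h3
    filter_upwards [h3.eventually h0] with z hz
    exact hz (by simp [hv])
  filter_upwards [hev, hev0] with z hz hz0
  have hftc : ∫ t in (0 : ℝ)..1, ℓ z * fderiv ℂ f (z + (((t : ℂ) - 1) * ℓ z) • v) v
      = f (z + ((((1 : ℝ) : ℂ) - 1) * ℓ z) • v) - f (z + ((((0 : ℝ) : ℂ) - 1) * ℓ z) • v) := by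
    refine intervalIntegral.integral_eq_sub_of_hasDerivAt
      (f := fun t : ℝ => f (z + (((t : ℂ) - 1) * ℓ z) • v)) (fun t ht => ?_) ?_
    · rw [Set.uIcc_of_le zero_le_one] at ht
      have h1 := (hz t ht).differentiableAt.hasFDerivAt
      have h2 : HasDerivAt (fun s : ℂ => z + ((s - 1) * ℓ z) • v) ((1 * ℓ z) • v) (t : ℂ) :=
        ((((hasDerivAt_id (t : ℂ)).sub_const 1).mul_const (ℓ z)).smul_const v).const_add z
      have h3 := (HasFDerivAt.comp_hasDerivAt (t : ℂ) (l := f) h1 h2).comp_ofReal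
      refine h3.congr_deriv ?_
      rw [one_mul, map_smul, smul_eq_mul]
    · refine ContinuousOn.intervalIntegrable fun t ht => ?_
      rw [Set.uIcc_of_le zero_le_one] at ht
      have h1 : ContinuousAt (fun z => fderiv ℂ f z v) (z + (((t : ℂ) - 1) * ℓ z) • v) :=
        ((hz t ht).fderiv.continuousAt.clm_apply continuousAt_const)
      have h2 : Continuous fun t : ℝ => z + (((t : ℂ) - 1) * ℓ z) • v := by fun_prop
      exact (continuousAt_const.mul (ContinuousAt.comp
        (f := fun t : ℝ => z + (((t : ℂ) - 1) * ℓ z) • v) h1 h2.continuousAt)).continuousWithinAt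
  rw [Complex.ofReal_one, sub_self, zero_mul, zero_smul, add_zero, Complex.ofReal_zero, zero_sub,
    hz0, sub_zero, intervalIntegral.integral_const_mul] at hftc
  rw [← hftc]
  congr 1
  refine intervalIntegral.integral_congr fun t ht => ?_
  rw [Set.uIcc_of_le zero_le_one] at ht
  simp only [hc]
  rw [Set.projIcc_of_mem zero_le_one ht]

open Classical in
/-- The quotient of `f` by a linear form `ℓ`, extended over `ℓ = 0` by the derivative of `f` in a
direction `v` with `ℓ v = 1`. -/
noncomputable def hyperplaneQuotient (ℓ : E →L[ℂ] ℂ) (v : E) (f : E → ℂ) (z : E) : ℂ :=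
  if ℓ z = 0 then fderiv ℂ f z v else f z / ℓ z

theorem hyperplaneQuotient_of_ne {ℓ : E →L[ℂ] ℂ} {v : E} {f : E → ℂ} {z : E} (h : ℓ z ≠ 0) :
    hyperplaneQuotient ℓ v f z = f z / ℓ z := if_neg h

theorem analyticOnNhd_hyperplaneQuotient {f : E → ℂ} {ℓ : E →L[ℂ] ℂ} {v : E} (hv : ℓ v = 1)
    {Ω : Set E} (hΩ : IsOpen Ω) (hf : AnalyticOnNhd ℂ f Ω) (h0 : ∀ z ∈ Ω, ℓ z = 0 → f z = 0) :
    AnalyticOnNhd ℂ (hyperplaneQuotient ℓ v f) Ω := by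
  intro z₀ hz₀
  by_cases hl : ℓ z₀ = 0
  · obtain ⟨g, hg, he⟩ := AnalyticAt.exists_eq_mul_of_hyperplane hv hl (hf z₀ hz₀)
      (by filter_upwards [hΩ.mem_nhds hz₀] with z hz using h0 z hz)
    refine hg.congr ?_
    filter_upwards [he.eventually_nhds, hg.eventually_analyticAt] with z hz hgz
    by_cases h : ℓ z = 0
    · rw [hyperplaneQuotient, if_pos h, Filter.EventuallyEq.fderiv_eq hz]
      have := (ℓ.hasFDerivAt (x := z)).mul hgz.differentiableAt.hasFDerivAt
      rw [show (fun z => ℓ z * g z) = (⇑ℓ) * g from rfl, this.fderiv]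
      simp [h, hv]
    · rw [hyperplaneQuotient_of_ne h, hz.self_of_nhds, mul_div_cancel_left₀ _ h]
  · refine ((hf z₀ hz₀).div (ℓ.analyticAt z₀) hl).congr ?_
    filter_upwards [ℓ.continuous.continuousAt.eventually_ne hl] with z hz
    rw [hyperplaneQuotient_of_ne hz]; rfl

end ParametricIntegrals

/-! ### Substitution of commuting elements -/

section Subst

variable {n : ℕ} {B : Type*} [Ring B] [Module ℂ B] [IsScalarTower ℂ B B] [SMulCommClass ℂ B B]

/-- For pairwise commuting `y_i`, substitution is the algebra map of the polynomial ring into the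
commutative subalgebra generated by the `y_i`. -/
theorem exists_ringHom_eq_subst (y : Fin n → B) (hy : ∀ i j, Commute (y i) (y j)) :
    ∃ φ : MvPolynomial (Fin n) ℂ →+* B, (∀ f, φ f = subst y f) ∧ (∀ i, φ (MvPolynomial.X i) = y i) ∧
      (∀ (c : ℂ) f, φ (c • f) = c • φ f) := by
  let : Algebra ℂ B := Algebra.ofModule smul_mul_assoc mul_smul_comm
  have hcomm : ∀ a ∈ Set.range y, ∀ b ∈ Set.range y, a * b = b * a := by
    rintro _ ⟨i, rfl⟩ _ ⟨j, rfl⟩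
    exact hy i j
  let : CommRing (Algebra.adjoin ℂ (Set.range y)) :=
    { (inferInstance : Ring (Algebra.adjoin ℂ (Set.range y))) with
      mul_comm := (Algebra.isMulCommutative_adjoin ℂ hcomm).is_comm.comm }
  let y' : Fin n → Algebra.adjoin ℂ (Set.range y) := fun i =>
    ⟨y i, Algebra.subset_adjoin (Set.mem_range_self i)⟩
  let φ : MvPolynomial (Fin n) ℂ →ₐ[ℂ] B :=
    (Algebra.adjoin ℂ (Set.range y)).val.comp (MvPolynomial.aeval y')
  refine ⟨φ.toRingHom, fun f => ?_, fun i => ?_, fun c f => map_smul φ c f⟩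
  · change (Algebra.adjoin ℂ (Set.range y)).val (MvPolynomial.aeval y' f) = _
    rw [MvPolynomial.aeval_def, MvPolynomial.eval₂_eq', map_sum, subst]
    refine Finset.sum_congr rfl fun k _ => ?_
    rw [map_mul, AlgHom.commutes, ← Algebra.smul_def, ← List.prod_ofFn, map_list_prod, List.map_ofFn]
    rfl
  · change (Algebra.adjoin ℂ (Set.range y)).val (MvPolynomial.aeval y' (MvPolynomial.X i)) = _
    rw [MvPolynomial.aeval_X]; rfl

end Subst

/-! ### Commutativity from the classical Yang–Baxter equation -/

section Dunkl

variable {n : ℕ}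

/-- Operators `p_i - ∑_{j ≠ i} Φ_{ij}` commute as soon as the `Φ_{ij}` are antisymmetric, satisfy the
classical Yang–Baxter equation and are compatible with the `p_i`. -/
theorem dunkl_commute_of_yangBaxter {B : Type*} [Ring B] (P : Fin n → B) (Φ : Fin n → Fin n → B)
    (hP : ∀ i j, Commute (P i) (P j))
    (hPΦ : ∀ i j, i ≠ j → Commute (P i + P j) (Φ i j))
    (hPk : ∀ i j k, i ≠ j → k ≠ i → k ≠ j → Commute (P k) (Φ i j))
    (hanti : ∀ i j, i ≠ j → Φ j i = -Φ i j)
    (hdisj : ∀ i j k l, i ≠ j → k ≠ l → i ≠ k → i ≠ l → j ≠ k → j ≠ l → Commute (Φ i j) (Φ k l))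
    (hYB : ∀ i j k, i ≠ j → i ≠ k → j ≠ k →
      (Φ i j * Φ j k - Φ j k * Φ i j) + (Φ i j * Φ i k - Φ i k * Φ i j)
        + (Φ i k * Φ j k - Φ j k * Φ i k) = 0) (i j : Fin n) :
    Commute (P i - ∑ k : {k : Fin n // k ≠ i}, Φ i k.1)
      (P j - ∑ k : {k : Fin n // k ≠ j}, Φ j k.1) := by
  by_cases hij : i = j
  · subst hij; exact Commute.refl _
  set s : Finset (Fin n) := (Finset.univ.erase i).erase j with hs
  have hmem : ∀ k ∈ s, i ≠ k ∧ j ≠ k := fun k hk =>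
    ⟨(Finset.ne_of_mem_erase (Finset.mem_of_mem_erase hk)).symm, (Finset.ne_of_mem_erase hk).symm⟩
  have e1 : ∑ k : {k : Fin n // k ≠ i}, Φ i k.1 = Φ i j + ∑ k ∈ s, Φ i k := by
    rw [← Finset.sum_subtype (Finset.univ.erase i) (by simp) (fun k => Φ i k),
      ← Finset.add_sum_erase _ _ (show j ∈ Finset.univ.erase i by simp [Ne.symm hij])]
  have e2 : ∑ k : {k : Fin n // k ≠ j}, Φ j k.1 = -Φ i j + ∑ k ∈ s, Φ j k := by
    rw [← Finset.sum_subtype (Finset.univ.erase j) (by simp) (fun k => Φ j k),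
      ← Finset.add_sum_erase _ _ (show i ∈ Finset.univ.erase j by simp [hij]), hanti i j hij, hs,
      Finset.erase_right_comm]
  rw [e1, e2]
  set A := Φ i j
  set S := ∑ k ∈ s, Φ i k with hS
  set T := ∑ k ∈ s, Φ j k with hT
  have h1 : P i * T = T * P i := by
    rw [hT, Finset.mul_sum, Finset.sum_mul]
    exact Finset.sum_congr rfl fun k hk => hPk j k i (hmem k hk).2 hij (hmem k hk).1
  have h2 : P j * S = S * P j := by
    rw [hS, Finset.mul_sum, Finset.sum_mul]
    exact Finset.sum_congr rfl fun k hk => hPk i k j (hmem k hk).1 (Ne.symm hij) (hmem k hk).2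
  have h3 : P i * A + P j * A = A * P i + A * P j := by
    have := (hPΦ i j hij).eq
    rwa [add_mul, mul_add] at this
  have h4 : P i * P j = P j * P i := hP i j
  have h5 : S * T - T * S = ∑ k ∈ s, (Φ i k * Φ j k - Φ j k * Φ i k) := by
    rw [hS, hT, Finset.sum_mul_sum, Finset.sum_mul_sum, Finset.sum_sub_distrib]
    have h51 : ∑ k ∈ s, ∑ l ∈ s, Φ i k * Φ j l - ∑ k ∈ s, ∑ l ∈ s, Φ j k * Φ i l
        = ∑ k ∈ s, ∑ l ∈ s, (Φ i k * Φ j l - Φ j l * Φ i k) := by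
      rw [Finset.sum_comm (f := fun k l => Φ j k * Φ i l), ← Finset.sum_sub_distrib]
      simp only [← Finset.sum_sub_distrib]
    rw [h51, ← Finset.sum_sub_distrib]
    refine Finset.sum_congr rfl fun k hk => ?_
    rw [Finset.sum_eq_single_of_mem k hk]
    intro l hl hlk
    rw [sub_eq_zero]
    exact hdisj i k j l (hmem k hk).1 (hmem l hl).2 hij (hmem l hl).1 (hmem k hk).2.symm (Ne.symm hlk)
  have h6 : (A * T - T * A) + (A * S - S * A) + (S * T - T * S) = 0 := by
    rw [h5, hS, hT, Finset.mul_sum, Finset.mul_sum, Finset.sum_mul, Finset.sum_mul,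
      ← Finset.sum_sub_distrib, ← Finset.sum_sub_distrib, ← Finset.sum_add_distrib,
      ← Finset.sum_add_distrib]
    exact Finset.sum_eq_zero fun k hk => hYB i j k hij (hmem k hk).1 (hmem k hk).2
  -- the commutator is a sum of commutators that vanish separately, and of `h6`
  have h7 : (P i - (A + S)) * (P j - (-A + T)) - (P j - (-A + T)) * (P i - (A + S))
      = (P i * P j - P j * P i) + (P i * A + P j * A - (A * P i + A * P j))
        - (P i * T - T * P i) + (P j * S - S * P j)
        + ((A * T - T * A) + (A * S - S * A) + (S * T - T * S)) := by noncomm_ring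
  rw [h6, h4, h3, h1, h2] at h7
  simp only [sub_self, add_zero] at h7
  exact sub_eq_zero.mp h7

end Dunkl

/-! ### Scalars in crossed products -/

section Crossed

open SkewMonoidAlgebra

variable {G R : Type*} [Group G] [Ring R] [Module ℂ R] [MulSemiringAction G R]

instance crossed_isScalarTower [IsScalarTower ℂ R R] :
    IsScalarTower ℂ (SkewMonoidAlgebra R G) (SkewMonoidAlgebra R G) where
  smul_assoc c a b := by
    simp only [smul_eq_mul]
    induction a using SkewMonoidAlgebra.induction_on with
    | zero => simp
    | single g a =>
      induction b using SkewMonoidAlgebra.induction_on with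
      | zero => simp
      | single h b =>
        rw [smul_single, single_mul_single, single_mul_single, smul_single, smul_mul_assoc]
      | add x y hx hy => rw [mul_add, mul_add, hx, hy, smul_add]
    | add x y hx hy => rw [smul_add, add_mul, add_mul, hx, hy, smul_add]

instance crossed_smulCommClass [SMulCommClass ℂ R R] [SMulCommClass G ℂ R] :
    SMulCommClass ℂ (SkewMonoidAlgebra R G) (SkewMonoidAlgebra R G) where
  smul_comm c a b := by
    simp only [smul_eq_mul]
    induction a using SkewMonoidAlgebra.induction_on with
    | zero => simp
    | single g a =>
      induction b using SkewMonoidAlgebra.induction_on with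
      | zero => simp
      | single h b =>
        rw [smul_single, single_mul_single, single_mul_single, smul_single, smul_comm g c b,
          mul_smul_comm c a (g • b)]
      | add x y hx hy => rw [mul_add, smul_add, hx, hy, smul_add, mul_add]
    | add x y hx hy => rw [add_mul, smul_add, hx, hy, add_mul]

end Crossed

/-! ### Dunkl operators in a crossed product -/

section CrossedDunkl

open SkewMonoidAlgebra

variable {n : ℕ} {R : Type*} [Ring R] [Module ℂ R] [MulSemiringAction (Equiv.Perm (Fin n)) R]
  [IsScalarTower ℂ R R] [SMulCommClass ℂ R R] [SMulCommClass (Equiv.Perm (Fin n)) ℂ R]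

/-- The Dunkl operators with momenta `p_i` and kernel `K`; here `K i j k l` stands for
`φ(λ_i - λ_j, x_k - x_l)`. -/
noncomputable def dunkl (p : Fin n → R) (K : Fin n → Fin n → Fin n → Fin n → R) (κ : ℂ)
    (i : Fin n) : SkewMonoidAlgebra R (Equiv.Perm (Fin n)) :=
  single 1 (p i) - κ • ∑ j : {j : Fin n // j ≠ i}, single (Equiv.swap i j.1) (K i j.1 i j.1)

/-- The properties of momenta and kernel that make the Dunkl operators commute. -/
structure IsDunklKernel (p : Fin n → R) (K : Fin n → Fin n → Fin n → Fin n → R) : Prop where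
  smul_p : ∀ (w : Equiv.Perm (Fin n)) i, w • p i = p (w i)
  p_comm : ∀ i j, Commute (p i) (p j)
  smul_K : ∀ (w : Equiv.Perm (Fin n)) i j k l, w • K i j k l = K i j (w k) (w l)
  K_comm : ∀ i j k l i' j' k' l', Commute (K i j k l) (K i' j' k' l')
  anti : ∀ i j k l, K j i l k = -K i j k l
  p_add_K : ∀ i j k l, Commute (p k + p l) (K i j k l)
  p_K : ∀ i j k l m, m ≠ k → m ≠ l → Commute (p m) (K i j k l)
  fay : ∀ i j k, i ≠ j → i ≠ k → j ≠ k →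
    K i j i j * K j k i k - K j k j k * K i k i j - K i k i k * K i j k j = 0

theorem IsDunklKernel.commute {p : Fin n → R} {K : Fin n → Fin n → Fin n → Fin n → R}
    (h : IsDunklKernel p K) (κ : ℂ) (i j : Fin n) : Commute (dunkl p K κ i) (dunkl p K κ j) := by
  let Φ : Fin n → Fin n → SkewMonoidAlgebra R (Equiv.Perm (Fin n)) := fun i j =>
    κ • single (Equiv.swap i j) (K i j i j)
  have e : ∀ i, dunkl p K κ i = single 1 (p i) - ∑ j : {j : Fin n // j ≠ i}, Φ i j.1 := fun i => by
    rw [dunkl, Finset.smul_sum]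
  have hsm : ∀ a b : SkewMonoidAlgebra R (Equiv.Perm (Fin n)),
      (κ • a) * (κ • b) = (κ * κ) • (a * b) := fun a b => by
    rw [smul_mul_assoc, mul_smul_comm, smul_smul]
  rw [e, e]
  refine dunkl_commute_of_yangBaxter (fun i => single 1 (p i)) Φ (fun i j => ?_) (fun i j hij => ?_)
    (fun i j k hij hki hkj => ?_) (fun i j hij => ?_) (fun i j k l hij hkl hik hil hjk hjl => ?_)
    (fun i j k hij hik hjk => ?_) i j
  · rw [commute_iff_eq, single_mul_single, single_mul_single, one_smul, one_smul, (h.p_comm i j).eq]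
  · refine Commute.smul_right ?_ κ
    rw [commute_iff_eq, ← single_add, single_mul_single, single_mul_single, one_smul, smul_add,
      h.smul_p, h.smul_p, Equiv.swap_apply_left, Equiv.swap_apply_right, one_mul, mul_one,
      (h.p_add_K i j i j).eq, add_comm (p i)]
  · refine Commute.smul_right ?_ κ
    rw [commute_iff_eq, single_mul_single, single_mul_single, one_smul,
      h.smul_p, Equiv.swap_apply_of_ne_of_ne hki hkj, one_mul, mul_one, (h.p_K i j i j k hki hkj).eq]
  · simp only [Φ]
    rw [Equiv.swap_comm, h.anti, single_neg, smul_neg]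
  · refine Commute.smul_left (Commute.smul_right ?_ κ) κ
    rw [commute_iff_eq, single_mul_single, single_mul_single, h.smul_K, h.smul_K,
      Equiv.swap_apply_of_ne_of_ne hik.symm hjk.symm, Equiv.swap_apply_of_ne_of_ne hil.symm hjl.symm,
      Equiv.swap_apply_of_ne_of_ne hik hil, Equiv.swap_apply_of_ne_of_ne hjk hjl,
      (h.K_comm _ _ _ _ _ _ _ _).eq]
    congr 1
    exact (Equiv.Perm.Disjoint.commute (Equiv.Perm.disjoint_swap_swap (by simp [*]))).eq
  · have hs : ∀ a b c d : Fin n, Equiv.swap a b * Equiv.swap c d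
        = Equiv.swap (Equiv.swap a b c) (Equiv.swap a b d) * Equiv.swap a b := fun a b c d =>
      Equiv.mul_swap_eq_swap_mul _ _ _
    -- The six products in the Yang–Baxter equation lie over two permutations, the 3-cycles
    -- `s_{ij} s_{jk}` and `s_{jk} s_{ij}`. Over each of them the equation is an instance of `fay`.
    have c1 : Equiv.swap i k * Equiv.swap i j = Equiv.swap i j * Equiv.swap j k := by
      rw [hs i j j k, Equiv.swap_apply_right, Equiv.swap_apply_of_ne_of_ne hik.symm hjk.symm]
    have c2 : Equiv.swap j k * Equiv.swap i k = Equiv.swap i j * Equiv.swap j k := by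
      rw [hs j k i k, Equiv.swap_apply_right, Equiv.swap_apply_of_ne_of_ne hij hik]
    have c3 : Equiv.swap i j * Equiv.swap i k = Equiv.swap j k * Equiv.swap i j := by
      rw [hs i j i k, Equiv.swap_apply_left, Equiv.swap_apply_of_ne_of_ne hik.symm hjk.symm]
    have c4 : Equiv.swap i k * Equiv.swap j k = Equiv.swap j k * Equiv.swap i j := by
      rw [hs i k j k, Equiv.swap_apply_right, Equiv.swap_apply_of_ne_of_ne hij.symm hjk,
        Equiv.swap_comm j i, c3]
    have f1 := h.fay i j k hij hik hjk
    have f2 := h.fay k j i hjk.symm hik.symm hij.symm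
    rw [h.anti j k j k, h.anti i j i k, h.anti i j i j, h.anti i k j k, h.anti i k i k,
      h.anti j k j i] at f2
    simp only [neg_mul_neg] at f2
    simp only [Φ, hsm, ← smul_sub, ← smul_add]
    simp only [single_mul_single, h.smul_K, c1, c2, c3, c4, Equiv.swap_apply_left,
      Equiv.swap_apply_right, Equiv.swap_apply_of_ne_of_ne hik.symm hjk.symm,
      Equiv.swap_apply_of_ne_of_ne hij hik, Equiv.swap_apply_of_ne_of_ne hij.symm hjk]
    have f1' : single (Equiv.swap i j * Equiv.swap j k) (K i j i j * K j k i k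
        - K j k j k * K i k i j - K i k i k * K i j k j) = 0 := by rw [f1, single_zero_right]
    have f2' : single (Equiv.swap j k * Equiv.swap i j) (K j k j k * K i j i k
        - K i j i j * K i k j k - K i k i k * K j k j i) = 0 := by
      rw [← single_zero_right (Equiv.swap j k * Equiv.swap i j), ← f2]
    simp only [sub_eq_add_neg, single_add, single_neg] at f1' f2' ⊢
    have hsum := sub_eq_zero.mpr (f1'.trans f2'.symm)
    rw [← smul_zero (κ * κ), ← hsum]
    congr 1
    abel

end CrossedDunkl

/-! ### Scalars in the classical and quantum algebras -/

section Instances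

variable {n : ℕ} {τ : UpperHalfPlane}

instance : IsScalarTower ℂ (A0 n τ) (A0 n τ) :=
  inferInstanceAs (IsScalarTower ℂ (MvPolynomial (Fin n) (Hol n τ)) (MvPolynomial (Fin n) (Hol n τ)))

instance : SMulCommClass ℂ (A0 n τ) (A0 n τ) :=
  inferInstanceAs (SMulCommClass ℂ (MvPolynomial (Fin n) (Hol n τ)) (MvPolynomial (Fin n) (Hol n τ)))

theorem permPoly_smul {K : Type*} [CommRing K] [Algebra ℂ K]
    (α : Equiv.Perm (Fin n) →* (K →+* K)) (hα : ∀ w (c : ℂ), α w (algebraMap ℂ K c) = algebraMap ℂ K c)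
    (w : Equiv.Perm (Fin n)) (c : ℂ) (a : MvPolynomial (Fin n) K) :
    permPoly α w (c • a) = c • permPoly α w a := by
  rw [Algebra.smul_def, Algebra.smul_def, MvPolynomial.algebraMap_apply, map_mul, permPoly_C, hα]

theorem permHol_algebraMap (w : Equiv.Perm (Fin n)) (c : ℂ) :
    permHol w (algebraMap ℂ (Hol n τ) c) = algebraMap ℂ (Hol n τ) c := rfl

instance : SMulCommClass (Equiv.Perm (Fin n)) ℂ (A0 n τ) where
  smul_comm w c a := permPoly_smul (K := Hol n τ) permHol permHol_algebraMap w c a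

theorem opL_smul {K : Type*} [CommRing K] [Algebra ℂ K] {d : Fin n → Derivation ℂ K K}
    (hd : ∀ i j f, d i (d j f) = d j (d i f)) (c : ℂ) (a b : MvPolynomial (Fin n) K) :
    opL hd (c • a) b = c • opL hd a b := by
  rw [Algebra.smul_def, Algebra.smul_def, MvPolynomial.algebraMap_apply, opL_C_mul]
  rfl

instance : IsScalarTower ℂ (Ah n τ) (Ah n τ) where
  smul_assoc c a b := opL_smul (K := HolH n τ) (d := hbarPartial) hbarPartial_comm c a b

instance : SMulCommClass ℂ (Ah n τ) (Ah n τ) where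
  smul_comm c a b :=
    (map_smul (opL (K := HolH n τ) (d := hbarPartial) hbarPartial_comm a) c b).symm

instance : SMulCommClass (Equiv.Perm (Fin n)) ℂ (Ah n τ) where
  smul_comm w c a := by
    refine permPoly_smul (K := HolH n τ) permHolH (fun w c => ?_) w c a
    change PowerSeries.map (permHol w) (algebraMap ℂ (HolH n τ) c) = _
    rw [PowerSeries.algebraMap_apply, PowerSeries.map_C, permHol_algebraMap]

end Instances

/-! ### The rational and elliptic Dunkl operators -/

section ConcreteDunkl

variable {n : ℕ} {τ : UpperHalfPlane}

theorem A0.smul_p (w : Equiv.Perm (Fin n)) (i : Fin n) : w • (A0.p i : A0 n τ) = A0.p (w i) :=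
  permPoly_X (K := Hol n τ) permHol w i

theorem A0.smul_ofHol (w : Equiv.Perm (Fin n)) (f : Hol n τ) :
    w • (A0.ofHol f) = A0.ofHol (permHol w f) :=
  permPoly_C (K := Hol n τ) permHol w f

theorem Ah.smul_p (w : Equiv.Perm (Fin n)) (i : Fin n) : w • (Ah.p i : Ah n τ) = Ah.p (w i) :=
  permPoly_X (K := HolH n τ) permHolH w i

theorem Ah.smul_ofHol (w : Equiv.Perm (Fin n)) (f : Hol n τ) :
    w • (Ah.ofHol f) = Ah.ofHol (permHol w f) := by
  refine (permPoly_C (K := HolH n τ) permHolH w _).trans ?_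
  change MvPolynomial.C (PowerSeries.map (permHol w) (PowerSeries.C f)) = _
  rw [PowerSeries.map_C]
  rfl

theorem A0.ofHol_mul (f g : Hol n τ) : A0.ofHol (f * g) = A0.ofHol f * A0.ofHol g :=
  map_mul (MvPolynomial.C (R := Hol n τ) (σ := Fin n)) f g

theorem A0.ofHol_sub (f g : Hol n τ) : A0.ofHol (f - g) = A0.ofHol f - A0.ofHol g :=
  map_sub (MvPolynomial.C (R := Hol n τ) (σ := Fin n)) f g

theorem A0.ofHol_neg (f : Hol n τ) : A0.ofHol (-f) = -A0.ofHol f :=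
  map_neg (MvPolynomial.C (R := Hol n τ) (σ := Fin n)) f

theorem A0.ofHol_zero : A0.ofHol (0 : Hol n τ) = 0 :=
  map_zero (MvPolynomial.C (R := Hol n τ) (σ := Fin n))

theorem Ah.ofHol_mul (f g : Hol n τ) : Ah.ofHol (f * g) = Ah.ofHol f * Ah.ofHol g := by
  refine Eq.symm (Eq.trans (b := opL (K := HolH n τ) (d := hbarPartial) hbarPartial_comm
      (MvPolynomial.monomial 0 (PowerSeries.C f)) (MvPolynomial.C (PowerSeries.C g))) rfl ?_)
  rw [opL_monomial, opPow_zero, Module.End.mul_apply, LinearMap.mulLeft_apply,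
      Module.End.one_apply, ← map_mul, ← map_mul]
  rfl

theorem Ah.ofHol_sub (f g : Hol n τ) : Ah.ofHol (f - g) = Ah.ofHol f - Ah.ofHol g :=
  map_sub ((MvPolynomial.C (R := HolH n τ) (σ := Fin n)).comp PowerSeries.C) f g

theorem Ah.ofHol_neg (f : Hol n τ) : Ah.ofHol (-f) = -Ah.ofHol f :=
  map_neg ((MvPolynomial.C (R := HolH n τ) (σ := Fin n)).comp PowerSeries.C) f

theorem Ah.ofHol_zero : Ah.ofHol (0 : Hol n τ) = 0 :=
  map_zero ((MvPolynomial.C (R := HolH n τ) (σ := Fin n)).comp PowerSeries.C)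

theorem Ah.p_commute (i j : Fin n) : Commute (Ah.p i : Ah n τ) (Ah.p j) := by
  have h : ∀ i j : Fin n, @Eq (Ah n τ) (Ah.p i * Ah.p j) (MvPolynomial.X i * MvPolynomial.X j :
      MvPolynomial (Fin n) (HolH n τ)) := by
    intro i j
    refine Eq.trans (b := opL (K := HolH n τ) (d := hbarPartial) hbarPartial_comm
      (MvPolynomial.monomial (Finsupp.single i 1) 1) (MvPolynomial.monomial (Finsupp.single j 1) 1))
      rfl ?_
    rw [opL_monomial, opPow_single, Module.End.mul_apply, LinearMap.mulLeft_apply, map_one, one_mul,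
      opD_monomial, Derivation.map_one_eq_zero, map_zero, add_zero, MvPolynomial.X, MvPolynomial.X,
      MvPolynomial.monomial_mul, one_mul]
  rw [commute_iff_eq, h, h]
  exact mul_comm (MvPolynomial.X i : MvPolynomial (Fin n) (HolH n τ)) _

theorem Ah.ofHol_commute (f g : Hol n τ) : Commute (Ah.ofHol f) (Ah.ofHol g) := by
  rw [commute_iff_eq, ← Ah.ofHol_mul, ← Ah.ofHol_mul, mul_comm]

/-- The function `x ↦ 1 / (x_k - x_l)`, and `0` for `k = l`. -/
noncomputable def invSubHol (k l : Fin n) : Hol n τ :=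
  if h : l ≠ k then Hol.mk (fun x => 1 / (x k - x l)) (analytic_inv_sub h) else 0

/-- The function `x ↦ φ(λ_i - λ_j, x_k - x_m)`, and `0` for `i = j` or `k = m`. -/
noncomputable def phiHol (l : regSet n τ) (i j k m : Fin n) : Hol n τ :=
  if h : j ≠ i ∧ m ≠ k then
    Hol.mk (fun x => phi τ (l.1 i - l.1 j) (x k - x m)) (by
      intro x hx
      have h1 : AnalyticAt ℂ (fun x : Fin n → ℂ => x k - x m) x := analytic_coord_sub k m _ x hx
      have h2 : AnalyticAt ℂ (fun x : Fin n → ℂ => sigma (periods τ) (x k - x m)) x :=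
        (analyticAt_sigma _ _).comp h1
      have h3 : AnalyticAt ℂ
          (fun x : Fin n → ℂ => sigma (periods τ) (x k - x m - (l.1 i - l.1 j))) x :=
        AnalyticAt.comp (g := sigma (periods τ))
          (f := fun x : Fin n → ℂ => x k - x m - (l.1 i - l.1 j))
          (analyticAt_sigma _ _) (h1.sub analyticAt_const)
      refine h3.div (h2.mul analyticAt_const)
        (mul_ne_zero (sigma_ne_zero _ (hx k m h.2.symm)) (sigma_ne_zero _ fun hl => ?_))
      exact l.2 i j h.1.symm (by simpa using (periods τ).lattice.neg_mem hl))
  else 0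

theorem phiHol_apply (l : regSet n τ) {i j k m : Fin n} (hij : i ≠ j) (hkm : k ≠ m)
    (x : regSet n τ) : (phiHol l i j k m).1 x = phi τ (l.1 i - l.1 j) (x.1 k - x.1 m) := by
  rw [phiHol, dif_pos ⟨hij.symm, hkm.symm⟩]; rfl

theorem phiHol_left (l : regSet n τ) (i k m : Fin n) : phiHol l i i k m = 0 :=
  dif_neg fun h => h.1 rfl

theorem phiHol_right (l : regSet n τ) (i j k : Fin n) : phiHol l i j k k = 0 :=
  dif_neg fun h => h.2 rfl

theorem invSubHol_apply {k l : Fin n} (h : k ≠ l) (x : regSet n τ) :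
    (invSubHol k l : Hol n τ).1 x = 1 / (x.1 k - x.1 l) := by
  rw [invSubHol, dif_pos h.symm]; rfl

theorem ratDunkl_eq (κ : ℂ) (i : Fin n) :
    (ratDunkl κ i : A0S n τ) = dunkl A0.p (fun _ _ k l => A0.ofHol (invSubHol k l)) κ i := by
  rw [ratDunkl, dunkl]
  congr 3
  funext j
  rw [invSubHol, dif_pos j.2]

theorem ellDunkl_eq (κ : ℂ) (l : regSet n τ) (i : Fin n) :
    ellDunkl κ l i = dunkl Ah.p (fun i j k m => Ah.ofHol (phiHol l i j k m)) κ i := by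
  rw [ellDunkl, dunkl]
  congr 3
  funext j
  rw [phiHol, dif_pos ⟨j.2, j.2⟩]

theorem permHol_phiHol (l : regSet n τ) (w : Equiv.Perm (Fin n)) (i j k m : Fin n) :
    permHol w (phiHol l i j k m) = phiHol l i j (w k) (w m) := by
  by_cases hij : i = j
  · subst hij; rw [phiHol_left, phiHol_left, map_zero]
  by_cases hkm : k = m
  · subst hkm; rw [phiHol_right, phiHol_right, map_zero]
  refine Hol.hext fun x => ?_
  rw [permHol_apply, phiHol_apply l hij hkm, phiHol_apply l hij (w.injective.ne hkm)]
  rfl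

theorem phiHol_anti (l : regSet n τ) (i j k m : Fin n) :
    phiHol l j i m k = -phiHol l i j k m := by
  by_cases hij : i = j
  · subst hij; rw [phiHol_left, phiHol_left, neg_zero]
  by_cases hkm : k = m
  · subst hkm; rw [phiHol_right, phiHol_right, neg_zero]
  refine Hol.hext fun x => ?_
  rw [phiHol_apply l (Ne.symm hij) (Ne.symm hkm), ← neg_sub (l.1 i), ← neg_sub (x.1 k), phi_neg_neg,
    ← phiHol_apply l hij hkm]
  rfl

/-- The factor `δ_{ak} - δ_{am}` is the derivative of `x_k - x_m` by `x_a`. -/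
theorem pderivHol_phiHol (l : regSet n τ) {i j k m : Fin n} (hij : i ≠ j) (hkm : k ≠ m) (a : Fin n)
    (x : regSet n τ) : (pderivHol a (phiHol l i j k m)).1 x
      = deriv (phi τ (l.1 i - l.1 j)) (x.1 k - x.1 m)
        * ((Pi.single a 1 : Fin n → ℂ) k - (Pi.single a 1 : Fin n → ℂ) m) := by
  refine (partialHol_apply a _ (fun x => phi τ (l.1 i - l.1 j) (x k - x m))
    (phiHol_apply l hij hkm) x).trans ?_
  have hd : DifferentiableAt ℂ (phi τ (l.1 i - l.1 j)) (x.1 k - x.1 m) := by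
    refine DifferentiableAt.div ((differentiable_sigma _).comp (differentiable_id.sub_const _) _)
      ((differentiable_sigma _ _).mul_const _) (mul_ne_zero (sigma_ne_zero _ (x.2 k m hkm))
        (sigma_ne_zero _ fun hl => l.2 i j hij ?_))
    simpa using (periods τ).lattice.neg_mem hl
  have hL : HasFDerivAt (fun x : Fin n → ℂ => x k - x m)
      (ContinuousLinearMap.proj (R := ℂ) (φ := fun _ : Fin n => ℂ) k
        - ContinuousLinearMap.proj (R := ℂ) (φ := fun _ : Fin n => ℂ) m) x.1 :=
    (ContinuousLinearMap.proj (R := ℂ) (φ := fun _ : Fin n => ℂ) k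
        - ContinuousLinearMap.proj (R := ℂ) (φ := fun _ : Fin n => ℂ) m).hasFDerivAt
  have := (hd.hasDerivAt.comp_hasFDerivAt x.1 hL).fderiv
  refine (congrArg (fun f => f (Pi.single a 1)) this).trans ?_
  simp

/-- A sum of momenta commutes with the functions that are killed by the corresponding sum of
derivatives. -/
theorem Ah.commute_sum_p_ofHol (s : Finset (Fin n)) (f : Hol n τ)
    (h : ∑ i ∈ s, pderivHol i f = 0) : Commute (∑ i ∈ s, Ah.p i) (Ah.ofHol f) := by
  rw [commute_iff_eq, Finset.sum_mul, Finset.mul_sum, Finset.sum_congr rfl fun i _ =>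
    Ah.p_mul_ofHol i f, Finset.sum_add_distrib, ← Finset.mul_sum,
    ← Finset.mul_sum (f := fun i => Ah.ofHol (pderivHol i f))]
  have : ∑ i ∈ s, Ah.ofHol (pderivHol i f) = 0 := by
    rw [← Ah.ofHol_zero, ← h]
    exact (map_sum ((MvPolynomial.C (R := HolH n τ) (σ := Fin n)).comp PowerSeries.C) _ s).symm
  rw [this, mul_zero, add_zero]

theorem isDunklKernel_phi (l : regSet n τ) :
    IsDunklKernel (R := Ah n τ) Ah.p (fun i j k m => Ah.ofHol (phiHol l i j k m)) where
  smul_p := Ah.smul_p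
  p_comm := Ah.p_commute
  smul_K w i j k m := by rw [Ah.smul_ofHol, permHol_phiHol]
  K_comm _ _ _ _ _ _ _ _ := Ah.ofHol_commute _ _
  anti i j k m := by rw [phiHol_anti, Ah.ofHol_neg]
  p_add_K i j k m := by
    by_cases hij : i = j
    · subst hij; rw [phiHol_left, Ah.ofHol_zero]; exact Commute.zero_right _
    by_cases hkm : k = m
    · subst hkm; rw [phiHol_right, Ah.ofHol_zero]; exact Commute.zero_right _
    have := Ah.commute_sum_p_ofHol {k, m} (phiHol l i j k m) (by
      rw [Finset.sum_pair hkm]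
      refine Hol.hext fun x => ?_
      change (pderivHol k (phiHol l i j k m)).1 x + (pderivHol m (phiHol l i j k m)).1 x = 0
      rw [pderivHol_phiHol l hij hkm, pderivHol_phiHol l hij hkm]
      simp [hkm, Ne.symm hkm])
    rwa [Finset.sum_pair hkm] at this
  p_K i j k m a hak ham := by
    by_cases hij : i = j
    · subst hij; rw [phiHol_left, Ah.ofHol_zero]; exact Commute.zero_right _
    by_cases hkm : k = m
    · subst hkm; rw [phiHol_right, Ah.ofHol_zero]; exact Commute.zero_right _
    have := Ah.commute_sum_p_ofHol {a} (phiHol l i j k m) (by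
      rw [Finset.sum_singleton]
      refine Hol.hext fun x => ?_
      rw [pderivHol_phiHol l hij hkm]
      simp [hak.symm, ham.symm])
    rwa [Finset.sum_singleton] at this
  fay i j k hij hik hjk := by
    rw [← Ah.ofHol_mul, ← Ah.ofHol_mul, ← Ah.ofHol_mul, ← Ah.ofHol_sub, ← Ah.ofHol_sub,
      ← Ah.ofHol_zero]
    congr 1
    refine Hol.hext fun x => ?_
    change (phiHol l i j i j).1 x * (phiHol l j k i k).1 x
      - (phiHol l j k j k).1 x * (phiHol l i k i j).1 x
      - (phiHol l i k i k).1 x * (phiHol l i j k j).1 x = 0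
    rw [phiHol_apply l hij hij, phiHol_apply l hjk hik, phiHol_apply l hjk hjk,
      phiHol_apply l hik hij, phiHol_apply l hik hik, phiHol_apply l hij hjk.symm]
    have := phi_fay (τ := τ) (a := l.1 i - l.1 j) (b := l.1 j - l.1 k) (x := x.1 i - x.1 j)
      (y := x.1 j - x.1 k) (l.2 i j hij) (l.2 j k hjk) (by simpa using l.2 i k hik)
      (x.2 i j hij) (x.2 j k hjk) (by simpa using x.2 i k hik)
    simpa using this

theorem isDunklKernel_inv :
    IsDunklKernel (R := A0 n τ) A0.p (fun _ _ k m => A0.ofHol (invSubHol k m)) where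
  smul_p := A0.smul_p
  p_comm _ _ := mul_comm _ _
  smul_K w i j k m := by
    rw [A0.smul_ofHol]
    congr 1
    by_cases hkm : k = m
    · subst hkm; rw [invSubHol, dif_neg (by simp), invSubHol, dif_neg (by simp), map_zero]
    refine Hol.hext fun x => ?_
    rw [permHol_apply, invSubHol_apply hkm, invSubHol_apply (w.injective.ne hkm)]
    rfl
  K_comm _ _ _ _ _ _ _ _ := mul_comm _ _
  anti i j k m := by
    rw [← A0.ofHol_neg]
    congr 1
    by_cases hkm : k = m
    · subst hkm; rw [invSubHol, dif_neg (by simp), neg_zero]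
    refine Hol.hext fun x => ?_
    rw [invSubHol_apply (Ne.symm hkm)]
    refine Eq.trans ?_ (congrArg Neg.neg (invSubHol_apply hkm x).symm)
    rw [← neg_sub (x.1 k), div_neg]
  p_add_K _ _ _ _ := mul_comm _ _
  p_K _ _ _ _ _ _ _ := mul_comm _ _
  fay i j k hij hik hjk := by
    rw [← A0.ofHol_mul, ← A0.ofHol_mul, ← A0.ofHol_mul, ← A0.ofHol_sub, ← A0.ofHol_sub,
      ← A0.ofHol_zero]
    congr 1
    refine Hol.hext fun x => ?_
    change (invSubHol i j : Hol n τ).1 x * (invSubHol i k : Hol n τ).1 x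
      - (invSubHol j k : Hol n τ).1 x * (invSubHol i j : Hol n τ).1 x
      - (invSubHol i k : Hol n τ).1 x * (invSubHol k j : Hol n τ).1 x = 0
    rw [invSubHol_apply hij, invSubHol_apply hik, invSubHol_apply hjk, invSubHol_apply hjk.symm]
    have h1 := sub_ne_zero_of_mem x.2 hij
    have h2 := sub_ne_zero_of_mem x.2 hik
    have h3 := sub_ne_zero_of_mem x.2 hjk
    rw [← neg_sub (x.1 j) (x.1 k), div_neg]
    field_simp
    ring

theorem ellDunkl_commute (κ : ℂ) (l : regSet n τ) (i j : Fin n) :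
    Commute (ellDunkl κ l i) (ellDunkl κ l j) := by
  rw [ellDunkl_eq, ellDunkl_eq]
  exact (isDunklKernel_phi l).commute κ i j

theorem ratDunkl_commute (κ : ℂ) (i j : Fin n) :
    Commute (ratDunkl κ i : A0S n τ) (ratDunkl κ j) := by
  rw [ratDunkl_eq, ratDunkl_eq]
  exact isDunklKernel_inv.commute κ i j

/-! ### The classical limit on crossed products -/

/-- The classical limit as a ring homomorphism. -/
noncomputable def eta0Hom (n : ℕ) (τ : UpperHalfPlane) : Ah n τ →+* A0 n τ where
  toFun := eta0
  map_zero' := map_zero (MvPolynomial.map (PowerSeries.constantCoeff (R := Hol n τ)))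
  map_one' := map_one (MvPolynomial.map (PowerSeries.constantCoeff (R := Hol n τ)))
  map_add' := map_add (MvPolynomial.map (PowerSeries.constantCoeff (R := Hol n τ)))
  map_mul' := eta0_mul

theorem eta0_smul (c : ℂ) (a : Ah n τ) : eta0 (c • a) = c • eta0 a := by
  refine MvPolynomial.ext (R := Hol n τ) _ _ fun k => ?_
  refine (MvPolynomial.coeff_map _ _ _).trans ?_
  refine Eq.trans ?_ (MvPolynomial.coeff_smul (S₁ := ℂ) (R := Hol n τ) k c (eta0 a)).symm
  refine Eq.trans ?_ (congrArg (c • ·) (MvPolynomial.coeff_map _ _ _).symm)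
  refine (congrArg (PowerSeries.constantCoeff (R := Hol n τ))
    (MvPolynomial.coeff_smul (S₁ := ℂ) (R := HolH n τ) k c a)).trans ?_
  rw [← PowerSeries.coeff_zero_eq_constantCoeff_apply, ← PowerSeries.coeff_zero_eq_constantCoeff_apply,
    PowerSeries.coeff_smul]

theorem eta0_perm (w : Equiv.Perm (Fin n)) (a : Ah n τ) : eta0 (w • a) = w • eta0 a := by
  have hc : (PowerSeries.constantCoeff (R := Hol n τ)).comp (permHolH w)
      = (permHol w).comp (PowerSeries.constantCoeff (R := Hol n τ)) := by
    refine RingHom.ext fun f => ?_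
    change PowerSeries.constantCoeff (PowerSeries.map (permHol w) f) = _
    rw [← PowerSeries.coeff_zero_eq_constantCoeff_apply, PowerSeries.coeff_map]
    simp
  have key : ∀ a : MvPolynomial (Fin n) (HolH n τ),
      MvPolynomial.map (PowerSeries.constantCoeff (R := Hol n τ))
        (MvPolynomial.rename w (MvPolynomial.map (permHolH w) a))
      = MvPolynomial.rename w (MvPolynomial.map (permHol w)
        (MvPolynomial.map (PowerSeries.constantCoeff (R := Hol n τ)) a)) := by
    intro a
    rw [MvPolynomial.map_rename, MvPolynomial.map_map, MvPolynomial.map_map, hc]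
  exact key a

/-- The classical limit on the crossed products. -/
noncomputable def eta0S (n : ℕ) (τ : UpperHalfPlane) : AhS n τ →+* A0S n τ :=
  SkewMonoidAlgebra.liftNCRingHom
    ((SkewMonoidAlgebra.singleOneRingHom (k := A0 n τ) (G := Equiv.Perm (Fin n))).comp (eta0Hom n τ))
    (SkewMonoidAlgebra.of (A0 n τ) (Equiv.Perm (Fin n))) (by
      intro a w
      change SkewMonoidAlgebra.single 1 (eta0 (w • a)) * SkewMonoidAlgebra.single w 1
        = SkewMonoidAlgebra.single w 1 * SkewMonoidAlgebra.single 1 (eta0 a)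
      rw [SkewMonoidAlgebra.single_mul_single, SkewMonoidAlgebra.single_mul_single, eta0_perm]
      simp)

theorem eta0S_single (w : Equiv.Perm (Fin n)) (a : Ah n τ) :
    eta0S n τ (SkewMonoidAlgebra.single w a) = SkewMonoidAlgebra.single w (eta0 a) := by
  refine (SkewMonoidAlgebra.liftNC_single _ _ _ _).trans ?_
  change SkewMonoidAlgebra.single 1 (eta0 a) * SkewMonoidAlgebra.single w 1 = _
  rw [SkewMonoidAlgebra.single_mul_single]
  simp

theorem coeff_eta0S (a : AhS n τ) (w : Equiv.Perm (Fin n)) :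
    (eta0S n τ a).coeff w = eta0 (a.coeff w) := by
  induction a using SkewMonoidAlgebra.induction_on with
  | zero => rw [map_zero]; exact (map_zero (eta0Hom n τ)).symm
  | single v a =>
    rw [eta0S_single, SkewMonoidAlgebra.coeff_single_apply, SkewMonoidAlgebra.coeff_single_apply]
    split_ifs
    · rfl
    · exact (map_zero (eta0Hom n τ)).symm
  | add p q hp hq =>
    rw [map_add, SkewMonoidAlgebra.coeff_add, SkewMonoidAlgebra.coeff_add, Finsupp.add_apply,
      Finsupp.add_apply, hp, hq]
    exact (map_add (eta0Hom n τ) _ _).symm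

theorem eta0S_smul (c : ℂ) (a : AhS n τ) : eta0S n τ (c • a) = c • eta0S n τ a := by
  refine SkewMonoidAlgebra.ext fun w => ?_
  rw [coeff_eta0S, SkewMonoidAlgebra.coeff_smul, SkewMonoidAlgebra.coeff_smul, Finsupp.smul_apply,
    Finsupp.smul_apply, coeff_eta0S, eta0_smul]

theorem eta0S_ellDunkl (κ : ℂ) (l : regSet n τ) (i : Fin n) :
    eta0S n τ (ellDunkl κ l i) = ellDunklC κ l i := by
  rw [ellDunkl, ellDunklC, map_sub, eta0S_smul, map_sum, eta0S_single]
  refine congrArg₂ _ ?_ (congrArg _ ?_)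
  · congr 1
    exact MvPolynomial.map_X _ _
  · refine Finset.sum_congr rfl fun j _ => ?_
    rw [eta0S_single]
    congr 1
    refine (MvPolynomial.map_C _ _).trans ?_
    rw [PowerSeries.constantCoeff_C]
    rfl

/-- Substitution is compatible with ring homomorphisms that respect the scalars. -/
theorem map_subst {B B' : Type*} [Ring B] [Module ℂ B] [Ring B'] [Module ℂ B'] (φ : B →+* B')
    (hφ : ∀ (c : ℂ) b, φ (c • b) = c • φ b) (y : Fin n → B) (f : MvPolynomial (Fin n) ℂ) :
    φ (subst y f) = subst (fun i => φ (y i)) f := by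
  rw [subst, subst, map_sum]
  refine Finset.sum_congr rfl fun k _ => ?_
  rw [hφ, map_list_prod, List.map_ofFn]
  congr 3
  funext i
  exact map_pow φ _ _

theorem ellDunklC_commute (κ : ℂ) (l : regSet n τ) (i j : Fin n) :
    Commute (ellDunklC κ l i) (ellDunklC κ l j) := by
  rw [← eta0S_ellDunkl, ← eta0S_ellDunkl]
  exact (ellDunkl_commute κ l i j).map (eta0S n τ)

end ConcreteDunkl

/-! ### The residue -/

section Residue

open SkewMonoidAlgebra

variable {n : ℕ}

theorem res_add {R : Type*} [AddCommMonoid R] (a b : SkewMonoidAlgebra R (Equiv.Perm (Fin n))) :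
    res (a + b) = res a + res b := by
  simp only [res, coeff_add, Finsupp.add_apply, Finset.sum_add_distrib]

theorem res_zero {R : Type*} [AddCommMonoid R] :
    res (0 : SkewMonoidAlgebra R (Equiv.Perm (Fin n))) = 0 := by
  simp [res]

theorem res_single {R : Type*} [AddCommMonoid R] (w : Equiv.Perm (Fin n)) (a : R) :
    res (single w a) = a := by
  simp [res]

variable {R : Type*} [Ring R] [MulSemiringAction (Equiv.Perm (Fin n)) R]

/-- Left multiplication by `w` acts on the residue by `w`, right multiplication trivially. -/
theorem res_single_mul (w : Equiv.Perm (Fin n)) (a : SkewMonoidAlgebra R (Equiv.Perm (Fin n))) :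
    res (single w 1 * a) = w • res a := by
  induction a using SkewMonoidAlgebra.induction_on with
  | zero => rw [mul_zero, res_zero, smul_zero]
  | single v a => rw [single_mul_single, res_single, res_single, one_mul]
  | add p q hp hq => rw [mul_add, res_add, res_add, hp, hq, smul_add]

theorem res_mul_single (w : Equiv.Perm (Fin n)) (a : SkewMonoidAlgebra R (Equiv.Perm (Fin n))) :
    res (a * single w 1) = res a := by
  induction a using SkewMonoidAlgebra.induction_on with
  | zero => rw [zero_mul]
  | single v a => rw [single_mul_single, res_single, res_single, smul_one, mul_one]
  | add p q hp hq => rw [add_mul, res_add, res_add, hp, hq]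

/-- The residue of an element that commutes with `w` is `w`-invariant. -/
theorem smul_res_eq_of_commute {w : Equiv.Perm (Fin n)}
    {a : SkewMonoidAlgebra R (Equiv.Perm (Fin n))} (h : single w 1 * a = a * single w 1) :
    w • res a = res a := by
  rw [← res_single_mul, h, res_mul_single]

end Residue

/-! ### Equivariance of Dunkl operators -/

section Equivariance

open SkewMonoidAlgebra

variable {n : ℕ}

/-- An element `g` that intertwines `y'_i` with `y_{w(i)}` intertwines the substitutions. -/
theorem subst_intertwine {B : Type*} [Ring B] [Module ℂ B] [IsScalarTower ℂ B B]
    [SMulCommClass ℂ B B] {y y' : Fin n → B} (hy : ∀ i j, Commute (y i) (y j))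
    (hy' : ∀ i j, Commute (y' i) (y' j)) {g : B} {w : Equiv.Perm (Fin n)}
    (h : ∀ i, g * y' i = y (w i) * g) (f : MvPolynomial (Fin n) ℂ) :
    g * subst y' f = subst y (MvPolynomial.rename w f) * g := by
  obtain ⟨φ, hφ, hX, hc⟩ := exists_ringHom_eq_subst y hy
  obtain ⟨φ', hφ', hX', hc'⟩ := exists_ringHom_eq_subst y' hy'
  rw [← hφ, ← hφ']
  induction f using MvPolynomial.induction_on with
  | C c =>
    have e : (MvPolynomial.C c : MvPolynomial (Fin n) ℂ) = c • 1 := by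
      rw [MvPolynomial.smul_eq_C_mul, mul_one]
    rw [MvPolynomial.rename_C, e, hc, hc', map_one, map_one, mul_smul_comm, smul_mul_assoc, mul_one,
      one_mul]
  | add p q hp hq => rw [map_add, map_add, map_add, mul_add, add_mul, hp, hq]
  | mul_X p i hp =>
    rw [map_mul, map_mul, map_mul, MvPolynomial.rename_X, hX, hX', ← mul_assoc, hp, mul_assoc, h,
      mul_assoc]

/-- Conjugation by `w` permutes the Dunkl operators, if it permutes momenta and kernels. The kernel
may depend on a parameter that is permuted as well, hence the two kernels `K` and `K'`. -/
theorem single_mul_dunkl {R : Type*} [Ring R] [Module ℂ R] [MulSemiringAction (Equiv.Perm (Fin n)) R]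
    [IsScalarTower ℂ R R] [SMulCommClass ℂ R R] [SMulCommClass (Equiv.Perm (Fin n)) ℂ R]
    {p : Fin n → R} {K K' : Fin n → Fin n → Fin n → Fin n → R} {w : Equiv.Perm (Fin n)}
    (hp : ∀ i, w • p i = p (w i)) (hK : ∀ i j k l, w • K' i j k l = K (w i) (w j) (w k) (w l))
    (κ : ℂ) (i : Fin n) :
    single w 1 * dunkl p K' κ i = dunkl p K κ (w i) * single w 1 := by
  rw [dunkl, dunkl, mul_sub, sub_mul, mul_smul_comm, smul_mul_assoc, Finset.mul_sum, Finset.sum_mul,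
    single_mul_single, single_mul_single]
  congr 1
  · simp [hp]
  · congr 1
    refine Fintype.sum_equiv (w.subtypeEquiv fun j => by simp) _ _ fun j => ?_
    rw [single_mul_single, single_mul_single, hK]
    simp [Equiv.mul_swap_eq_swap_mul]

variable {τ : UpperHalfPlane}

/-- The regular point `l ∘ w`. -/
def permReg (w : Equiv.Perm (Fin n)) (l : regSet n τ) : regSet n τ :=
  ⟨l.1 ∘ w, comp_mem_regSet w l.2⟩

theorem permHol_phiHol_permReg (l : regSet n τ) (w : Equiv.Perm (Fin n)) (i j k m : Fin n) :
    permHol w (phiHol (permReg w l) i j k m) = phiHol l (w i) (w j) (w k) (w m) := by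
  rw [permHol_phiHol]
  by_cases hij : i = j
  · subst hij; rw [phiHol_left, phiHol_left]
  by_cases hkm : k = m
  · subst hkm; rw [phiHol_right, phiHol_right]
  refine Hol.hext fun x => ?_
  rw [phiHol_apply _ hij (w.injective.ne hkm), phiHol_apply l (w.injective.ne hij) (w.injective.ne hkm)]
  rfl

theorem single_mul_ellDunkl (κ : ℂ) (w : Equiv.Perm (Fin n)) (l : regSet n τ) (i : Fin n) :
    single w 1 * ellDunkl κ (permReg w l) i = ellDunkl κ l (w i) * single w 1 := by
  rw [ellDunkl_eq, ellDunkl_eq]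
  exact single_mul_dunkl (Ah.smul_p w)
    (fun i j k m => by rw [Ah.smul_ofHol, permHol_phiHol_permReg]) κ i

theorem single_mul_ratDunkl (κ : ℂ) (w : Equiv.Perm (Fin n)) (i : Fin n) :
    single w 1 * (ratDunkl κ i : A0S n τ) = ratDunkl κ (w i) * single w 1 := by
  rw [ratDunkl_eq, ratDunkl_eq]
  exact single_mul_dunkl (A0.smul_p w)
    (fun i j k m => isDunklKernel_inv.smul_K w i j k m) κ i

/-- The value of `w F` at `λ` is the value of `F` at `w⁻¹ λ` with permuted momenta. -/
theorem evalAt_smul (l : regSet n τ) (w : Equiv.Perm (Fin n)) (F : A0 n τ) :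
    (w • F).evalAt l = MvPolynomial.rename w (F.evalAt (permReg w l)) := by
  have key : ∀ F : MvPolynomial (Fin n) (Hol n τ),
      MvPolynomial.map (Hol.eval l) (MvPolynomial.rename w (MvPolynomial.map (permHol w) F))
      = MvPolynomial.rename w (MvPolynomial.map (Hol.eval (permReg w l)) F) := by
    intro F
    rw [MvPolynomial.map_rename, MvPolynomial.map_map]
    rfl
  exact key F

end Equivariance

/-! ### The action on functions of the spectral parameter -/

section Quantization

open SkewMonoidAlgebra

variable {n : ℕ} {τ : UpperHalfPlane} (κ : ℂ)

/-- The algebra map `f ↦ f(y_1(λ), …, y_n(λ))`. -/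
noncomputable def substEll (l : regSet n τ) : MvPolynomial (Fin n) ℂ →+* AhS n τ :=
  (exists_ringHom_eq_subst (ellDunkl κ l) (ellDunkl_commute κ l)).choose

theorem substEll_apply (l : regSet n τ) (f : MvPolynomial (Fin n) ℂ) :
    substEll κ l f = subst (ellDunkl κ l) f :=
  (exists_ringHom_eq_subst (ellDunkl κ l) (ellDunkl_commute κ l)).choose_spec.1 f

theorem substEll_X (l : regSet n τ) (i : Fin n) :
    substEll κ l (MvPolynomial.X i) = ellDunkl κ l i :=
  (exists_ringHom_eq_subst (ellDunkl κ l) (ellDunkl_commute κ l)).choose_spec.2.1 i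

theorem substEll_smul (l : regSet n τ) (c : ℂ) (f : MvPolynomial (Fin n) ℂ) :
    substEll κ l (c • f) = c • substEll κ l f :=
  (exists_ringHom_eq_subst (ellDunkl κ l) (ellDunkl_commute κ l)).choose_spec.2.2 c f

/-- `A0.evalAt` as a ring homomorphism. -/
noncomputable def evalAtHom (l : regSet n τ) : A0 n τ →+* MvPolynomial (Fin n) ℂ :=
  MvPolynomial.map (R := Hol n τ) (Hol.eval l)

theorem evalAtHom_apply (l : regSet n τ) (F : A0 n τ) : evalAtHom l F = F.evalAt l := rfl

theorem coeff_evalAt (l : regSet n τ) (F : A0 n τ) (k : Fin n →₀ ℕ) :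
    (F.evalAt l).coeff k = (F.coeff k).1 l :=
  MvPolynomial.coeff_map (R := Hol n τ) (Hol.eval l) F k

theorem evalAt_p (l : regSet n τ) (i : Fin n) : (A0.p i : A0 n τ).evalAt l = MvPolynomial.X i :=
  MvPolynomial.map_X (R := Hol n τ) (Hol.eval l) i

theorem evalAt_ofHol (l : regSet n τ) (f : Hol n τ) :
    (A0.ofHol f).evalAt l = MvPolynomial.C (f.1 l) :=
  MvPolynomial.map_C (R := Hol n τ) (Hol.eval l) f

theorem A0.coeff_smul (c : ℂ) (F : A0 n τ) (k : Fin n →₀ ℕ) :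
    (c • F).coeff k = c • F.coeff k :=
  MvPolynomial.coeff_smul (S₁ := ℂ) (R := Hol n τ) k c F

theorem evalAt_smul_complex (l : regSet n τ) (c : ℂ) (F : A0 n τ) :
    (c • F).evalAt l = c • F.evalAt l := by
  refine MvPolynomial.ext _ _ fun k => ?_
  rw [MvPolynomial.coeff_smul, coeff_evalAt, coeff_evalAt, A0.coeff_smul]
  rfl

/-- The ring homomorphism `f(x, p) ↦ f(λ, y(λ))` from `A_0` to `A_ħ * S_n`. -/
noncomputable def hat (l : regSet n τ) : A0 n τ →+* AhS n τ :=
  (substEll κ l).comp (evalAtHom l)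

theorem hat_apply (l : regSet n τ) (F : A0 n τ) : hat κ l F = subst (ellDunkl κ l) (F.evalAt l) :=
  substEll_apply κ l _

theorem hat_p (l : regSet n τ) (i : Fin n) : hat κ l (A0.p i) = ellDunkl κ l i := by
  rw [hat, RingHom.comp_apply, evalAtHom_apply, evalAt_p, substEll_X]

theorem hat_smul (l : regSet n τ) (c : ℂ) (F : A0 n τ) : hat κ l (c • F) = c • hat κ l F := by
  rw [hat, RingHom.comp_apply, evalAtHom_apply, evalAt_smul_complex, substEll_smul]
  rfl

theorem hat_ofHol (l : regSet n τ) (f : Hol n τ) : hat κ l (A0.ofHol f) = f.1 l • 1 := by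
  rw [hat, RingHom.comp_apply, evalAtHom_apply, evalAt_ofHol, ← mul_one (MvPolynomial.C _),
    ← MvPolynomial.smul_eq_C_mul, substEll_smul, map_one]

/-- The equivariance that makes `actFun` an action: `w F(w⁻¹ λ, y(w⁻¹ λ)) = (w F)(λ, y(λ)) w`. -/
theorem single_mul_hat (w : Equiv.Perm (Fin n)) (l : regSet n τ) (F : A0 n τ) :
    single w 1 * hat κ (permReg w l) F = hat κ l (w • F) * single w 1 := by
  rw [hat_apply, hat_apply, evalAt_smul]
  exact subst_intertwine (ellDunkl_commute κ l) (ellDunkl_commute κ _)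
    (single_mul_ellDunkl κ w l) _

/-- The action of `A_0 * S_n` on functions `G` of the spectral parameter with values in
`A_ħ * S_n`: an element `F` of `A_0` multiplies `G(λ)` by `F(λ, y(λ))`, and a permutation `w` sends
`G` to `w G(w⁻¹ λ)`. -/
noncomputable def actFun (h : A0S n τ) (G : regSet n τ → AhS n τ) (l : regSet n τ) : AhS n τ :=
  ∑ w, hat κ l (h.coeff w) * (single w 1 * G (permReg w l))

theorem actFun_single (v : Equiv.Perm (Fin n)) (a : A0 n τ) (G : regSet n τ → AhS n τ)
    (l : regSet n τ) :
    actFun κ (single v a) G l = hat κ l a * (single v 1 * G (permReg v l)) := by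
  rw [actFun, Finset.sum_eq_single v]
  · rw [coeff_single_apply, if_pos rfl]
  · intro w _ hw
    rw [coeff_single_apply, if_neg hw.symm, map_zero, zero_mul]
  · simp

theorem actFun_add (h h' : A0S n τ) (G : regSet n τ → AhS n τ) :
    actFun κ (h + h') G = actFun κ h G + actFun κ h' G := by
  funext l
  simp only [actFun, Pi.add_apply, coeff_add, Finsupp.add_apply, map_add, add_mul,
    Finset.sum_add_distrib]

theorem actFun_zero (G : regSet n τ → AhS n τ) : actFun κ 0 G = 0 := by
  funext l
  simp [actFun]

theorem actFun_map_add (h : A0S n τ) (G G' : regSet n τ → AhS n τ) :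
    actFun κ h (G + G') = actFun κ h G + actFun κ h G' := by
  funext l
  simp only [actFun, Pi.add_apply, mul_add, Finset.sum_add_distrib]

theorem actFun_map_zero (h : A0S n τ) : actFun κ h 0 = 0 := by
  funext l
  simp [actFun]

theorem actFun_smul (c : ℂ) (h : A0S n τ) (G : regSet n τ → AhS n τ) :
    actFun κ (c • h) G = c • actFun κ h G := by
  funext l
  simp only [actFun, Pi.smul_apply, coeff_smul, Finsupp.smul_apply, hat_smul, smul_mul_assoc,
    Finset.smul_sum]

theorem actFun_one (G : regSet n τ → AhS n τ) : actFun κ 1 G = G := by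
  funext l
  rw [one_def, actFun_single, map_one, one_mul, ← one_def, one_mul]
  rfl

/-- `actFun` is an action: for `F ∈ A_0` and permutations by `single_mul_hat`. -/
theorem actFun_mul (h h' : A0S n τ) (G : regSet n τ → AhS n τ) :
    actFun κ (h * h') G = actFun κ h (actFun κ h' G) := by
  induction h using SkewMonoidAlgebra.induction_on with
  | zero => rw [zero_mul, actFun_zero, actFun_zero]
  | add p q hp hq => rw [add_mul, actFun_add, actFun_add, hp, hq]
  | single v a =>
    induction h' using SkewMonoidAlgebra.induction_on with
    | zero => rw [mul_zero, actFun_zero, actFun_map_zero]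
    | add p q hp hq => rw [mul_add, actFun_add, actFun_add, actFun_map_add, hp, hq]
    | single w b =>
      funext l
      rw [single_mul_single, actFun_single, actFun_single, actFun_single, map_mul, mul_assoc,
        ← mul_assoc (single v 1) (hat κ _ b), single_mul_hat, mul_assoc (hat κ l (v • b)),
        ← mul_assoc (single v 1) (single w 1), single_mul_single, smul_one, one_mul]
      rfl

/-- On equivariant functions `h` acts as multiplication by `Res(h)(λ, y(λ))`. -/
theorem actFun_of_equivariant (h : A0S n τ) {G : regSet n τ → AhS n τ} {l : regSet n τ}
    (hG : ∀ w, single w 1 * G (permReg w l) = G l) :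
    actFun κ h G l = hat κ l (res h) * G l := by
  rw [res, _root_.map_sum, Finset.sum_mul]
  exact Finset.sum_congr rfl fun w _ => by rw [hG]

theorem actFun_sum {ι : Type*} (s : Finset ι) (h : ι → A0S n τ) (G : regSet n τ → AhS n τ) :
    actFun κ (∑ i ∈ s, h i) G = ∑ i ∈ s, actFun κ (h i) G := by
  classical
  induction s using Finset.induction_on with
  | empty => exact actFun_zero κ G
  | insert i s hi ih => rw [Finset.sum_insert hi, Finset.sum_insert hi, actFun_add, ih]

end Quantization

/-! ### Analytic families -/

section Families

variable {n : ℕ} {τ : UpperHalfPlane} {E : Type*} [NormedAddCommGroup E] [NormedSpace ℂ E]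

/-- A family of elements of `Hol n τ` that depends analytically on a parameter in `Ω`, jointly with
the variable `x`. -/
def HolFamily (Ω : Set E) (f : E → Hol n τ) : Prop :=
  AnalyticOnNhd ℂ (fun z : E × (Fin n → ℂ) => extZero (f z.1).1 z.2) (Ω ×ˢ regSet n τ)

variable {Ω : Set E}

/-- It suffices to give the values at regular points by a function analytic in all variables. -/
theorem HolFamily.of_eq (hΩ : IsOpen Ω) {f : E → Hol n τ} (g : E × (Fin n → ℂ) → ℂ)
    (h : ∀ e ∈ Ω, ∀ x : regSet n τ, (f e).1 x = g (e, x.1))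
    (hg : AnalyticOnNhd ℂ g (Ω ×ˢ regSet n τ)) : HolFamily Ω f := by
  intro z hz
  refine (hg z hz).congr ?_
  filter_upwards [(hΩ.prod (isOpen_regSet n τ)).mem_nhds hz] with y hy
  exact ((extZero_apply (f y.1).1 ⟨y.2, hy.2⟩).trans (h _ hy.1 ⟨y.2, hy.2⟩)).symm

theorem HolFamily.congr (hΩ : IsOpen Ω) {f g : E → Hol n τ} (hf : HolFamily Ω f)
    (h : ∀ e ∈ Ω, g e = f e) : HolFamily Ω g :=
  HolFamily.of_eq hΩ _ (fun e he x => by rw [h e he]; exact (extZero_apply _ x).symm) hf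

theorem HolFamily.add (hΩ : IsOpen Ω) {f g : E → Hol n τ} (hf : HolFamily Ω f)
    (hg : HolFamily Ω g) : HolFamily Ω fun e => f e + g e :=
  HolFamily.of_eq hΩ _ (fun e _ x => by
    change (f e).1 x + (g e).1 x = _
    rw [← extZero_apply (f e).1, ← extZero_apply (g e).1]; rfl) (AnalyticOnNhd.add hf hg)

theorem HolFamily.mul (hΩ : IsOpen Ω) {f g : E → Hol n τ} (hf : HolFamily Ω f)
    (hg : HolFamily Ω g) : HolFamily Ω fun e => f e * g e :=
  HolFamily.of_eq hΩ _ (fun e _ x => by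
    change (f e).1 x * (g e).1 x = _
    rw [← extZero_apply (f e).1, ← extZero_apply (g e).1]) (AnalyticOnNhd.mul hf hg)

theorem HolFamily.smul (hΩ : IsOpen Ω) {c : E → ℂ} (hc : AnalyticOnNhd ℂ c Ω) {f : E → Hol n τ}
    (hf : HolFamily Ω f) : HolFamily Ω fun e => c e • f e :=
  HolFamily.of_eq hΩ (fun z => c z.1 * extZero (f z.1).1 z.2)
    (fun e _ x => congrArg (c e * ·) (extZero_apply (f e).1 x).symm) fun z hz =>
      (AnalyticAt.comp (g := c) (f := Prod.fst) (hc z.1 hz.1) analyticAt_fst).mul (hf z hz)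

theorem HolFamily.const (hΩ : IsOpen Ω) (f : Hol n τ) : HolFamily Ω fun _ : E => f :=
  HolFamily.of_eq hΩ (fun z => extZero f.1 z.2) (fun _ _ x => (extZero_apply f.1 x).symm)
    fun z hz => AnalyticAt.comp (g := extZero f.1) (f := Prod.snd) (f.2 z.2 hz.2) analyticAt_snd

theorem HolFamily.pderiv (hΩ : IsOpen Ω) {f : E → Hol n τ} (hf : HolFamily Ω f) (i : Fin n) :
    HolFamily Ω fun e => pderivHol i (f e) := by
  refine HolFamily.of_eq hΩ (fun z => fderiv ℂ (fun z : E × (Fin n → ℂ) => extZero (f z.1).1 z.2) z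
    (0, Pi.single i 1)) (fun e he x => ?_) fun z hz =>
      ((ContinuousLinearMap.apply ℂ ℂ ((0, Pi.single i 1) : E × (Fin n → ℂ))).analyticAt _).comp
        (hf z hz).fderiv
  rw [pderivHol_apply]
  have h1 := (hf (e, x.1) ⟨he, x.2⟩).differentiableAt.hasFDerivAt
  have h2 : HasFDerivAt (fun y : Fin n → ℂ => (e, y)) (ContinuousLinearMap.inr ℂ E (Fin n → ℂ)) x.1 :=
    hasFDerivAt_prodMk_right e x.1
  have h3 := HasFDerivAt.comp x.1 (f := fun y : Fin n → ℂ => (e, y)) h1 h2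
  refine (congrArg (fun L => L (Pi.single i 1)) h3.fderiv).trans ?_
  rfl

theorem HolFamily.perm (hΩ : IsOpen Ω) {f : E → Hol n τ} (hf : HolFamily Ω f)
    (w : Equiv.Perm (Fin n)) : HolFamily Ω fun e => permHol w (f e) := by
  refine HolFamily.of_eq hΩ (fun z => extZero (f z.1).1 (permL w z.2)) (fun e he x => ?_)
    fun z hz => ?_
  · exact (extZero_apply (f e).1 ⟨x.1 ∘ w, comp_mem_regSet w x.2⟩).symm
  · refine AnalyticAt.comp (g := fun z : E × (Fin n → ℂ) => extZero (f z.1).1 z.2)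
      (f := fun z : E × (Fin n → ℂ) => (z.1, permL w z.2))
      (hf (z.1, permL w z.2) ⟨hz.1, comp_mem_regSet w hz.2⟩)
      (analyticAt_fst.prod (((permL w).analyticAt _).comp analyticAt_snd))

theorem HolFamily.comp {E' : Type*} [NormedAddCommGroup E'] [NormedSpace ℂ E'] {Ω' : Set E'}
    {f : E → Hol n τ} (hf : HolFamily Ω f) {g : E' → E} (hg : AnalyticOnNhd ℂ g Ω')
    (h : Set.MapsTo g Ω' Ω) : HolFamily Ω' fun e => f (g e) := fun z hz =>
  AnalyticAt.comp (g := fun z : E × (Fin n → ℂ) => extZero (f z.1).1 z.2)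
    (f := fun z : E' × (Fin n → ℂ) => (g z.1, z.2)) (hf (g z.1, z.2) ⟨h hz.1, hz.2⟩)
    ((AnalyticAt.comp (g := g) (f := Prod.fst) (hg z.1 hz.1) analyticAt_fst).prod analyticAt_snd)

theorem HolFamily.sum (hΩ : IsOpen Ω) {ι : Type*} (s : Finset ι) {f : ι → E → Hol n τ}
    (hf : ∀ i ∈ s, HolFamily Ω (f i)) : HolFamily Ω fun e => ∑ i ∈ s, f i e := by
  classical
  induction s using Finset.induction_on with
  | empty => simpa using HolFamily.const hΩ 0
  | insert i s hi ih =>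
    simp only [Finset.sum_insert hi]
    exact (hf i (Finset.mem_insert_self i s)).add hΩ
      (ih fun j hj => hf j (Finset.mem_insert_of_mem hj))

/-- An analytic family of power series in `ħ`. -/
def HolHFamily (Ω : Set E) (f : E → HolH n τ) : Prop :=
  ∀ m, HolFamily Ω fun e => PowerSeries.coeff m (f e)

theorem HolHFamily.congr (hΩ : IsOpen Ω) {f g : E → HolH n τ} (hf : HolHFamily Ω f)
    (h : ∀ e ∈ Ω, g e = f e) : HolHFamily Ω g :=
  fun m => (hf m).congr hΩ fun e he => by rw [h e he]

theorem HolHFamily.add (hΩ : IsOpen Ω) {f g : E → HolH n τ} (hf : HolHFamily Ω f)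
    (hg : HolHFamily Ω g) : HolHFamily Ω fun e => f e + g e := fun m => by
  simp only [map_add]
  exact (hf m).add hΩ (hg m)

theorem HolHFamily.mul (hΩ : IsOpen Ω) {f g : E → HolH n τ} (hf : HolHFamily Ω f)
    (hg : HolHFamily Ω g) : HolHFamily Ω fun e => f e * g e := fun m => by
  simp only [PowerSeries.coeff_mul]
  exact HolFamily.sum hΩ _ fun p _ => (hf p.1).mul hΩ (hg p.2)

theorem HolHFamily.smul (hΩ : IsOpen Ω) {c : E → ℂ} (hc : AnalyticOnNhd ℂ c Ω) {f : E → HolH n τ}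
    (hf : HolHFamily Ω f) : HolHFamily Ω fun e => c e • f e := fun m => by
  simp only [PowerSeries.coeff_smul]
  exact (hf m).smul hΩ hc

theorem HolHFamily.const (hΩ : IsOpen Ω) (f : HolH n τ) : HolHFamily Ω fun _ : E => f :=
  fun _ => HolFamily.const hΩ _

theorem HolHFamily.C (hΩ : IsOpen Ω) {f : E → Hol n τ} (hf : HolFamily Ω f) :
    HolHFamily Ω fun e => PowerSeries.C (f e) := fun m => by
  simp only [PowerSeries.coeff_C]
  split_ifs
  · exact hf
  · exact HolFamily.const hΩ 0

theorem HolHFamily.hbarPartial (hΩ : IsOpen Ω) {f : E → HolH n τ} (hf : HolHFamily Ω f) (i : Fin n) :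
    HolHFamily Ω fun e => hbarPartial i (f e) := fun m => by
  rcases m with _ | m
  · simp only [coeff_zero_hbarPartial]
    exact HolFamily.const hΩ 0
  · simp only [coeff_hbarPartial]
    exact (hf m).pderiv hΩ i

theorem HolHFamily.perm (hΩ : IsOpen Ω) {f : E → HolH n τ} (hf : HolHFamily Ω f)
    (w : Equiv.Perm (Fin n)) : HolHFamily Ω fun e => permHolH w (f e) := fun m =>
  ((hf m).perm hΩ w).congr hΩ fun e _ => by
    change PowerSeries.coeff m (PowerSeries.map (permHol w) (f e)) = _
    rw [PowerSeries.coeff_map]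

/-- An analytic family of polynomials in the momenta, of bounded degree. This is `AhFamily` for the
polynomials underlying the elements of `A_ħ`; the commutative product of polynomials is available
here. -/
def PolyFamily (Ω : Set E) (f : E → MvPolynomial (Fin n) (HolH n τ)) : Prop :=
  (∃ S : Finset (Fin n →₀ ℕ), ∀ e ∈ Ω, ∀ k ∉ S, (f e).coeff k = 0) ∧
    ∀ k, HolHFamily Ω fun e => (f e).coeff k

/-- An analytic family of elements of `A_ħ`; the degrees in the momenta are bounded. -/
def AhFamily (Ω : Set E) (f : E → Ah n τ) : Prop :=
  (∃ S : Finset (Fin n →₀ ℕ), ∀ e ∈ Ω, ∀ k ∉ S, MvPolynomial.coeff (R := HolH n τ) k (f e) = 0) ∧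
    ∀ k, HolHFamily Ω fun e => MvPolynomial.coeff (R := HolH n τ) k (f e)

theorem AhFamily.congr (hΩ : IsOpen Ω) {f g : E → Ah n τ} (hf : AhFamily Ω f)
    (h : ∀ e ∈ Ω, g e = f e) : AhFamily Ω g := by
  obtain ⟨S, hS⟩ := hf.1
  exact ⟨⟨S, fun e he k hk => by rw [h e he]; exact hS e he k hk⟩,
    fun k => (hf.2 k).congr hΩ fun e he => by rw [h e he]⟩

theorem AhFamily.add (hΩ : IsOpen Ω) {f g : E → Ah n τ} (hf : AhFamily Ω f)
    (hg : AhFamily Ω g) : AhFamily Ω fun e => f e + g e := by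
  classical
  obtain ⟨S, hS⟩ := hf.1
  obtain ⟨T, hT⟩ := hg.1
  have key : ∀ k e, MvPolynomial.coeff (R := HolH n τ) k (f e + g e)
      = MvPolynomial.coeff (R := HolH n τ) k (f e) + MvPolynomial.coeff (R := HolH n τ) k (g e) :=
    fun k e => MvPolynomial.coeff_add (R := HolH n τ) k (f e) (g e)
  refine ⟨⟨S ∪ T, fun e he k hk => ?_⟩, fun k => ?_⟩
  · rw [Finset.mem_union, not_or] at hk
    rw [key, hS e he k hk.1, hT e he k hk.2, add_zero]
  · exact ((hf.2 k).add hΩ (hg.2 k)).congr hΩ fun e _ => key k e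

theorem AhFamily.const (hΩ : IsOpen Ω) (f : Ah n τ) : AhFamily Ω fun _ : E => f :=
  ⟨⟨MvPolynomial.support (R := HolH n τ) f, fun _ _ _ hk => MvPolynomial.notMem_support_iff.mp hk⟩,
    fun _ => HolHFamily.const hΩ _⟩

theorem AhFamily.smul (hΩ : IsOpen Ω) {c : E → ℂ} (hc : AnalyticOnNhd ℂ c Ω) {f : E → Ah n τ}
    (hf : AhFamily Ω f) : AhFamily Ω fun e => c e • f e := by
  have key : ∀ k e, MvPolynomial.coeff (R := HolH n τ) k (c e • f e)
      = c e • MvPolynomial.coeff (R := HolH n τ) k (f e) :=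
    fun k e => MvPolynomial.coeff_smul (S₁ := ℂ) (R := HolH n τ) k (c e) (f e)
  obtain ⟨S, hS⟩ := hf.1
  refine ⟨⟨S, fun e he k hk => ?_⟩, fun k => ?_⟩
  · rw [key, hS e he k hk, smul_zero]
  · exact ((hf.2 k).smul hΩ hc).congr hΩ fun e _ => key k e

theorem AhFamily.sum (hΩ : IsOpen Ω) {ι : Type*} (s : Finset ι) {f : ι → E → Ah n τ}
    (hf : ∀ i ∈ s, AhFamily Ω (f i)) : AhFamily Ω fun e => ∑ i ∈ s, f i e := by
  classical
  induction s using Finset.induction_on with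
  | empty => simpa using AhFamily.const hΩ 0
  | insert i s hi ih =>
    simp only [Finset.sum_insert hi]
    exact (hf i (Finset.mem_insert_self i s)).add hΩ
      (ih fun j hj => hf j (Finset.mem_insert_of_mem hj))

theorem PolyFamily.C_mul (hΩ : IsOpen Ω) {f : E → HolH n τ} {g : E → MvPolynomial (Fin n) (HolH n τ)}
    (hf : HolHFamily Ω f) (hg : PolyFamily Ω g) :
    PolyFamily Ω fun e => MvPolynomial.C (f e) * g e := by
  obtain ⟨S, hS⟩ := hg.1
  refine ⟨⟨S, fun e he k hk => ?_⟩, fun k => ?_⟩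
  · rw [MvPolynomial.coeff_C_mul, hS e he k hk, mul_zero]
  · simp only [MvPolynomial.coeff_C_mul]
    exact hf.mul hΩ (hg.2 k)

theorem PolyFamily.opD (hΩ : IsOpen Ω) {g : E → MvPolynomial (Fin n) (HolH n τ)}
    (hg : PolyFamily Ω g) (i : Fin n) :
    PolyFamily Ω fun e => EllipticCM.opD (K := HolH n τ) hbarPartial i (g e) := by
  classical
  obtain ⟨S, hS⟩ := hg.1
  have key : ∀ k e, MvPolynomial.coeff k (EllipticCM.opD (K := HolH n τ) hbarPartial i (g e))
      = (if i ∈ k.support then MvPolynomial.coeff (k - Finsupp.single i 1) (g e) else 0)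
        + hbarPartial i (MvPolynomial.coeff k (g e)) := by
    intro k e
    rw [opD_apply, MvPolynomial.coeff_add, MvPolynomial.coeff_X_mul', coeff_coeffDer]
  refine ⟨⟨S ∪ S.image (fun k => k + Finsupp.single i 1), fun e he k hk => ?_⟩, fun k => ?_⟩
  · rw [Finset.mem_union, not_or] at hk
    rw [key, hS e he k hk.1, map_zero, add_zero]
    split_ifs with hi
    · refine hS e he _ fun hk' => hk.2 (Finset.mem_image.mpr ⟨_, hk', ?_⟩)
      refine tsub_add_cancel_of_le (Finsupp.single_le_iff.mpr ?_)
      exact Nat.one_le_iff_ne_zero.mpr (Finsupp.mem_support_iff.mp hi)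
    · rfl
  · simp only [key]
    refine HolHFamily.add hΩ ?_ ((hg.2 k).hbarPartial hΩ i)
    split_ifs
    · exact hg.2 _
    · exact HolHFamily.const hΩ 0

theorem PolyFamily.opPow (hΩ : IsOpen Ω) {g : E → MvPolynomial (Fin n) (HolH n τ)}
    (hg : PolyFamily Ω g) (k : Fin n →₀ ℕ) :
    PolyFamily Ω fun e => EllipticCM.opPow (K := HolH n τ) (d := hbarPartial) hbarPartial_comm k (g e) := by
  induction k using Finsupp.induction_linear generalizing g with
  | zero => simpa only [opPow_zero, Module.End.one_apply] using hg
  | add k l hk hl =>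
    simp only [opPow_add, Module.End.mul_apply]
    exact hk (hl hg)
  | single i m =>
    induction m generalizing g with
    | zero => simpa only [Finsupp.single_zero, opPow_zero, Module.End.one_apply] using hg
    | succ m ih =>
      simp only [Finsupp.single_add, opPow_add, Module.End.mul_apply, opPow_single]
      exact ih (hg.opD hΩ i)

/-- The product `a b` is the sum over `k` of the coefficients of `a` times `p̂^k b`, so it is
assembled from `PolyFamily.C_mul` and `PolyFamily.opPow`. -/
theorem AhFamily.mul (hΩ : IsOpen Ω) {f g : E → Ah n τ} (hf : AhFamily Ω f)
    (hg : AhFamily Ω g) : AhFamily Ω fun e => f e * g e := by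
  obtain ⟨S, hS⟩ := hf.1
  refine (AhFamily.sum (τ := τ) hΩ S fun k _ => PolyFamily.C_mul hΩ (hf.2 k) (PolyFamily.opPow hΩ hg k)).congr hΩ
    fun e he => ?_
  have hs : MvPolynomial.support (R := HolH n τ) (f e) ⊆ S := fun k hk => by
    by_contra hkS
    exact MvPolynomial.mem_support_iff.mp hk (hS e he k hkS)
  exact (congrArg (fun L => L (g e)) (opL_eq (K := HolH n τ) (d := hbarPartial) hbarPartial_comm hs)).trans
    (LinearMap.sum_apply _ _ _)

theorem AhFamily.perm (hΩ : IsOpen Ω) {g : E → Ah n τ} (hg : AhFamily Ω g)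
    (w : Equiv.Perm (Fin n)) : AhFamily Ω fun e => w • g e := by
  classical
  obtain ⟨S, hS⟩ := hg.1
  have key : ∀ k e, MvPolynomial.coeff (R := HolH n τ) (k.mapDomain w) (w • g e)
      = permHolH w (MvPolynomial.coeff (R := HolH n τ) k (g e)) := by
    intro k e
    refine (MvPolynomial.coeff_rename_mapDomain _ w.injective _ _).trans ?_
    exact MvPolynomial.coeff_map _ _ _
  have hk : ∀ k : Fin n →₀ ℕ, k = (k.mapDomain w.symm).mapDomain w := fun k => by
    rw [← Finsupp.mapDomain_comp, Equiv.self_comp_symm, Finsupp.mapDomain_id]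
  refine ⟨⟨S.image (fun k => k.mapDomain w), fun e he k hkS => ?_⟩, fun k => ?_⟩
  · rw [hk k, key, hS e he _ fun h => hkS (Finset.mem_image.mpr ⟨_, h, (hk k).symm⟩), map_zero]
  · rw [hk k]
    exact ((hg.2 _).perm hΩ w).congr hΩ fun e _ => key _ e

theorem AhFamily.ofHol (hΩ : IsOpen Ω) {f : E → Hol n τ} (hf : HolFamily Ω f) :
    AhFamily Ω fun e => Ah.ofHol (f e) :=
  (show AhFamily Ω fun e => (MvPolynomial.C (PowerSeries.C (f e)) * 1 :
      MvPolynomial (Fin n) (HolH n τ)) from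
    PolyFamily.C_mul hΩ (HolHFamily.C hΩ hf) (AhFamily.const hΩ (1 : Ah n τ))).congr hΩ fun e _ =>
    (mul_one (MvPolynomial.C (PowerSeries.C (f e)) : MvPolynomial (Fin n) (HolH n τ))).symm

open SkewMonoidAlgebra

/-- An analytic family of elements of `A_ħ * S_n`. -/
def AhSFamily (Ω : Set E) (f : E → AhS n τ) : Prop := ∀ w, AhFamily Ω fun e => (f e).coeff w

theorem AhSFamily.congr (hΩ : IsOpen Ω) {f g : E → AhS n τ} (hf : AhSFamily Ω f)
    (h : ∀ e ∈ Ω, g e = f e) : AhSFamily Ω g :=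
  fun w => (hf w).congr hΩ fun e he => by rw [h e he]

theorem AhSFamily.add (hΩ : IsOpen Ω) {f g : E → AhS n τ} (hf : AhSFamily Ω f)
    (hg : AhSFamily Ω g) : AhSFamily Ω fun e => f e + g e := fun w => by
  simp only [coeff_add, Finsupp.add_apply]
  exact (hf w).add hΩ (hg w)

theorem AhSFamily.smul (hΩ : IsOpen Ω) {c : E → ℂ} (hc : AnalyticOnNhd ℂ c Ω) {f : E → AhS n τ}
    (hf : AhSFamily Ω f) : AhSFamily Ω fun e => c e • f e := fun w => by
  simp only [coeff_smul, Finsupp.smul_apply]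
  exact (hf w).smul hΩ hc

theorem AhSFamily.const (hΩ : IsOpen Ω) (f : AhS n τ) : AhSFamily Ω fun _ : E => f :=
  fun _ => AhFamily.const hΩ _

theorem AhSFamily.sum (hΩ : IsOpen Ω) {ι : Type*} (s : Finset ι) {f : ι → E → AhS n τ}
    (hf : ∀ i ∈ s, AhSFamily Ω (f i)) : AhSFamily Ω fun e => ∑ i ∈ s, f i e := by
  classical
  induction s using Finset.induction_on with
  | empty => simpa using AhSFamily.const hΩ 0
  | insert i s hi ih =>
    simp only [Finset.sum_insert hi]
    exact (hf i (Finset.mem_insert_self i s)).add hΩ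
      (ih fun j hj => hf j (Finset.mem_insert_of_mem hj))

theorem AhSFamily.sub (hΩ : IsOpen Ω) {f g : E → AhS n τ} (hf : AhSFamily Ω f)
    (hg : AhSFamily Ω g) : AhSFamily Ω fun e => f e - g e :=
  (hf.add hΩ (hg.smul hΩ (c := fun _ => -1) analyticOnNhd_const)).congr hΩ fun e _ => by
    rw [neg_one_smul, sub_eq_add_neg]

theorem AhSFamily.mul (hΩ : IsOpen Ω) {f g : E → AhS n τ} (hf : AhSFamily Ω f)
    (hg : AhSFamily Ω g) : AhSFamily Ω fun e => f e * g e := fun w => by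
  refine (AhFamily.sum hΩ Finset.univ fun v _ =>
    (hf v).mul hΩ ((hg (v⁻¹ * w)).perm hΩ v)).congr hΩ fun e _ => ?_
  rw [coeff_mul_left, sum_def]
  exact Finsupp.sum_fintype _ _ fun v => zero_mul _

theorem AhSFamily.pow (hΩ : IsOpen Ω) {f : E → AhS n τ} (hf : AhSFamily Ω f) (m : ℕ) :
    AhSFamily Ω fun e => f e ^ m := by
  induction m with
  | zero => simpa using AhSFamily.const hΩ 1
  | succ m ih =>
    simp only [pow_succ]
    exact ih.mul hΩ hf

theorem AhSFamily.list_prod (hΩ : IsOpen Ω) {m : ℕ} {f : Fin m → E → AhS n τ}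
    (hf : ∀ i, AhSFamily Ω (f i)) : AhSFamily Ω fun e => (List.ofFn fun i => f i e).prod := by
  induction m with
  | zero => simpa using AhSFamily.const hΩ 1
  | succ m ih =>
    simp only [List.ofFn_succ, List.prod_cons]
    exact (hf 0).mul hΩ (ih fun i => hf i.succ)

theorem AhSFamily.single (hΩ : IsOpen Ω) (w : Equiv.Perm (Fin n)) {f : E → Ah n τ}
    (hf : AhFamily Ω f) : AhSFamily Ω fun e => single w (f e) := fun v => by
  classical
  by_cases h : w = v
  · exact hf.congr hΩ fun e _ => by rw [coeff_single_apply, if_pos h]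
  · exact (AhFamily.const hΩ 0).congr hΩ fun e _ => by rw [coeff_single_apply, if_neg h]

theorem AhSFamily.comp {E' : Type*} [NormedAddCommGroup E'] [NormedSpace ℂ E'] {Ω' : Set E'}
    {f : E → AhS n τ} (hf : AhSFamily Ω f) {g : E' → E} (hg : AnalyticOnNhd ℂ g Ω')
    (h : Set.MapsTo g Ω' Ω) : AhSFamily Ω' fun e => f (g e) := fun w => by
  obtain ⟨S, hS⟩ := (hf w).1
  exact ⟨⟨S, fun e he => hS (g e) (h he)⟩, fun k m => ((hf w).2 k m).comp hg h⟩

theorem AhSFamily.mono {Ω' : Set E} {f : E → AhS n τ} (hf : AhSFamily Ω f) (h : Ω' ⊆ Ω) :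
    AhSFamily Ω' f :=
  hf.comp analyticOnNhd_id h

/-- The value at `x` of the coefficient of `ħ^m p̂^k w`. -/
noncomputable def coeffAt (a : AhS n τ) (w : Equiv.Perm (Fin n)) (k : Fin n →₀ ℕ) (m : ℕ)
    (x : regSet n τ) : ℂ :=
  ((a.coeff w).coeff k m).1 x

theorem AhS_ext {a b : AhS n τ} (h : ∀ w k m x, coeffAt a w k m x = coeffAt b w k m x) : a = b := by
  refine SkewMonoidAlgebra.ext fun w => ?_
  refine MvPolynomial.ext (R := HolH n τ) _ _ fun k => ?_
  exact PowerSeries.ext fun m => Hol.hext fun x => h w k m x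

theorem AhSFamily.analyticOnNhd_coeffAt {f : E → AhS n τ} (hf : AhSFamily Ω f)
    (w : Equiv.Perm (Fin n)) (k : Fin n →₀ ℕ) (m : ℕ) (x : regSet n τ) :
    AnalyticOnNhd ℂ (fun e => coeffAt (f e) w k m x) Ω := by
  intro e he
  refine (AnalyticAt.comp (f := fun e : E => (e, x.1)) ((hf w).2 k m (e, x.1) ⟨he, x.2⟩)
    (analyticAt_id.prod analyticAt_const)).congr (Eventually.of_forall fun e => ?_)
  exact extZero_apply _ x

/-- Analytic families that agree on a dense subset agree. -/
theorem AhSFamily.eq_of_dense {f g : E → AhS n τ} (hf : AhSFamily Ω f)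
    (hg : AhSFamily Ω g) {D : Set E} (hD : Ω ⊆ closure (D ∩ Ω)) (h : ∀ e ∈ D ∩ Ω, f e = g e) :
    ∀ e ∈ Ω, f e = g e := by
  intro e he
  refine AhS_ext fun w k m x => ?_
  have hf' := (hf.analyticOnNhd_coeffAt w k m x e he).continuousAt
  have hg' := (hg.analyticOnNhd_coeffAt w k m x e he).continuousAt
  have : (𝓝[D ∩ Ω] e).NeBot := mem_closure_iff_nhdsWithin_neBot.mp (hD he)
  refine tendsto_nhds_unique (hf'.mono_left (nhdsWithin_le_nhds (s := D ∩ Ω)))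
    ((hg'.mono_left nhdsWithin_le_nhds).congr' ?_)
  filter_upwards [self_mem_nhdsWithin] with y hy
  rw [h y hy]

end Families

/-! ### Quotients and mean values of analytic families -/

section Construction

variable {n : ℕ} {τ : UpperHalfPlane} {E : Type*} [NormedAddCommGroup E] [NormedSpace ℂ E]
  {Ω : Set E}

open Classical in
/-- The element of `Hol n τ` given by a function on `ℂⁿ`, and `0` if the function is not analytic. -/
noncomputable def holOf (g : (Fin n → ℂ) → ℂ) : Hol n τ :=
  if h : AnalyticOnNhd ℂ g (regSet n τ) then Hol.mk g h else 0

theorem holOf_apply {g : (Fin n → ℂ) → ℂ} (h : AnalyticOnNhd ℂ g (regSet n τ)) (x : regSet n τ) :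
    (holOf g : Hol n τ).1 x = g x := by
  rw [holOf, dif_pos h]; rfl

/-- The element of `A_ħ` with prescribed coefficients of `ħ^m p̂^k` for `k ∈ T`. -/
noncomputable def ofCoeffsAh (T : Finset (Fin n →₀ ℕ)) (c : (Fin n →₀ ℕ) → ℕ → (Fin n → ℂ) → ℂ) :
    Ah n τ :=
  (∑ k ∈ T, MvPolynomial.monomial k (PowerSeries.mk fun m => holOf (c k m)) :
    MvPolynomial (Fin n) (HolH n τ))

open Classical in
theorem coeff_ofCoeffsAh (T : Finset (Fin n →₀ ℕ)) (c : (Fin n →₀ ℕ) → ℕ → (Fin n → ℂ) → ℂ)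
    (k : Fin n →₀ ℕ) : MvPolynomial.coeff (R := HolH n τ) k (ofCoeffsAh T c)
      = if k ∈ T then PowerSeries.mk fun m => holOf (c k m) else 0 := by
  refine (MvPolynomial.coeff_sum (R := HolH n τ) _ _ _).trans ?_
  simp only [MvPolynomial.coeff_monomial, Finset.sum_ite_eq']

/-- The element of `A_ħ * S_n` with prescribed coefficients of `ħ^m p̂^k w` for `k ∈ T w`. -/
noncomputable def ofCoeffs (T : Equiv.Perm (Fin n) → Finset (Fin n →₀ ℕ))
    (c : Equiv.Perm (Fin n) → (Fin n →₀ ℕ) → ℕ → (Fin n → ℂ) → ℂ) : AhS n τ :=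
  ⟨Finsupp.equivFunOnFinite.symm fun w => ofCoeffsAh (T w) (c w)⟩

open Classical in
theorem coeff_ofCoeffs (T : Equiv.Perm (Fin n) → Finset (Fin n →₀ ℕ))
    (c : Equiv.Perm (Fin n) → (Fin n →₀ ℕ) → ℕ → (Fin n → ℂ) → ℂ) (w : Equiv.Perm (Fin n))
    (k : Fin n →₀ ℕ) :
    MvPolynomial.coeff (R := HolH n τ) k ((ofCoeffs T c : AhS n τ).coeff w)
      = if k ∈ T w then PowerSeries.mk fun m => holOf (c w k m) else 0 :=
  coeff_ofCoeffsAh (T w) (c w) k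

/-- A family with prescribed analytic coefficients. -/
theorem AhSFamily.exists_of_coeffs (hΩ : IsOpen Ω)
    (T : Equiv.Perm (Fin n) → Finset (Fin n →₀ ℕ))
    (c : Equiv.Perm (Fin n) → (Fin n →₀ ℕ) → ℕ → E × (Fin n → ℂ) → ℂ)
    (hc : ∀ w k m, AnalyticOnNhd ℂ (c w k m) (Ω ×ˢ regSet n τ))
    (h0 : ∀ w, ∀ k ∉ T w, ∀ m, ∀ e ∈ Ω, ∀ x ∈ regSet n τ, c w k m (e, x) = 0) :
    ∃ f : E → AhS n τ, AhSFamily Ω f ∧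
      ∀ e ∈ Ω, ∀ w k m (x : regSet n τ), coeffAt (f e) w k m x = c w k m (e, x.1) := by
  classical
  have key : ∀ e ∈ Ω, ∀ w k m (x : regSet n τ),
      coeffAt (ofCoeffs T (fun w k m x => c w k m (e, x)) : AhS n τ) w k m x
        = c w k m (e, x.1) := by
    intro e he w k m x
    rw [coeffAt, Ah.coeff, coeff_ofCoeffs]
    split_ifs with hk
    · rw [PowerSeries.coeff_mk, holOf_apply]
      intro y hy
      exact AnalyticAt.comp (f := fun y : Fin n → ℂ => (e, y)) (hc w k m (e, y) ⟨he, hy⟩)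
        (analyticAt_const.prod analyticAt_id)
    · rw [h0 w k hk m e he x.1 x.2, map_zero]; rfl
  refine ⟨fun e => ofCoeffs T (fun w k m x => c w k m (e, x)), fun w => ⟨⟨T w, fun e _ k hk => ?_⟩,
    fun k m => HolFamily.of_eq hΩ (c w k m) (fun e he x => key e he w k m x) (hc w k m)⟩, key⟩
  rw [coeff_ofCoeffs, if_neg hk]

/-- The monomials that occur in an analytic family belong to a finite set. -/
theorem AhSFamily.exists_support {f : E → AhS n τ} (hf : AhSFamily Ω f) :
    ∃ T : Equiv.Perm (Fin n) → Finset (Fin n →₀ ℕ), ∀ w, ∀ k ∉ T w, ∀ m, ∀ e ∈ Ω, ∀ x : regSet n τ,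
      coeffAt (f e) w k m x = 0 := by
  choose T hT using fun w => (hf w).1
  refine ⟨T, fun w k hk m e he x => ?_⟩
  rw [coeffAt, Ah.coeff, hT w e he k hk, map_zero]; rfl

/-- Division: an analytic family that vanishes on the hyperplane `ℓ = 0` is divisible by `ℓ`. -/
theorem AhSFamily.exists_eq_smul_of_hyperplane (hΩ : IsOpen Ω) {f : E → AhS n τ}
    (hf : AhSFamily Ω f) {ℓ : E →L[ℂ] ℂ} {v : E} (hv : ℓ v = 1) (h0 : ∀ e ∈ Ω, ℓ e = 0 → f e = 0) :
    ∃ g : E → AhS n τ, AhSFamily Ω g ∧ ∀ e ∈ Ω, ℓ e ≠ 0 → f e = ℓ e • g e := by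
  obtain ⟨T, hT⟩ := hf.exists_support
  let c : Equiv.Perm (Fin n) → (Fin n →₀ ℕ) → ℕ → E × (Fin n → ℂ) → ℂ := fun w k m z =>
    extZero (((f z.1).coeff w).coeff k m).1 z.2
  have hc : ∀ w k m, AnalyticOnNhd ℂ (c w k m) (Ω ×ˢ regSet n τ) := fun w k m => (hf w).2 k m
  have hcx : ∀ w k m e (x : regSet n τ), c w k m (e, x.1) = coeffAt (f e) w k m x := fun w k m e x =>
    extZero_apply _ x
  let L : E × (Fin n → ℂ) →L[ℂ] ℂ := ℓ.comp (ContinuousLinearMap.fst ℂ E (Fin n → ℂ))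
  have hq : ∀ w k m, AnalyticOnNhd ℂ (hyperplaneQuotient L (v, 0) (c w k m)) (Ω ×ˢ regSet n τ) :=
    fun w k m => analyticOnNhd_hyperplaneQuotient (by simpa [L] using hv)
      (hΩ.prod (isOpen_regSet n τ)) (hc w k m) fun z hz hz0 => by
        refine (hcx w k m z.1 ⟨z.2, hz.2⟩).trans ?_
        rw [h0 z.1 hz.1 hz0]; rfl
  obtain ⟨g, hg, hgc⟩ := AhSFamily.exists_of_coeffs hΩ T
    (fun w k m => hyperplaneQuotient L (v, 0) (c w k m)) hq (by
      intro w k hk m e he x hx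
      -- coefficients outside `T` vanish identically, hence so do their quotients, which on the
      -- hyperplane are defined by derivatives
      have hz : ∀ᶠ z in 𝓝 (e, x), c w k m z = 0 := by
        filter_upwards [(hΩ.prod (isOpen_regSet n τ)).mem_nhds (⟨he, hx⟩ : (e, x) ∈ Ω ×ˢ regSet n τ)]
          with z hz
        exact (hcx w k m z.1 ⟨z.2, hz.2⟩).trans (hT w k hk m z.1 hz.1 _)
      rw [hyperplaneQuotient]
      split_ifs
      · have : fderiv ℂ (c w k m) (e, x) = 0 := by
          rw [Filter.EventuallyEq.fderiv_eq (f := fun _ => (0 : ℂ)) hz]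
          simp
        rw [this]; rfl
      · rw [hz.self_of_nhds, zero_div])
  refine ⟨g, hg, fun e he hne => AhS_ext fun w k m x => ?_⟩
  change _ = ℓ e * coeffAt (g e) w k m x
  rw [hgc e he, hyperplaneQuotient_of_ne (by simpa [L] using hne), hcx]
  change _ = ℓ e * (_ / ℓ e)
  rw [mul_div_cancel₀ _ hne]

/-- `a` is the mean value of `F` over the unit circle, coefficientwise. -/
def IsCircleMean (F : ℂ → AhS n τ) (a : AhS n τ) : Prop :=
  ∀ w k m x, coeffAt a w k m x = Real.circleAverage (fun s => coeffAt (F s) w k m x) 0 1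

/-- The mean over the unit circle of an analytic family is an analytic family in the other
parameters. -/
theorem AhSFamily.exists_circleMean (hΩ : IsOpen Ω) {S : Set (ℂ × E)}
    (hS : Metric.sphere (0 : ℂ) 1 ×ˢ Ω ⊆ S) {f : ℂ × E → AhS n τ} (hf : AhSFamily S f) :
    ∃ g : E → AhS n τ, AhSFamily Ω g ∧ ∀ e ∈ Ω, IsCircleMean (fun s => f (s, e)) (g e) := by
  obtain ⟨T, hT⟩ := hf.exists_support
  let c : Equiv.Perm (Fin n) → (Fin n →₀ ℕ) → ℕ → ℂ × (E × (Fin n → ℂ)) → ℂ := fun w k m z =>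
    extZero (((f (z.1, z.2.1)).coeff w).coeff k m).1 z.2.2
  have hcx : ∀ w k m s e (x : regSet n τ), c w k m (s, e, x.1) = coeffAt (f (s, e)) w k m x :=
    fun w k m s e x => extZero_apply _ x
  obtain ⟨g, hg, hgc⟩ := AhSFamily.exists_of_coeffs (τ := τ) hΩ T
    (fun w k m z => Real.circleAverage (fun s => c w k m (s, z)) 0 1)
    (fun w k m z hz => analyticAt_circleAverage fun s hs => by
      refine AnalyticAt.comp (g := fun z : (ℂ × E) × (Fin n → ℂ) =>
        extZero (((f z.1).coeff w).coeff k m).1 z.2)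
        (f := fun z : ℂ × (E × (Fin n → ℂ)) => ((z.1, z.2.1), z.2.2))
        ((hf w).2 k m ((s, z.1), z.2) ⟨hS ⟨hs, hz.1⟩, hz.2⟩) ?_
      exact (analyticAt_fst.prod (analyticAt_fst.comp analyticAt_snd)).prod
        (analyticAt_snd.comp analyticAt_snd))
    (by
      intro w k hk m e he x hx
      have : Set.EqOn (fun s => c w k m (s, e, x)) (fun _ => 0) (Metric.sphere 0 |1|) := by
        intro s hs
        rw [abs_one] at hs
        exact (hcx w k m s e ⟨x, hx⟩).trans (hT w k hk m (s, e) (hS ⟨hs, he⟩) _)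
      rw [Real.circleAverage_congr_sphere this, Real.circleAverage_const])
  refine ⟨g, hg, fun e he w k m x => ?_⟩
  rw [hgc e he]
  simp only [hcx]

end Construction

/-! ### Operators preserving analyticity in the spectral parameter -/

section Preservation

open SkewMonoidAlgebra

variable {n : ℕ} {τ : UpperHalfPlane} {E : Type*} [NormedAddCommGroup E] [NormedSpace ℂ E]

/-- A family `h` of elements of `A_0 * S_n`, with parameter in `S`, preserves analyticity on `N`: it
sends functions of the spectral parameter that are analytic on `N`, including the non-regular
points, to functions with the same property. -/
def PreservesAnalytic (κ : ℂ) (S : Set E) (N : Set (Fin n → ℂ)) (h : E → A0S n τ) : Prop :=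
  ∀ G : E × (Fin n → ℂ) → AhS n τ, AhSFamily (S ×ˢ N) G →
    ∃ G' : E × (Fin n → ℂ) → AhS n τ, AhSFamily (S ×ˢ N) G' ∧
      ∀ e ∈ S, ∀ l : regSet n τ, l.1 ∈ N → actFun κ (h e) (fun l => G (e, l.1)) l = G' (e, l.1)

variable {κ : ℂ} {S : Set E} {N : Set (Fin n → ℂ)}

theorem PreservesAnalytic.congr {h h' : E → A0S n τ} (hh : PreservesAnalytic κ S N h)
    (he : ∀ e ∈ S, h' e = h e) : PreservesAnalytic κ S N h' := fun G hG => by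
  obtain ⟨G', hG', H⟩ := hh G hG
  exact ⟨G', hG', fun e heS l hl => by rw [he e heS, H e heS l hl]⟩

theorem PreservesAnalytic.one : PreservesAnalytic κ S N fun _ => (1 : A0S n τ) := fun G hG =>
  ⟨G, hG, fun e _ l _ => by rw [actFun_one]⟩

theorem PreservesAnalytic.smul (hS : IsOpen S) (hN : IsOpen N) {c : E → ℂ}
    (hc : AnalyticOnNhd ℂ c S) {h : E → A0S n τ}
    (hh : PreservesAnalytic κ S N h) : PreservesAnalytic κ S N fun e => c e • h e := fun G hG => by
  obtain ⟨G', hG', H⟩ := hh G hG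
  refine ⟨fun z => c z.1 • G' z, hG'.smul (hS.prod hN) fun z hz =>
    AnalyticAt.comp (g := c) (f := Prod.fst) (hc z.1 hz.1) analyticAt_fst, fun e he l hl => ?_⟩
  rw [actFun_smul, Pi.smul_apply, H e he l hl]

theorem PreservesAnalytic.add (hS : IsOpen S) (hN : IsOpen N) {h h' : E → A0S n τ}
    (hh : PreservesAnalytic κ S N h) (hh' : PreservesAnalytic κ S N h') :
    PreservesAnalytic κ S N fun e => h e + h' e := fun G hG => by
  obtain ⟨G₁, hG₁, H₁⟩ := hh G hG
  obtain ⟨G₂, hG₂, H₂⟩ := hh' G hG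
  refine ⟨_, hG₁.add (hS.prod hN) hG₂, fun e he l hl => ?_⟩
  rw [actFun_add, Pi.add_apply, H₁ e he l hl, H₂ e he l hl]

theorem PreservesAnalytic.sum (hS : IsOpen S) (hN : IsOpen N) {ι : Type*} (s : Finset ι)
    {h : ι → E → A0S n τ} (hh : ∀ i ∈ s, PreservesAnalytic κ S N (h i)) :
    PreservesAnalytic κ S N fun e => ∑ i ∈ s, h i e := by
  classical
  induction s using Finset.induction_on with
  | empty =>
    exact (PreservesAnalytic.one.smul hS hN (c := fun _ => 0) analyticOnNhd_const).congr fun e _ => by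
      rw [Finset.sum_empty, zero_smul]
  | insert i s hi ih =>
    simp only [Finset.sum_insert hi]
    exact (hh i (Finset.mem_insert_self i s)).add hS hN
      (ih fun j hj => hh j (Finset.mem_insert_of_mem hj))

theorem PreservesAnalytic.mul (hW : ∀ (w : Equiv.Perm (Fin n)), ∀ l ∈ N, l ∘ w ∈ N)
    {h h' : E → A0S n τ} (hh : PreservesAnalytic κ S N h) (hh' : PreservesAnalytic κ S N h') :
    PreservesAnalytic κ S N fun e => h e * h' e := fun G hG => by
  obtain ⟨G₁, hG₁, H₁⟩ := hh' G hG
  obtain ⟨G₂, hG₂, H₂⟩ := hh G₁ hG₁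
  refine ⟨G₂, hG₂, fun e he l hl => ?_⟩
  rw [actFun_mul, ← H₂ e he l hl]
  refine Finset.sum_congr rfl fun w _ => ?_
  rw [H₁ e he (permReg w l) (hW w _ hl)]

theorem PreservesAnalytic.pow (hW : ∀ (w : Equiv.Perm (Fin n)), ∀ l ∈ N, l ∘ w ∈ N)
    {h : E → A0S n τ} (hh : PreservesAnalytic κ S N h) (m : ℕ) :
    PreservesAnalytic κ S N fun e => h e ^ m := by
  induction m with
  | zero => simpa using PreservesAnalytic.one
  | succ m ih =>
    simp only [pow_succ]
    exact ih.mul hW hh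

theorem PreservesAnalytic.list_prod (hW : ∀ (w : Equiv.Perm (Fin n)), ∀ l ∈ N, l ∘ w ∈ N)
    {m : ℕ} {h : Fin m → E → A0S n τ} (hh : ∀ i, PreservesAnalytic κ S N (h i)) :
    PreservesAnalytic κ S N fun e => (List.ofFn fun i => h i e).prod := by
  induction m with
  | zero => simpa using PreservesAnalytic.one
  | succ m ih =>
    simp only [List.ofFn_succ, List.prod_cons]
    exact (hh 0).mul hW (ih fun i => hh i.succ)

/-- A polynomial in operators that preserve analyticity preserves it. The coefficients may depend
analytically on the parameter. -/
theorem PreservesAnalytic.subst (hS : IsOpen S) (hN : IsOpen N)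
    (hW : ∀ (w : Equiv.Perm (Fin n)), ∀ l ∈ N, l ∘ w ∈ N) {y : Fin n → E → A0S n τ}
    (hy : ∀ i, PreservesAnalytic κ S N (y i)) {f : E → MvPolynomial (Fin n) ℂ}
    (T : Finset (Fin n →₀ ℕ)) (hT : ∀ e ∈ S, (f e).support ⊆ T)
    (hf : ∀ k, AnalyticOnNhd ℂ (fun e => (f e).coeff k) S) :
    PreservesAnalytic κ S N fun e => EllipticCM.subst (fun i => y i e) (f e) := by
  refine (PreservesAnalytic.sum hS hN T fun k _ => (PreservesAnalytic.list_prod hW fun i =>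
    (hy i).pow hW (k i)).smul hS hN (hf k)).congr fun e he => ?_
  refine Finset.sum_subset (hT e he) fun k _ hk => ?_
  rw [MvPolynomial.notMem_support_iff.mp hk, zero_smul]

/-- The set of `λ` such that no difference `λ_i - λ_j` is a nonzero period. There the poles of
`φ(λ_i - λ_j, z)` in `λ` are those at `λ_i = λ_j`. It contains a neighbourhood of `0`. -/
def nearDiagonal (n : ℕ) (τ : UpperHalfPlane) : Set (Fin n → ℂ) :=
  {l | ∀ i j, l i - l j ∈ (periods τ).lattice → l i - l j = 0}

/-- The function `x ↦ μ φ(μ, x_i - x_j)` with `μ = λ_i - λ_j`, extended to `μ = 0`. -/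
noncomputable def psiHol (i j : Fin n) (l : Fin n → ℂ) : Hol n τ :=
  holOf fun x => -sigma (periods τ) (x i - x j - (l i - l j))
    / (sigma (periods τ) (x i - x j) * sigmaTail (periods τ) (-(l i - l j)))

theorem sigmaTail_ne_zero_of_mem {l : Fin n → ℂ} (hl : l ∈ nearDiagonal n τ) (i j : Fin n) :
    sigmaTail (periods τ) (-(l i - l j)) ≠ 0 := by
  refine sigmaTail_ne_zero _ fun h => ?_
  rw [neg_eq_zero]
  exact hl i j (by simpa using (periods τ).lattice.neg_mem h)

theorem analyticOnNhd_psi {i j : Fin n} (hij : i ≠ j) :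
    AnalyticOnNhd ℂ (fun z : (Fin n → ℂ) × (Fin n → ℂ) =>
      -sigma (periods τ) (z.2 i - z.2 j - (z.1 i - z.1 j))
      / (sigma (periods τ) (z.2 i - z.2 j) * sigmaTail (periods τ) (-(z.1 i - z.1 j))))
      (nearDiagonal n τ ×ˢ regSet n τ) := by
  intro z hz
  have h1 : AnalyticAt ℂ (fun z : (Fin n → ℂ) × (Fin n → ℂ) => z.1 i - z.1 j) z :=
    AnalyticAt.comp (g := fun x : Fin n → ℂ => x i - x j) (f := Prod.fst)
      (analytic_coord_sub i j Set.univ z.1 trivial) analyticAt_fst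
  have h2 : AnalyticAt ℂ (fun z : (Fin n → ℂ) × (Fin n → ℂ) => z.2 i - z.2 j) z :=
    AnalyticAt.comp (g := fun x : Fin n → ℂ => x i - x j) (f := Prod.snd)
      (analytic_coord_sub i j Set.univ z.2 trivial) analyticAt_snd
  have h3 := AnalyticAt.comp (g := sigma (periods τ)) (analyticAt_sigma (periods τ) _) (h2.sub h1)
  have h4 := AnalyticAt.comp (g := sigma (periods τ)) (analyticAt_sigma (periods τ) _) h2
  have h5 := AnalyticAt.comp (g := sigmaTail (periods τ)) (analyticAt_sigmaTail (periods τ) _) h1.neg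
  exact h3.neg.div (h4.mul h5)
    (mul_ne_zero (sigma_ne_zero _ (hz.2 i j hij)) (sigmaTail_ne_zero_of_mem hz.1 i j))

theorem psiHol_apply {i j : Fin n} (hij : i ≠ j) {l : Fin n → ℂ} (hl : l ∈ nearDiagonal n τ)
    (x : regSet n τ) : (psiHol i j l : Hol n τ).1 x
      = -sigma (periods τ) (x.1 i - x.1 j - (l i - l j))
        / (sigma (periods τ) (x.1 i - x.1 j) * sigmaTail (periods τ) (-(l i - l j))) :=
  holOf_apply (fun x hx => AnalyticAt.comp (f := fun x : Fin n → ℂ => (l, x))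
    (analyticOnNhd_psi hij (l, x) ⟨hl, hx⟩) (analyticAt_const.prod analyticAt_id)) x

theorem psiHol_family (hN : IsOpen N) (hN0 : N ⊆ nearDiagonal n τ) {i j : Fin n} (hij : i ≠ j) :
    HolFamily N (psiHol i j : (Fin n → ℂ) → Hol n τ) :=
  HolFamily.of_eq hN _ (fun _ hl x => psiHol_apply hij (hN0 hl) x)
    ((analyticOnNhd_psi hij).mono (Set.prod_mono hN0 subset_rfl))

theorem regSet_subset_nearDiagonal : regSet n τ ⊆ nearDiagonal n τ := fun l hl i j h => by
  by_cases hij : i = j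
  · rw [hij, sub_self]
  · exact absurd h (hl i j hij)

theorem psiHol_of_mem_regSet (l : regSet n τ) {i j : Fin n} (hij : i ≠ j) :
    psiHol i j l.1 = (l.1 i - l.1 j) • phiHol l i j i j := by
  refine Hol.hext fun x => ?_
  change _ = (l.1 i - l.1 j) * (phiHol l i j i j).1 x
  have h0 := sub_ne_zero_of_mem l.2 hij
  have ht := sigmaTail_ne_zero_of_mem (regSet_subset_nearDiagonal l.2) i j
  have hs := sigma_ne_zero (periods τ) (x.2 i j hij)
  rw [psiHol_apply hij (regSet_subset_nearDiagonal l.2), phiHol_apply l hij hij, phi,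
    sigma_eq_mul_sigmaTail _ (-(l.1 i - l.1 j))]
  field_simp

/-- The residue of `φ(μ, z)` at `μ = 0` is `-1`, independently of `z`. -/
theorem psiHol_of_eq {i j : Fin n} (hij : i ≠ j) {l : Fin n → ℂ} (hl : l ∈ nearDiagonal n τ)
    (h : l i = l j) : psiHol i j l = (-1 : Hol n τ) := by
  refine Hol.hext fun x => ?_
  have hs := sigma_ne_zero (periods τ) (x.2 i j hij)
  rw [psiHol_apply hij hl, h, sub_self, sub_zero, neg_zero, sigmaTail_zero, mul_one, neg_div,
    div_self hs]
  rfl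

theorem Ah.ofHol_smul (c : ℂ) (f : Hol n τ) : Ah.ofHol (c • f) = c • Ah.ofHol f := by
  have key : (MvPolynomial.C (PowerSeries.C (c • f)) : MvPolynomial (Fin n) (HolH n τ))
      = c • MvPolynomial.C (PowerSeries.C f) := by
    rw [Algebra.smul_def, Algebra.smul_def, map_mul, map_mul, MvPolynomial.algebraMap_apply,
      PowerSeries.algebraMap_apply]
  exact key

theorem single_ofHol_smul (s : Equiv.Perm (Fin n)) (c : ℂ) (f : Hol n τ) :
    single s (Ah.ofHol (c • f)) = c • single s (Ah.ofHol f) := by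
  rw [smul_single, Ah.ofHol_smul]

theorem actFun_p (i : Fin n) (G : regSet n τ → AhS n τ) (l : regSet n τ) :
    actFun κ (single 1 (A0.p i)) G l = ellDunkl κ l i * G l := by
  rw [actFun_single, hat_p, ← one_def, one_mul]
  rfl

theorem actFun_ofHol (s : Equiv.Perm (Fin n)) (f : Hol n τ) (G : regSet n τ → AhS n τ)
    (l : regSet n τ) :
    actFun κ (single s (A0.ofHol f)) G l = f.1 l • (single s 1 * G (permReg s l)) := by
  rw [actFun_single, hat_ofHol, smul_mul_assoc, one_mul]

/-- Dunkl operators in the variable `λ` preserve analyticity: the pole of `φ(λ_i - λ_j, x_i - x_j)`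
at `λ_i = λ_j` in the action of `p_i` is cancelled by that of the kernel. The kernel `k` may depend
on a parameter; `a j` is the product of `λ_i - λ_j` and `k j`, extended to `λ_i = λ_j`, where its
value has to be `1`. -/
theorem preservesAnalytic_dunkl (hS : IsOpen S) (hN : IsOpen N) (hN0 : N ⊆ nearDiagonal n τ)
    (hW : ∀ (w : Equiv.Perm (Fin n)), ∀ l ∈ N, l ∘ w ∈ N) (i : Fin n)
    (k : {j : Fin n // j ≠ i} → E → Hol n τ) (a : {j : Fin n // j ≠ i} → E × (Fin n → ℂ) → ℂ)
    (ha : ∀ j, AnalyticOnNhd ℂ (a j) (S ×ˢ N))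
    (hka : ∀ j, ∀ e ∈ S, ∀ l : regSet n τ, l.1 ∈ N → (l.1 i - l.1 j.1) * (k j e).1 l = a j (e, l.1))
    (ha1 : ∀ j, ∀ e ∈ S, ∀ l ∈ N, l i = l j.1 → a j (e, l) = 1) :
    PreservesAnalytic κ S N fun e => single 1 (A0.p i)
      - κ • ∑ j : {j : Fin n // j ≠ i}, single (Equiv.swap i j.1) (A0.ofHol (k j e)) := by
  intro G hG
  have hO := hS.prod hN
  -- `M j` is `λ_i - λ_j` times the sum of the two terms with a pole at `λ_i = λ_j`
  let M : {j : Fin n // j ≠ i} → E × (Fin n → ℂ) → AhS n τ := fun j z =>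
    single (Equiv.swap i j.1) (Ah.ofHol (psiHol i j.1 z.2)) * G z
      + a j z • (single (Equiv.swap i j.1) 1 * G (z.1, z.2 ∘ Equiv.swap i j.1))
  have hM : ∀ j, AhSFamily (S ×ˢ N) (M j) := by
    intro j
    have hswap : AhSFamily (S ×ˢ N) fun z => G (z.1, z.2 ∘ Equiv.swap i j.1) :=
      AhSFamily.comp hG (g := fun z : E × (Fin n → ℂ) => (z.1, permL (Equiv.swap i j.1) z.2))
        (fun z _ => analyticAt_fst.prod (((permL _).analyticAt _).comp analyticAt_snd))
        fun z hz => ⟨hz.1, hW _ _ hz.2⟩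
    have hpsi : HolFamily (S ×ˢ N) fun z => (psiHol i j.1 z.2 : Hol n τ) :=
      (psiHol_family hN hN0 j.2.symm).comp (g := Prod.snd) (fun z _ => analyticAt_snd)
        fun z hz => hz.2
    exact AhSFamily.add hO (AhSFamily.mul hO (AhSFamily.single hO _ (AhFamily.ofHol hO hpsi)) hG)
      (AhSFamily.smul hO (ha j) (AhSFamily.mul hO (AhSFamily.const hO _) hswap))
  let ℓ : {j : Fin n // j ≠ i} → E × (Fin n → ℂ) →L[ℂ] ℂ := fun j =>
    (ContinuousLinearMap.proj (R := ℂ) (φ := fun _ : Fin n => ℂ) i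
      - ContinuousLinearMap.proj (R := ℂ) (φ := fun _ : Fin n => ℂ) j.1).comp
      (ContinuousLinearMap.snd ℂ E (Fin n → ℂ))
  have hℓ : ∀ j z, ℓ j z = z.2 i - z.2 j.1 := fun j z => rfl
  -- at `λ_i = λ_j` the two residues are opposite, because `s_{ij}` fixes `λ`
  have hM0 : ∀ j, ∀ z ∈ S ×ˢ N, ℓ j z = 0 → M j z = 0 := by
    intro j z hz h0
    have he : z.2 i = z.2 j.1 := sub_eq_zero.mp h0
    have hsw : z.2 ∘ Equiv.swap i j.1 = z.2 := by
      funext m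
      simp only [Function.comp_apply, Equiv.swap_apply_def]
      split_ifs with h1 h2
      · rw [h1, he]
      · rw [h2, he]
      · rfl
    have h1 : Ah.ofHol (-1 : Hol n τ) = -1 := by
      rw [Ah.ofHol_neg]; rfl
    simp only [M]
    rw [psiHol_of_eq j.2.symm (hN0 hz.2) he, ha1 j z.1 hz.1 z.2 hz.2 he, hsw, one_smul, h1, single_neg,
      neg_mul, neg_add_cancel]
  have hdiv : ∀ j, ∃ M' : E × (Fin n → ℂ) → AhS n τ, AhSFamily (S ×ˢ N) M' ∧
      ∀ z ∈ S ×ˢ N, ℓ j z ≠ 0 → M j z = ℓ j z • M' z := fun j =>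
    AhSFamily.exists_eq_smul_of_hyperplane hO (hM j) (ℓ := ℓ j) (v := (0, Pi.single i 1))
      (by rw [hℓ]; simp [j.2]) (hM0 j)
  choose M' hM' hMM' using hdiv
  refine ⟨fun z => single 1 (Ah.p i) * G z - κ • ∑ j, M' j z,
    AhSFamily.sub hO (AhSFamily.mul hO (AhSFamily.const hO _) hG)
      (AhSFamily.smul hO analyticOnNhd_const (AhSFamily.sum hO _ fun j _ => hM' j)),
    fun e he l hl => ?_⟩
  -- away from the hyperplane `M' j` is that sum of two terms
  have hterm : ∀ j : {j : Fin n // j ≠ i}, M' j (e, l.1)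
      = single (Equiv.swap i j.1) (Ah.ofHol (phiHol l i j.1 i j.1)) * G (e, l.1)
        + (k j e).1 l • (single (Equiv.swap i j.1) 1 * G (e, l.1 ∘ Equiv.swap i j.1)) := by
    intro j
    have hne : l.1 i - l.1 j.1 ≠ 0 := sub_ne_zero_of_mem l.2 j.2.symm
    have h := hMM' j (e, l.1) ⟨he, hl⟩ hne
    refine smul_right_injective _ hne ?_
    refine Eq.trans h.symm ?_
    simp only [M]
    rw [psiHol_of_mem_regSet l j.2.symm, smul_add, ← hka j e he l hl, mul_smul, single_ofHol_smul,
      smul_mul_assoc]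
  simp only
  rw [sub_eq_add_neg, actFun_add, ← neg_smul, actFun_smul, Pi.add_apply, Pi.smul_apply, actFun_p]
  have hsum : actFun κ (∑ j : {j : Fin n // j ≠ i}, single (Equiv.swap i j.1) (A0.ofHol (k j e)))
      (fun l => G (e, l.1)) l
      = ∑ j : {j : Fin n // j ≠ i}, (k j e).1 l •
        (single (Equiv.swap i j.1) 1 * G (e, l.1 ∘ Equiv.swap i j.1)) := by
    rw [actFun_sum, Finset.sum_apply]
    exact Finset.sum_congr rfl fun j _ => actFun_ofHol _ _ _ _
  rw [hsum, ellDunkl_eq, dunkl, sub_mul, smul_mul_assoc, Finset.sum_mul, Finset.sum_congr rfl fun j _ =>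
    hterm j, Finset.sum_add_distrib, smul_add, neg_smul]
  abel

theorem preservesAnalytic_ratDunkl (hS : IsOpen S) (hN : IsOpen N) (hN0 : N ⊆ nearDiagonal n τ)
    (hW : ∀ (w : Equiv.Perm (Fin n)), ∀ l ∈ N, l ∘ w ∈ N) (i : Fin n) :
    PreservesAnalytic κ S N fun _ => (ratDunkl κ i : A0S n τ) :=
  preservesAnalytic_dunkl hS hN hN0 hW i (fun j _ => Hol.mk _ (analytic_inv_sub j.2))
    (fun _ _ => 1) (fun _ => analyticOnNhd_const)
    (fun j _ _ l _ => mul_one_div_cancel (sub_ne_zero_of_mem l.2 j.2.symm)) (fun _ _ _ _ _ _ => rfl)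

theorem preservesAnalytic_ellDunklC (hS : IsOpen S) (hN : IsOpen N) (hN0 : N ⊆ nearDiagonal n τ)
    (hW : ∀ (w : Equiv.Perm (Fin n)), ∀ l ∈ N, l ∘ w ∈ N) {ν : E → regSet n τ}
    (hν : AnalyticOnNhd ℂ (fun e => (ν e).1) S) (i : Fin n) :
    PreservesAnalytic κ S N fun e => ellDunklC κ (ν e) i := by
  have hσ : ∀ e, ∀ j : {j : Fin n // j ≠ i},
      sigma (periods τ) (-((ν e).1 i - (ν e).1 j.1)) ≠ 0 := fun e j =>
    sigma_ne_zero _ fun hl => (ν e).2 i j.1 j.2.symm (by simpa using (periods τ).lattice.neg_mem hl)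
  refine preservesAnalytic_dunkl hS hN hN0 hW i (fun j e => Hol.mk _ (analytic_phi (ν e) j.2))
    (fun j z => sigma (periods τ) (z.2 i - z.2 j.1 - ((ν z.1).1 i - (ν z.1).1 j.1))
      / (sigmaTail (periods τ) (z.2 i - z.2 j.1) * sigma (periods τ) (-((ν z.1).1 i - (ν z.1).1 j.1))))
    (fun j z hz => ?_) (fun j e he l hl => ?_) (fun j e he l hl h => ?_)
  · have h1 : AnalyticAt ℂ (fun z : E × (Fin n → ℂ) => (ν z.1).1 i - (ν z.1).1 j.1) z :=
      AnalyticAt.comp (g := fun x : Fin n → ℂ => x i - x j.1)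
        (f := fun z : E × (Fin n → ℂ) => (ν z.1).1)
        (analytic_coord_sub i j.1 Set.univ _ trivial)
        (AnalyticAt.comp (g := fun e => (ν e).1) (f := Prod.fst) (hν z.1 hz.1) analyticAt_fst)
    have h2 : AnalyticAt ℂ (fun z : E × (Fin n → ℂ) => z.2 i - z.2 j.1) z :=
      AnalyticAt.comp (g := fun x : Fin n → ℂ => x i - x j.1) (f := Prod.snd)
        (analytic_coord_sub i j.1 Set.univ z.2 trivial) analyticAt_snd
    have h3 := AnalyticAt.comp (g := sigma (periods τ)) (analyticAt_sigma (periods τ) _) (h2.sub h1)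
    have h4 := AnalyticAt.comp (g := sigmaTail (periods τ)) (analyticAt_sigmaTail (periods τ) _) h2
    have h5 := AnalyticAt.comp (g := sigma (periods τ)) (analyticAt_sigma (periods τ) _) h1.neg
    exact h3.div (h4.mul h5) (mul_ne_zero
      (sigmaTail_ne_zero _ (hN0 hz.2 i j.1)) (hσ z.1 j))
  · have h0 := sub_ne_zero_of_mem l.2 j.2.symm
    have ht := sigmaTail_ne_zero (periods τ) (hN0 hl i j.1)
    have := hσ e j
    change (l.1 i - l.1 j.1) * phi τ _ _ = _
    rw [phi, sigma_eq_mul_sigmaTail _ (l.1 i - l.1 j.1)]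
    field_simp
  · simp only [h, sub_self, sigmaTail_zero, zero_sub, one_mul]
    exact div_self (hσ e j)

end Preservation

/-! ### Extension across one hyperplane -/

section LocalExtension

open SkewMonoidAlgebra

variable {n : ℕ} {τ : UpperHalfPlane} {κ : ℂ}

theorem dense_ne_zero {E : Type*} [NormedAddCommGroup E] [NormedSpace ℂ E] {ℓ : E →L[ℂ] ℂ}
    (hℓ : ℓ ≠ 0) : Dense {e | ℓ e ≠ 0} :=
  (dense_compl_singleton (0 : ℂ)).preimage (ContinuousLinearMap.isOpenMap_of_ne_zero ℓ hℓ)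

/-- The functional `λ ↦ λ_a - λ_b`. -/
noncomputable def coordSub (a b : Fin n) : (Fin n → ℂ) →L[ℂ] ℂ :=
  ContinuousLinearMap.proj (R := ℂ) (φ := fun _ : Fin n => ℂ) a
    - ContinuousLinearMap.proj (R := ℂ) (φ := fun _ : Fin n => ℂ) b

theorem coordSub_apply (a b : Fin n) (l : Fin n → ℂ) : coordSub a b l = l a - l b := rfl

theorem coordSub_ne_zero {a b : Fin n} (h : a ≠ b) : coordSub a b ≠ 0 := fun h0 => by
  have := congrArg (fun f => f (Pi.single a 1)) h0
  simp [coordSub_apply, h.symm] at this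

/-- The operator of multiplication by `F(λ, y(λ))` preserves the analyticity on `N` of equivariant
functions. -/
def MulPreservesAnalytic (κ : ℂ) (N : Set (Fin n → ℂ)) (F : A0 n τ) : Prop :=
  ∀ G : (Fin n → ℂ) → AhS n τ, AhSFamily N G →
    (∀ (w : Equiv.Perm (Fin n)), ∀ l ∈ N, single w 1 * G (l ∘ w) = G l) →
    ∃ G' : (Fin n → ℂ) → AhS n τ, AhSFamily N G' ∧
      ∀ l : regSet n τ, l.1 ∈ N → hat κ l F * G l.1 = G' l.1

theorem norm_comp_perm (l : Fin n → ℂ) (w : Equiv.Perm (Fin n)) : ‖l ∘ w‖ = ‖l‖ := by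
  refine le_antisymm ((pi_norm_le_iff_of_nonneg (norm_nonneg _)).mpr fun i => norm_le_pi_norm l _)
    ((pi_norm_le_iff_of_nonneg (norm_nonneg _)).mpr fun i => ?_)
  simpa using norm_le_pi_norm (l ∘ w) (w.symm i)

theorem dist_comp_perm (l l' : Fin n → ℂ) (w : Equiv.Perm (Fin n)) :
    dist (l ∘ w) (l' ∘ w) = dist l l' := by
  rw [dist_eq_norm, dist_eq_norm, ← norm_comp_perm (l - l') w]
  rfl

theorem comp_swap_eq {a b : Fin n} {l : Fin n → ℂ} (h : l a = l b) : l ∘ Equiv.swap a b = l := by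
  funext m
  simp only [Function.comp_apply, Equiv.swap_apply_def]
  split_ifs with h1 h2
  · rw [h1, h]
  · rw [h2, h]
  · rfl

/-- A permutation that fixes all points except possibly `a` and `b` is `1` or `s_{ab}`. -/
theorem perm_eq_of_fixes {a b : Fin n} (w : Equiv.Perm (Fin n))
    (h : ∀ i, i ≠ a → i ≠ b → w i = i) : w = 1 ∨ w = Equiv.swap a b := by
  by_cases ha : w a = a
  · left
    ext i
    by_cases hia : i = a
    · simp [hia, ha]
    by_cases hib : i = b
    · subst hib
      by_contra hne
      have hwi : w i ≠ i := fun h' => hne (by simp [h'])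
      by_cases hwa : w i = a
      · exact hia (w.injective (hwa.trans ha.symm))
      · exact hwi (w.injective (h _ hwa hwi))
    · simp [h i hia hib]
  · right
    have hb : w a = b := by
      by_contra hne
      exact ha (w.injective (h _ ha hne))
    have hwb : w b = a := by
      by_contra hne
      by_cases hbb : w b = b
      · exact ha (hb.trans (w.injective (hb.trans hbb.symm)).symm)
      · exact hbb (w.injective (h _ hne hbb))
    ext i
    by_cases hia : i = a
    · subst hia; simp [hb]
    by_cases hib : i = b
    · subst hib; simp [hwb]
    · rw [h i hia hib, Equiv.swap_apply_of_ne_of_ne hia hib]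

/-- The equivariant function `λ ↦ ∑_w g(λ ∘ w) w`. -/
noncomputable def orbitSum (τ : UpperHalfPlane) (g : (Fin n → ℂ) → ℂ) (l : Fin n → ℂ) : AhS n τ :=
  ∑ w : Equiv.Perm (Fin n), g (l ∘ w) • single w 1

theorem single_mul_orbitSum (g : (Fin n → ℂ) → ℂ) (l : Fin n → ℂ) (v : Equiv.Perm (Fin n)) :
    single v 1 * orbitSum τ g (l ∘ v) = orbitSum τ g l := by
  rw [orbitSum, orbitSum, Finset.mul_sum]
  refine Fintype.sum_equiv (Equiv.mulLeft v) _ _ fun w => ?_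
  rw [mul_smul_comm, single_mul_single, smul_one, one_mul]
  rfl

theorem orbitSum_family {N : Set (Fin n → ℂ)} (hN : IsOpen N)
    (hW : ∀ (w : Equiv.Perm (Fin n)), ∀ l ∈ N, l ∘ w ∈ N) {g : (Fin n → ℂ) → ℂ}
    (hg : AnalyticOnNhd ℂ g N) : AhSFamily N (orbitSum τ g) := by
  refine AhSFamily.sum hN _ fun w _ => AhSFamily.smul hN (fun l hl => ?_) (AhSFamily.const hN _)
  exact AnalyticAt.comp (f := permL w) (hg _ (hW w l hl)) ((permL w).analyticAt l)

/-- Around a point on exactly one hyperplane `λ_a = λ_b` there is a neighbourhood whose translates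
under the permutations outside `{1, s_{ab}}` are disjoint from it. -/
theorem exists_slice {B : Set (Fin n → ℂ)} (hB : IsOpen B) {l₀ : Fin n → ℂ} (hl₀ : l₀ ∈ B)
    {a b : Fin n} (hab : l₀ a = l₀ b)
    (hgen : ∀ i j, i ≠ j → ¬(i = a ∧ j = b) → ¬(i = b ∧ j = a) → l₀ i ≠ l₀ j) :
    ∃ D : Set (Fin n → ℂ), IsOpen D ∧ l₀ ∈ D ∧ D ⊆ B ∧ (∀ l ∈ D, l ∘ Equiv.swap a b ∈ D) ∧
      (∀ (w : Equiv.Perm (Fin n)), ∀ l ∈ D, l ∘ w ∈ D → w = 1 ∨ w = Equiv.swap a b) ∧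
      ∀ l ∈ D, ∀ i j, i ≠ j → ¬(i = a ∧ j = b) → ¬(i = b ∧ j = a) → l i ≠ l j := by
  -- `D` is a small ball around `l₀`
  have h1 : ∀ᶠ ε : ℝ in 𝓝[>] 0, Metric.ball l₀ ε ⊆ B := by
    obtain ⟨r, hr, hrB⟩ := Metric.isOpen_iff.mp hB l₀ hl₀
    filter_upwards [Ioc_mem_nhdsGT hr] with ε hε
    exact (Metric.ball_subset_ball hε.2).trans hrB
  have h2 : ∀ᶠ ε : ℝ in 𝓝[>] 0, ∀ w : Equiv.Perm (Fin n), l₀ ∘ w ≠ l₀ → 2 * ε < dist (l₀ ∘ w) l₀ := by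
    refine Filter.eventually_all.mpr fun w => ?_
    by_cases hw : l₀ ∘ w = l₀
    · exact Eventually.of_forall fun ε h => absurd hw h
    · have := dist_pos.mpr hw
      filter_upwards [Ioo_mem_nhdsGT (half_pos this)] with ε hε _
      linarith [hε.2]
  have h3 : ∀ᶠ ε : ℝ in 𝓝[>] 0, ∀ i j, l₀ i ≠ l₀ j → 2 * ε < dist (l₀ i) (l₀ j) := by
    refine Filter.eventually_all.mpr fun i => Filter.eventually_all.mpr fun j => ?_
    by_cases hij : l₀ i = l₀ j
    · exact Eventually.of_forall fun ε h => absurd hij h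
    · have := dist_pos.mpr hij
      filter_upwards [Ioo_mem_nhdsGT (half_pos this)] with ε hε _
      linarith [hε.2]
  obtain ⟨ε, ⟨hεB, hεw, hεi⟩, hε⟩ := ((h1.and (h2.and h3)).and self_mem_nhdsWithin).exists
  have hε : 0 < ε := hε
  refine ⟨Metric.ball l₀ ε, Metric.isOpen_ball, Metric.mem_ball_self hε, hεB, fun l hl => ?_,
    fun w l hl hlw => ?_, fun l hl i j hij h h' hlij => ?_⟩
  · rw [Metric.mem_ball, ← comp_swap_eq hab, dist_comp_perm]
    exact hl
  · have hw : l₀ ∘ w = l₀ := by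
      by_contra hne
      have := hεw w hne
      have h4 := dist_triangle_left (l₀ ∘ w) l₀ (l ∘ w)
      rw [dist_comp_perm] at h4
      rw [Metric.mem_ball] at hl hlw
      linarith
    refine perm_eq_of_fixes w fun i hia hib => ?_
    by_contra hwi
    exact hgen (w i) i hwi (fun h => hib h.2) (fun h => hia h.2) (congrFun hw i)
  · have := hεi i j (hgen i j hij h h')
    have hi := (dist_le_pi_dist l l₀ i).trans_lt hl
    have hj := (dist_le_pi_dist l l₀ j).trans_lt hl
    have h4 := dist_triangle_left (l₀ i) (l₀ j) (l i)
    rw [hlij] at h4 hi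
    linarith

/-- The regular points are dense in open sets of the neighbourhood `nearDiagonal` of `0`. -/
theorem subset_closure_regSet_inter {D : Set (Fin n → ℂ)} (hD : IsOpen D)
    (hD0 : D ⊆ nearDiagonal n τ) : D ⊆ closure (regSet n τ ∩ D) := by
  have hd : Dense (⋂ p : {p : Fin n × Fin n // p.1 ≠ p.2}, {l | coordSub p.1.1 p.1.2 l ≠ 0}) :=
    dense_iInter_of_isOpen (fun p => isOpen_ne_fun (coordSub p.1.1 p.1.2).continuous continuous_const)
      fun p => dense_ne_zero (coordSub_ne_zero p.2)
  refine (hd.open_subset_closure_inter hD).trans (closure_mono fun l hl => ⟨fun i j hij h => ?_, hl.1⟩)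
  exact Set.mem_iInter.mp hl.2 ⟨(i, j), hij⟩ (hD0 hl.1 i j h)

/-- Without interaction the operators `y_i(λ)` are the momenta. -/
theorem hat_zero_eq_single (l : regSet n τ) (F : A0 n τ) :
    ∃ a : Ah n τ, hat 0 l F = single 1 a := by
  have key : ∀ f : MvPolynomial (Fin n) ℂ, ∃ a : Ah n τ, substEll 0 l f = single 1 a := by
    intro f
    induction f using MvPolynomial.induction_on with
    | C c =>
      refine ⟨c • 1, ?_⟩
      rw [← mul_one (MvPolynomial.C c), ← MvPolynomial.smul_eq_C_mul, substEll_smul, map_one,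
        ← smul_single, ← one_def]
    | add p q hp hq =>
      obtain ⟨a, ha⟩ := hp
      obtain ⟨b, hb⟩ := hq
      exact ⟨a + b, by rw [map_add, ha, hb, single_add]⟩
    | mul_X p i hp =>
      obtain ⟨a, ha⟩ := hp
      refine ⟨a * Ah.p i, ?_⟩
      rw [map_mul, ha, substEll_X, ellDunkl, zero_smul, sub_zero, single_mul_single, one_smul, one_mul]
  exact key (F.evalAt l)

theorem hat_mul_ellDunkl (l : regSet n τ) (F : A0 n τ) (i : Fin n) :
    hat κ l F * ellDunkl κ l i = ellDunkl κ l i * hat κ l F := by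
  rw [← hat_p, ← map_mul, ← map_mul, mul_comm]

/-- Multiplying `y_a(λ)` by `λ_a - λ_b` removes its pole at `λ_a = λ_b` and leaves `κ s_{ab}`
there. -/
theorem exists_family_smul_ellDunkl {D : Set (Fin n → ℂ)} (hD : IsOpen D)
    (hD0 : D ⊆ nearDiagonal n τ) {a b : Fin n} (hab : a ≠ b)
    (hgen : ∀ l ∈ D, ∀ j, j ≠ a → j ≠ b → l a ≠ l j) :
    ∃ Y : (Fin n → ℂ) → AhS n τ, AhSFamily D Y ∧
      (∀ l : regSet n τ, l.1 ∈ D → Y l.1 = (l.1 a - l.1 b) • ellDunkl κ l a) ∧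
      ∀ l ∈ D, l a = l b → Y l = κ • single (Equiv.swap a b) 1 := by
  classical
  let c : {j : Fin n // j ≠ a} → (Fin n → ℂ) → ℂ := fun j l =>
    if j.1 = b then 1 else (l a - l b) / (l a - l j.1)
  have hc : ∀ j, AnalyticOnNhd ℂ (c j) D := by
    intro j l hl
    by_cases hj : j.1 = b
    · simp only [c, if_pos hj]; exact analyticAt_const
    · simp only [c, if_neg hj]
      exact (analytic_coord_sub a b Set.univ l trivial).div (analytic_coord_sub a j.1 Set.univ l trivial)
        (sub_ne_zero.mpr (hgen l hl j.1 j.2 hj))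
  refine ⟨fun l => (l a - l b) • single 1 (Ah.p a)
      - κ • ∑ j, c j l • single (Equiv.swap a j.1) (Ah.ofHol (psiHol a j.1 l)), ?_, fun l hl => ?_,
    fun l hl h => ?_⟩
  · exact AhSFamily.sub hD
      (AhSFamily.smul hD (fun l _ => analytic_coord_sub a b Set.univ l trivial) (AhSFamily.const hD _))
      (AhSFamily.smul hD analyticOnNhd_const (AhSFamily.sum hD _ fun j _ => AhSFamily.smul hD (hc j)
        (AhSFamily.single hD _ (AhFamily.ofHol hD (psiHol_family hD hD0 j.2.symm)))))
  · simp only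
    rw [ellDunkl_eq, dunkl, smul_sub, smul_comm (l.1 a - l.1 b) κ,
      Finset.smul_sum (r := l.1 a - l.1 b)]
    refine congrArg₂ _ rfl (congrArg (κ • ·) (Finset.sum_congr rfl fun j _ => ?_))
    rw [psiHol_of_mem_regSet l j.2.symm, single_ofHol_smul, smul_smul]
    congr 1
    by_cases hj : j.1 = b
    · simp only [c, if_pos hj, one_mul, hj]
    · simp only [c, if_neg hj]
      exact div_mul_cancel₀ _ (sub_ne_zero_of_mem l.2 j.2.symm)
  · simp only
    rw [Finset.sum_eq_single ⟨b, hab.symm⟩]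
    · have h1 : Ah.ofHol (-1 : Hol n τ) = -1 := by
        rw [Ah.ofHol_neg]; rfl
      rw [psiHol_of_eq hab (hD0 hl) h, h1]
      simp [c, h, single_neg]
    · intro j _ hj
      have hj' : j.1 ≠ b := fun h' => hj (Subtype.ext h')
      simp [c, if_neg hj', h]
    · simp

/-- Near a point on exactly one hyperplane `λ_a = λ_b`, the function `F(λ, y(λ))` extends
analytically across the hyperplane. With `u = λ_a - λ_b` and `s = s_{ab}`, applying `F` to the
equivariant functions that equal `1 + s` and `u (1 - s)` near the point shows that `u F(λ, y(λ))` is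
analytic; on `u = 0` it commutes with the residue `κ s` of `y_a(λ)`, while the symmetry of `F` makes
it anticommute with `s`. -/
theorem exists_local_extension {B : Set (Fin n → ℂ)} (hB : IsOpen B)
    (hB0 : B ⊆ nearDiagonal n τ) (hBW : ∀ (w : Equiv.Perm (Fin n)), ∀ l, l ∘ w ∈ B → l ∈ B)
    {F : A0 n τ} (hF : ∀ w : Equiv.Perm (Fin n), w • F = F)
    (hgood : ∀ N ⊆ B, IsOpen N → (∀ (w : Equiv.Perm (Fin n)), ∀ l ∈ N, l ∘ w ∈ N) →
      MulPreservesAnalytic κ N F)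
    {l₀ : Fin n → ℂ} (hl₀ : l₀ ∈ B) {a b : Fin n} (hne : a ≠ b) (hab : l₀ a = l₀ b)
    (hgen : ∀ i j, i ≠ j → ¬(i = a ∧ j = b) → ¬(i = b ∧ j = a) → l₀ i ≠ l₀ j) :
    ∃ D : Set (Fin n → ℂ), IsOpen D ∧ l₀ ∈ D ∧ ∃ Q : (Fin n → ℂ) → AhS n τ, AhSFamily D Q ∧
      ∀ l : regSet n τ, l.1 ∈ D → hat κ l F = Q l.1 := by
  obtain ⟨D, hDo, hlD, hDB, hDs, hDw, hDij⟩ := exists_slice hB hl₀ hab hgen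
  set s := Equiv.swap a b with hs
  have hs1 : s ≠ 1 := fun h => hne (by simpa [hs] using congrFun (congrArg DFunLike.coe h) b)
  have hss : single s (1 : Ah n τ) * single s 1 = 1 := by
    rw [single_mul_single, smul_one, one_mul, hs, Equiv.swap_mul_self, one_def]
  let N : Set (Fin n → ℂ) := ⋃ w : Equiv.Perm (Fin n), permL w ⁻¹' D
  have hmemN : ∀ l, l ∈ N ↔ ∃ w : Equiv.Perm (Fin n), l ∘ w ∈ D := fun l => Set.mem_iUnion
  have hDN : D ⊆ N := fun l hl => (hmemN l).mpr ⟨1, hl⟩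
  have hNo : IsOpen N := isOpen_iUnion fun w => hDo.preimage (permL w).continuous
  have hNB : N ⊆ B := fun l hl => by
    obtain ⟨w, hw⟩ := (hmemN l).mp hl
    exact hBW w l (hDB hw)
  have hNW : ∀ (w : Equiv.Perm (Fin n)), ∀ l ∈ N, l ∘ w ∈ N := fun w l hl => by
    obtain ⟨v, hv⟩ := (hmemN l).mp hl
    refine (hmemN _).mpr ⟨w⁻¹ * v, ?_⟩
    convert hv using 1
    funext i
    simp
  have hDW : ∀ (w : Equiv.Perm (Fin n)), ∀ l ∈ D, (l ∘ w ∈ D ↔ w = 1 ∨ w = s) := fun w l hl =>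
    ⟨hDw w l hl, fun h => by
      rcases h with rfl | rfl
      · exact hl
      · exact hDs l hl⟩
  -- a function on `D`, extended by zero, is analytic on the union `N` of the translates of `D`
  have hind : ∀ c : (Fin n → ℂ) → ℂ, AnalyticOnNhd ℂ c Set.univ →
      AnalyticOnNhd ℂ (D.indicator c) N := by
    intro c hc l hl
    by_cases hlD : l ∈ D
    · refine (hc l trivial).congr ?_
      filter_upwards [hDo.mem_nhds hlD] with y hy
      rw [Set.indicator_of_mem hy]
    · obtain ⟨w, hw⟩ := (hmemN l).mp hl
      refine (analyticAt_const (v := (0 : ℂ))).congr ?_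
      filter_upwards [(hDo.preimage (permL w).continuous).mem_nhds hw] with y hy
      rw [Set.indicator_of_notMem]
      intro hyD
      rcases hDw w y hyD hy with rfl | rfl
      · exact hlD hw
      · refine hlD ?_
        have := hDs _ hw
        convert this using 1
        funext i
        simp [hs]
  -- on `D` only the terms of `1` and `s` in the orbit sum are nonzero
  have horb : ∀ c : (Fin n → ℂ) → ℂ, ∀ l ∈ D, (orbitSum τ (D.indicator c) l : AhS n τ)
      = c l • 1 + c (l ∘ s) • single s 1 := by
    classical
    intro c l hl
    rw [orbitSum, ← Finset.sum_subset (Finset.subset_univ {1, s}), Finset.sum_pair hs1.symm]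
    · rw [Set.indicator_of_mem, Set.indicator_of_mem, one_def]
      · rfl
      · exact hDs l hl
      · exact hl
    · intro w _ hw
      rw [Set.indicator_of_notMem, zero_smul]
      rw [hDW w l hl]
      simpa using hw
  have hres : ∀ c : (Fin n → ℂ) → ℂ, AnalyticOnNhd ℂ c Set.univ → ∃ A : (Fin n → ℂ) → AhS n τ,
      AhSFamily D A ∧ ∀ l : regSet n τ, l.1 ∈ D →
        hat κ l F * (c l.1 • 1 + c (l.1 ∘ s) • single s 1) = A l.1 := by
    intro c hc
    obtain ⟨A, hA, hAl⟩ := hgood N hNB hNo hNW _ (orbitSum_family (τ := τ) hNo hNW (hind c hc))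
      fun w l _ => single_mul_orbitSum _ l w
    exact ⟨A, hA.mono hDN, fun l hl => by rw [← horb c l.1 hl]; exact hAl l (hDN hl)⟩
  -- on regular points of `D`, with `u = λ_a - λ_b` and `F̂ = F(λ, y(λ))`:
  -- `A = F̂ (1 + s)` and, since `u` is odd under `s`, `A' = u F̂ (1 - s)`
  obtain ⟨A, hA, hAl⟩ := hres (fun _ => 1) analyticOnNhd_const
  obtain ⟨A', hA', hAl'⟩ := hres (fun l => l a - l b) (analytic_coord_sub a b _)
  simp only [one_smul] at hAl
  -- for `κ = 0` the value `F̂` lies in `A_ħ`, and is the coefficient of `1` in `F̂ (1 + s)`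
  by_cases hκ : κ = 0
  · subst hκ
    refine ⟨D, hDo, hlD, fun l => single 1 ((A l).coeff 1), AhSFamily.single hDo _ (hA 1),
      fun l hl => ?_⟩
    obtain ⟨f, hf⟩ := hat_zero_eq_single l F
    simp only
    rw [← hAl l hl, hf, mul_add, mul_one, single_mul_single, one_smul, one_mul, mul_one, coeff_add,
      Finsupp.add_apply, coeff_single_apply, coeff_single_apply, if_pos rfl, if_neg hs1, add_zero]
  -- `Z` is the analytic extension of `u F̂`
  let Z : (Fin n → ℂ) → AhS n τ := fun l => (1 / 2 : ℂ) • ((l a - l b) • A l + A' l)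
  have hcs : AnalyticOnNhd ℂ (fun l : Fin n → ℂ => l a - l b) D := analytic_coord_sub a b _
  have hZ : AhSFamily D Z := AhSFamily.smul hDo analyticOnNhd_const
    (AhSFamily.add hDo (AhSFamily.smul hDo hcs hA) hA')
  have hZl : ∀ l : regSet n τ, l.1 ∈ D → Z l.1 = (l.1 a - l.1 b) • hat κ l F := by
    intro l hl
    have h1 : (l.1 ∘ s) a - (l.1 ∘ s) b = -(l.1 a - l.1 b) := by simp [hs]
    simp only [Z]
    rw [← hAl l hl, ← hAl' l hl, h1, neg_smul, mul_add, mul_add, mul_neg, mul_smul_comm,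
      mul_smul_comm, mul_one]
    module
  have hdense : D ⊆ closure (regSet n τ ∩ D) := subset_closure_regSet_inter hDo (hDB.trans hB0)
  obtain ⟨Y, hY, hYl, hY0⟩ := exists_family_smul_ellDunkl (κ := κ) hDo (hDB.trans hB0) hne
    fun l hl j hja hjb => hDij l hl a j hja.symm (fun h => hjb h.2) (fun h => hne h.1)
  -- `F̂` commutes with `y_a(λ)`
  have hcomm : ∀ l ∈ D, Z l * Y l = Y l * Z l :=
    AhSFamily.eq_of_dense (hZ.mul hDo hY) (hY.mul hDo hZ) hdense fun l hl => by
      rw [hZl ⟨l, hl.1⟩ hl.2, hYl ⟨l, hl.1⟩ hl.2, smul_mul_assoc, mul_smul_comm, smul_mul_assoc,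
        mul_smul_comm, hat_mul_ellDunkl]
  -- the symmetry of `F` gives `s F̂(s λ) = F̂(λ) s`; the factor `u` changes sign
  have hanti : ∀ l ∈ D, single s 1 * Z (l ∘ s) = (-1 : ℂ) • (Z l * single s 1) := by
    refine AhSFamily.eq_of_dense ((AhSFamily.const hDo _).mul hDo (AhSFamily.comp hZ (g := permL s)
      (fun l _ => (permL s).analyticAt l) hDs)) (AhSFamily.smul hDo analyticOnNhd_const
        (hZ.mul hDo (AhSFamily.const hDo _))) hdense fun l hl => ?_
    have h1 := hZl (permReg s ⟨l, hl.1⟩) (hDs l hl.2)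
    have h2 : (permReg s ⟨l, hl.1⟩ : regSet n τ).1 a - (permReg s ⟨l, hl.1⟩ : regSet n τ).1 b
        = -(l a - l b) := by simp [permReg, hs]
    rw [h2] at h1
    refine (congrArg (single s 1 * ·) h1).trans ?_
    rw [mul_smul_comm, single_mul_hat, hF, hZl ⟨l, hl.1⟩ hl.2, smul_mul_assoc, smul_smul]
    congr 1
    ring
  -- on the hyperplane `Z` both commutes and anticommutes with `s`, so it vanishes
  have hZ0 : ∀ l ∈ D, coordSub a b l = 0 → Z l = 0 := by
    intro l hl h0
    have he : l a = l b := sub_eq_zero.mp h0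
    have h1 := hcomm l hl
    have h2 := hanti l hl
    rw [comp_swap_eq he] at h2
    rw [hY0 l hl he, mul_smul_comm κ (Z l), smul_mul_assoc κ] at h1
    have h3 : Z l * single s 1 = single s 1 * Z l := smul_right_injective (AhS n τ) hκ h1
    rw [← h3] at h2
    have h4 : Z l * single s 1 = 0 := by
      have : (2 : ℂ) • (Z l * single s 1) = 0 := by
        rw [two_smul]; nth_rewrite 1 [h2]; rw [neg_one_smul, neg_add_cancel]
      exact (smul_eq_zero.mp this).resolve_left two_ne_zero
    rw [← mul_one (Z l), ← hss, ← mul_assoc, h4, zero_mul]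
  obtain ⟨Q, hQ, hQl⟩ := AhSFamily.exists_eq_smul_of_hyperplane hDo hZ (ℓ := coordSub a b)
    (v := Pi.single a 1) (by simp [coordSub_apply, hne.symm]) hZ0
  refine ⟨D, hDo, hlD, Q, hQ, fun l hl => ?_⟩
  have hn : l.1 a - l.1 b ≠ 0 := sub_ne_zero_of_mem l.2 hne
  refine smul_right_injective _ hn ?_
  exact (hZl l hl).symm.trans (hQl l.1 hl hn)

end LocalExtension

/-! ### A mean value property -/

section Circle

/-- The mean value property for a function with removable singularities in the unit disc. -/
theorem circleAverage_eq_of_removable {f : ℂ → ℂ}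
    (h : ∀ s ∈ Metric.closedBall (0 : ℂ) 1, ∃ g : ℂ → ℂ, AnalyticAt ℂ g s ∧ f =ᶠ[𝓝[≠] s] g)
    (h0 : ContinuousAt f 0) (h1 : ∀ s ∈ Metric.sphere (0 : ℂ) 1, ContinuousAt f s) :
    Real.circleAverage f 0 1 = f 0 := by
  -- the function with the singularities removed
  let F : ℂ → ℂ := fun s => limUnder (𝓝[≠] s) f
  have hF : ∀ s ∈ Metric.closedBall (0 : ℂ) 1, DifferentiableAt ℂ F s := by
    intro s hs
    obtain ⟨g, hg, hfg⟩ := h s hs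
    have : F =ᶠ[𝓝 s] g := by
      have h2 : ∀ᶠ t in 𝓝 s, AnalyticAt ℂ g t := hg.eventually_analyticAt
      have h3 : ∀ᶠ t in 𝓝 s, t ≠ s → ∀ᶠ u in 𝓝 t, f u = g u := by
        have := eventually_nhdsWithin_iff.mp (eventually_eventually_nhdsWithin.mpr hfg)
        filter_upwards [this] with t ht hts
        have := ht hts
        rwa [IsOpen.nhdsWithin_eq isOpen_compl_singleton hts] at this
      filter_upwards [h2, h3] with t ht ht'
      refine Tendsto.limUnder_eq ?_
      refine (ht.continuousAt.tendsto.mono_left nhdsWithin_le_nhds).congr' ?_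
      by_cases hts : t = s
      · subst hts; exact hfg.symm
      · exact ((ht' hts).filter_mono nhdsWithin_le_nhds).mono fun u hu => hu.symm
    exact hg.differentiableAt.congr_of_eventuallyEq this
  have hFf : ∀ s, ContinuousAt f s → F s = f s := fun s hs =>
    (hs.tendsto.mono_left nhdsWithin_le_nhds).limUnder_eq
  rw [← hFf 0 h0, ← DiffContOnCl.circleAverage (f := F) (c := 0) (R := 1)]
  · refine Real.circleAverage_congr_sphere fun s hs => (hFf s (h1 s ?_)).symm
    rwa [abs_one] at hs
  · rw [abs_one]
    refine DifferentiableOn.diffContOnCl fun s hs => (hF s ?_).differentiableWithinAt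
    exact Metric.closure_ball_subset_closedBall hs

end Circle

/-! ### Extension to the origin -/

section Limit

open SkewMonoidAlgebra

variable {n : ℕ} {τ : UpperHalfPlane} {κ : ℂ}

open Classical in
/-- `F(λ, y(λ))`, extended by `0` to non-regular `λ`. -/
noncomputable def hatExt (κ : ℂ) (F : A0 n τ) (l : Fin n → ℂ) : AhS n τ :=
  if h : l ∈ regSet n τ then hat κ ⟨l, h⟩ F else 0

theorem hatExt_apply (F : A0 n τ) (l : regSet n τ) : hatExt κ F l.1 = hat κ l F := dif_pos l.2

/-- The set `T` of monomials may be larger than the support of the value at `λ`, so that one set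
serves for all `λ`. -/
theorem hat_eq_sum (F : A0 n τ) (l : regSet n τ) {T : Finset (Fin n →₀ ℕ)}
    (hT : ∀ k ∉ T, (F.coeff k).1 l = 0) :
    hat κ l F = ∑ k ∈ T, (F.coeff k).1 l • substEll κ l (MvPolynomial.monomial k 1) := by
  rw [hat_apply, ← substEll_apply]
  have : F.evalAt l = ∑ k ∈ T, (F.coeff k).1 l • MvPolynomial.monomial k (1 : ℂ) := by
    rw [MvPolynomial.as_sum (F.evalAt l)]
    refine (Finset.sum_subset (s₂ := T) (fun k hk => ?_) fun k _ hk => ?_).trans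
      (Finset.sum_congr rfl fun k _ => ?_)
    · by_contra hkT
      exact MvPolynomial.mem_support_iff.mp hk ((coeff_evalAt l F k).trans (hT k hkT))
    · rw [MvPolynomial.notMem_support_iff.mp hk, map_zero]
    · rw [coeff_evalAt, MvPolynomial.smul_monomial, smul_eq_mul, mul_one]
  rw [this, _root_.map_sum]
  exact Finset.sum_congr rfl fun k _ => substEll_smul κ l _ _

theorem substEll_monomial (l : regSet n τ) (k : Fin n →₀ ℕ) :
    substEll κ l (MvPolynomial.monomial k 1) = (List.ofFn fun i => ellDunkl κ l i ^ k i).prod := by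
  rw [substEll_apply, subst, Finset.sum_eq_single k]
  · rw [MvPolynomial.coeff_monomial, if_pos rfl, one_smul]
  · intro b hb hbk
    rw [MvPolynomial.coeff_monomial, if_neg hbk.symm, zero_smul]
  · intro hk
    rw [MvPolynomial.notMem_support_iff.mp hk, zero_smul]

/-- On regular `λ`, the elements `F(λ, y(λ))` form an analytic family. -/
theorem hatExt_family (F : A0 n τ) : AhSFamily (regSet n τ) (hatExt κ F) := by
  classical
  have hO := isOpen_regSet n τ
  let Y : Fin n → (Fin n → ℂ) → AhS n τ := fun i l =>
    single 1 (Ah.p i) - κ • ∑ j : {j : Fin n // j ≠ i},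
      (l i - l j.1)⁻¹ • single (Equiv.swap i j.1) (Ah.ofHol (psiHol i j.1 l))
  have hY : ∀ i, AhSFamily (regSet n τ) (Y i) := fun i =>
    AhSFamily.sub hO (AhSFamily.const hO _) (AhSFamily.smul hO analyticOnNhd_const
      (AhSFamily.sum hO _ fun j _ => AhSFamily.smul hO
        (fun l hl => (analytic_coord_sub i j.1 Set.univ l trivial).inv
          (sub_ne_zero_of_mem hl j.2.symm))
        (AhSFamily.single hO _ (AhFamily.ofHol hO
          (psiHol_family hO regSet_subset_nearDiagonal j.2.symm)))))
  have hYl : ∀ i, ∀ l : regSet n τ, Y i l.1 = ellDunkl κ l i := by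
    intro i l
    simp only [Y]
    rw [ellDunkl_eq, dunkl]
    refine congrArg₂ _ rfl (congrArg (κ • ·) (Finset.sum_congr rfl fun j _ => ?_))
    rw [psiHol_of_mem_regSet l j.2.symm, single_ofHol_smul, smul_smul,
      inv_mul_cancel₀ (sub_ne_zero_of_mem l.2 j.2.symm), one_smul]
  have hsum : AhSFamily (regSet n τ) fun l => ∑ k ∈ MvPolynomial.support (R := Hol n τ) F,
      extZero (F.coeff k).1 l • (List.ofFn fun i => Y i l ^ k i).prod :=
    AhSFamily.sum hO _ fun k _ => AhSFamily.smul hO (F.coeff k).2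
      (AhSFamily.list_prod hO fun i => (hY i).pow hO (k i))
  refine hsum.congr hO fun l hl => ?_
  refine (hatExt_apply (κ := κ) F ⟨l, hl⟩).trans ((hat_eq_sum F ⟨l, hl⟩
    (T := MvPolynomial.support (R := Hol n τ) F) fun k hk => ?_).trans
    (Finset.sum_congr rfl fun k _ => ?_))
  · rw [A0.coeff, MvPolynomial.notMem_support_iff.mp hk]; rfl
  · have h2 : (fun i => ellDunkl κ (⟨l, hl⟩ : regSet n τ) i ^ k i) = fun i => Y i l ^ k i :=
      funext fun i => congrArg (· ^ k i) (hYl i ⟨l, hl⟩).symm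
    rw [substEll_monomial, h2]
    exact congrArg (· • _) (extZero_apply _ (⟨l, hl⟩ : regSet n τ)).symm

/-- The lattice is discrete, since `σ(z)/z` does not vanish near `0`. -/
theorem exists_ball_subset_nearDiagonal (n : ℕ) (τ : UpperHalfPlane) :
    ∃ R > 0, Metric.ball (0 : Fin n → ℂ) R ⊆ nearDiagonal n τ := by
  have h1 : ∀ᶠ z in 𝓝 (0 : ℂ), sigmaTail (periods τ) z ≠ 0 :=
    (analyticAt_sigmaTail (periods τ) 0).continuousAt.eventually_ne (by
      rw [sigmaTail_zero]; exact one_ne_zero)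
  obtain ⟨δ, hδ, h⟩ := Metric.eventually_nhds_iff_ball.mp h1
  refine ⟨δ / 2, half_pos hδ, fun l hl i j hij => ?_⟩
  by_contra hne
  have h2 := (sigma_eq_zero_iff (periods τ)).mpr hij
  rw [sigma_eq_mul_sigmaTail] at h2
  refine h (l i - l j) ?_ ((mul_eq_zero.mp h2).resolve_left hne)
  rw [mem_ball_zero_iff] at hl ⊢
  have := norm_sub_le (l i) (l j)
  have hi := norm_le_pi_norm l i
  have hj := norm_le_pi_norm l j
  linarith

/-- For a direction `v` with distinct coordinates, a generic line in direction `v` meets at most one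
of the hyperplanes `λ_i = λ_j` at a time. -/
theorem dense_generic {v : Fin n → ℂ} (hv : ∀ i j, i ≠ j → v i ≠ v j) :
    Dense {l : Fin n → ℂ | ∀ i j k m, i ≠ j → k ≠ m → ¬(k = i ∧ m = j) → ¬(k = j ∧ m = i) →
      (l i - l j) * (v k - v m) ≠ (l k - l m) * (v i - v j)} := by
  let ι := {p : (Fin n × Fin n) × (Fin n × Fin n) // p.1.1 ≠ p.1.2 ∧ p.2.1 ≠ p.2.2 ∧
    ¬(p.2.1 = p.1.1 ∧ p.2.2 = p.1.2) ∧ ¬(p.2.1 = p.1.2 ∧ p.2.2 = p.1.1)}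
  let ℓ : ι → (Fin n → ℂ) →L[ℂ] ℂ := fun p =>
    (v p.1.2.1 - v p.1.2.2) • coordSub p.1.1.1 p.1.1.2
      - (v p.1.1.1 - v p.1.1.2) • coordSub p.1.2.1 p.1.2.2
  have hℓ : ∀ p, ℓ p ≠ 0 := by
    rintro ⟨⟨⟨i, j⟩, k, m⟩, hij, hkm, h1, h2⟩ h0
    simp only at hij hkm h1 h2
    have hvkm := sub_ne_zero.mpr (hv k m hkm)
    by_cases hi : i = k ∨ i = m
    · have hjk : k ≠ j := by
        rintro rfl
        rcases hi with hi | hi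
        · exact hij hi
        · exact h2 ⟨rfl, hi.symm⟩
      have hjm : m ≠ j := by
        rintro rfl
        rcases hi with hi | hi
        · exact h1 ⟨hi.symm, rfl⟩
        · exact hij hi
      have := congrArg (fun f => f (Pi.single j 1)) h0
      simp [ℓ, coordSub_apply, hij, hjk, hjm] at this
      exact hvkm (by linear_combination -this)
    · rw [not_or] at hi
      have := congrArg (fun f => f (Pi.single i 1)) h0
      simp [ℓ, coordSub_apply, Ne.symm hij, Ne.symm hi.1, Ne.symm hi.2] at this
      exact hvkm this
  have hd : Dense (⋂ p : ι, {l | ℓ p l ≠ 0}) :=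
    dense_iInter_of_isOpen (fun p => isOpen_ne_fun (ℓ p).continuous continuous_const)
      fun p => dense_ne_zero (hℓ p)
  refine hd.mono fun l hl i j k m hij hkm h1 h2 h => ?_
  refine Set.mem_iInter.mp hl ⟨((i, j), (k, m)), hij, hkm, h1, h2⟩ ?_
  simp only [ℓ, sub_apply, smul_apply, coordSub_apply,
    smul_eq_mul]
  linear_combination h

/-- The limit theorem. If `F` is symmetric and multiplication by `F(λ, y(λ))` preserves analyticity
near `0`, then `F(λ, y(λ))` extends analytically to a neighbourhood of `0`; the value at `0` is the
mean value over a small circle of regular points. -/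
theorem exists_extension_at_zero {F : A0 n τ} (hF : ∀ w : Equiv.Perm (Fin n), w • F = F)
    (hgood : ∀ N ⊆ nearDiagonal n τ, IsOpen N →
      (∀ (w : Equiv.Perm (Fin n)), ∀ l ∈ N, l ∘ w ∈ N) → MulPreservesAnalytic κ N F) :
    ∃ ρ > 0, ∃ (v : Fin n → ℂ) (g : (Fin n → ℂ) → AhS n τ),
      AhSFamily (Metric.ball 0 ρ) g ∧
      (∀ l : regSet n τ, l.1 ∈ Metric.ball (0 : Fin n → ℂ) ρ → hat κ l F = g l.1) ∧
      (∀ s ∈ Metric.sphere (0 : ℂ) 1, s • v ∈ regSet n τ) ∧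
      IsCircleMean (fun s => hatExt κ F (s • v)) (g 0) ∧
      ∀ w : Equiv.Perm (Fin n), single w 1 * g 0 = g 0 * single w 1 := by
  obtain ⟨R, hR, hRB⟩ := exists_ball_subset_nearDiagonal n τ
  -- The coordinates of `v` are multiples of `η`. This choice gives `‖v‖ ≤ R/2`, so the discs
  -- `λ + s v` with `|s| ≤ 1` and `‖λ‖ < η/2` stay in the ball of radius `R`. Also
  -- `|v_i - v_j| ≥ η` for `i ≠ j`, while `|λ_i - λ_j| < η`, so their boundaries are regular.
  set η : ℝ := R / (2 * (n + 1)) with hη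
  have hη0 : 0 < η := by positivity
  have hηR : η * (n + 1) = R / 2 := by rw [hη]; field_simp
  have hηR' : η ≤ R / 2 := by
    rw [← hηR]
    exact le_mul_of_one_le_right hη0.le (by linarith [(Nat.cast_nonneg n : (0 : ℝ) ≤ n)])
  let v : Fin n → ℂ := fun i => ((η * (i : ℕ) : ℝ) : ℂ)
  have hvn : ‖v‖ ≤ R / 2 := by
    refine (pi_norm_le_iff_of_nonneg (by positivity)).mpr fun i => ?_
    rw [Complex.norm_real, Real.norm_eq_abs, abs_of_nonneg (by positivity), ← hηR]
    have : ((i : ℕ) : ℝ) < n := by exact_mod_cast i.2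
    gcongr
    linarith
  have hvij : ∀ i j, i ≠ j → η ≤ ‖v i - v j‖ := by
    intro i j hij
    rw [← Complex.ofReal_sub, Complex.norm_real, ← mul_sub, norm_mul, Real.norm_eq_abs η,
      abs_of_pos hη0]
    refine le_mul_of_one_le_right hη0.le ?_
    have h1 : (1 : ℤ) ≤ |((i : ℕ) : ℤ) - (j : ℕ)| :=
      Int.one_le_abs (sub_ne_zero.mpr fun h => hij (Fin.ext (by exact_mod_cast h)))
    rw [Real.norm_eq_abs]
    exact_mod_cast h1
  have hvne : ∀ i j, i ≠ j → v i ≠ v j := fun i j hij h => by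
    have := hvij i j hij
    rw [h, sub_self, norm_zero] at this
    linarith
  have hBmem : ∀ l ∈ Metric.ball (0 : Fin n → ℂ) (η / 2), ∀ s ∈ Metric.closedBall (0 : ℂ) 1,
      l + s • v ∈ Metric.ball (0 : Fin n → ℂ) R := by
    intro l hl s hs
    rw [mem_ball_zero_iff] at hl ⊢
    rw [mem_closedBall_zero_iff] at hs
    have h1 := norm_add_le l (s • v)
    rw [norm_smul] at h1
    have h2 : ‖s‖ * ‖v‖ ≤ 1 * (R / 2) := by gcongr
    linarith
  have hcirc : ∀ l ∈ Metric.ball (0 : Fin n → ℂ) (η / 2), ∀ s ∈ Metric.sphere (0 : ℂ) 1,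
      l + s • v ∈ regSet n τ := by
    intro l hl s hs i j hij hmem
    have h0 := hRB (hBmem l hl s (Metric.sphere_subset_closedBall hs)) i j hmem
    have h1 : l i - l j = -(s * (v i - v j)) := by
      simp only [Pi.add_apply, Pi.smul_apply, smul_eq_mul] at h0
      linear_combination h0
    have h2 := hvij i j hij
    have h3 := norm_sub_le (l i) (l j)
    rw [mem_sphere_zero_iff_norm] at hs
    rw [h1, norm_neg, norm_mul, hs, one_mul] at h3
    rw [mem_ball_zero_iff] at hl
    have hi := norm_le_pi_norm l i
    have hj := norm_le_pi_norm l j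
    linarith
  have hBW : ∀ (w : Equiv.Perm (Fin n)), ∀ l : Fin n → ℂ, l ∘ w ∈ Metric.ball (0 : Fin n → ℂ) R →
      l ∈ Metric.ball (0 : Fin n → ℂ) R := fun w l hl => by
    rwa [mem_ball_zero_iff, norm_comp_perm, ← mem_ball_zero_iff] at hl
  let S : Set (ℂ × (Fin n → ℂ)) := {z | z.2 + z.1 • v ∈ regSet n τ}
  have hline : ∀ z : ℂ × (Fin n → ℂ),
      AnalyticAt ℂ (fun z : ℂ × (Fin n → ℂ) => z.2 + z.1 • v) z := fun z =>
    analyticAt_snd.add (analyticAt_fst.smul analyticAt_const)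
  have hfam : AhSFamily S fun z => hatExt κ F (z.2 + z.1 • v) :=
    AhSFamily.comp (hatExt_family F) (g := fun z : ℂ × (Fin n → ℂ) => z.2 + z.1 • v)
      (fun z _ => hline z) fun z hz => hz
  obtain ⟨g, hg, hgm⟩ := AhSFamily.exists_circleMean (Ω := Metric.ball (0 : Fin n → ℂ) (η / 2))
    Metric.isOpen_ball (fun z hz => hcirc z.2 hz.2 z.1 hz.1) hfam
  -- on a generic line all singularities inside the circle are removable
  have hgen : ∀ l ∈ {l : Fin n → ℂ | ∀ i j k m, i ≠ j → k ≠ m → ¬(k = i ∧ m = j) →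
      ¬(k = j ∧ m = i) → (l i - l j) * (v k - v m) ≠ (l k - l m) * (v i - v j)},
      l ∈ Metric.ball (0 : Fin n → ℂ) (η / 2) → l ∈ regSet n τ → hatExt κ F l = g l := by
    intro l hlg hlb hlr
    refine AhS_ext fun w k m x => ?_
    rw [hgm l hlb w k m x]
    have han : ∀ s : ℂ, l + s • v ∈ regSet n τ →
        AnalyticAt ℂ (fun s : ℂ => coeffAt (hatExt κ F (l + s • v)) w k m x) s := fun s hs =>
      AnalyticAt.comp (f := fun s : ℂ => l + s • v)
        ((hatExt_family F).analyticOnNhd_coeffAt w k m x _ hs)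
        (analyticAt_const.add (analyticAt_id.smul analyticAt_const))
    refine Eq.trans ?_ (circleAverage_eq_of_removable (fun s hs => ?_) ?_ fun s hs =>
      (han s (hcirc l hlb s hs)).continuousAt).symm
    · simp
    · by_cases hreg : l + s • v ∈ regSet n τ
      · exact ⟨_, han s hreg, EventuallyEq.rfl⟩
      have hex : ∃ a b, a ≠ b ∧ (l + s • v) a - (l + s • v) b ∈ (periods τ).lattice := by
        simpa [regSet] using hreg
      obtain ⟨a, b, hab, hlat⟩ := hex
      have hB := hBmem l hlb s hs
      have h0 := hRB hB a b hlat
      obtain ⟨D, hDo, hlD, Q, hQ, hQl⟩ := exists_local_extension Metric.isOpen_ball hRB hBW hF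
        (fun N hN => hgood N (hN.trans hRB)) hB hab (sub_eq_zero.mp h0) fun i j hij h h' hEq => by
          refine hlg a b i j hab hij h h' ?_
          simp only [Pi.add_apply, Pi.smul_apply, smul_eq_mul] at h0 hEq
          linear_combination (v i - v j) * h0 - (v a - v b) * hEq
      refine ⟨fun t => coeffAt (Q (l + t • v)) w k m x, AnalyticAt.comp (f := fun s : ℂ => l + s • v)
        (hQ.analyticOnNhd_coeffAt w k m x _ hlD)
        (analyticAt_const.add (analyticAt_id.smul analyticAt_const)), ?_⟩
      have hc : Continuous fun t : ℂ => l + t • v := by fun_prop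
      have hB' : ∀ᶠ t in 𝓝 s, l + t • v ∈ Metric.ball (0 : Fin n → ℂ) R :=
        hc.continuousAt.preimage_mem_nhds (Metric.isOpen_ball.mem_nhds hB)
      have hD' : ∀ᶠ t in 𝓝 s, l + t • v ∈ D :=
        hc.continuousAt.preimage_mem_nhds (hDo.mem_nhds hlD)
      have hne : ∀ᶠ t in 𝓝[≠] s, ∀ i j, i ≠ j → (l + t • v) i - (l + t • v) j ≠ 0 := by
        refine Filter.eventually_all.mpr fun i => Filter.eventually_all.mpr fun j => ?_
        by_cases hij : i = j
        · exact Eventually.of_forall fun t h => absurd hij h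
        by_cases hs0 : (l + s • v) i - (l + s • v) j = 0
        · filter_upwards [self_mem_nhdsWithin] with t ht _ h
          simp only [Pi.add_apply, Pi.smul_apply, smul_eq_mul] at h hs0
          have : (t - s) * (v i - v j) = 0 := by linear_combination h - hs0
          rcases mul_eq_zero.mp this with h' | h'
          · exact ht (sub_eq_zero.mp h')
          · exact hvne i j hij (sub_eq_zero.mp h')
        · have : ContinuousAt (fun t : ℂ => (l + t • v) i - (l + t • v) j) s := by
            simp only [Pi.add_apply, Pi.smul_apply, smul_eq_mul]
            fun_prop
          exact ((this.eventually_ne hs0).filter_mono nhdsWithin_le_nhds).mono fun t ht _ => ht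
      filter_upwards [nhdsWithin_le_nhds hB', nhdsWithin_le_nhds hD', hne] with t h1 h2 h3
      have ht : l + t • v ∈ regSet n τ := fun i j hij h => h3 i j hij (hRB h1 i j h)
      rw [hatExt_apply F ⟨_, ht⟩, hQl ⟨_, ht⟩ h2]
    · exact (han 0 (by simpa using hlr)).continuousAt
  have hO : IsOpen (Metric.ball (0 : Fin n → ℂ) (η / 2) ∩ regSet n τ) :=
    Metric.isOpen_ball.inter (isOpen_regSet n τ)
  -- generic `l` are dense
  have hEq : ∀ l : regSet n τ, l.1 ∈ Metric.ball (0 : Fin n → ℂ) (η / 2) → hat κ l F = g l.1 := by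
    intro l hl
    rw [← hatExt_apply]
    refine AhSFamily.eq_of_dense ((hatExt_family F).mono Set.inter_subset_right)
      (hg.mono Set.inter_subset_left) ?_ (fun l hl => hgen l hl.1 hl.2.1 hl.2.2) l.1 ⟨hl, l.2⟩
    exact ((dense_generic hvne).open_subset_closure_inter hO).trans
      (closure_mono fun l hl => ⟨hl.2, hl.1⟩)
  refine ⟨η / 2, half_pos hη0, v, g, hg, hEq, fun s hs => ?_, ?_, fun w => ?_⟩
  · simpa using hcirc 0 (Metric.mem_ball_self (half_pos hη0)) s hs
  · simpa using hgm 0 (Metric.mem_ball_self (half_pos hη0))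
  · have hsub : Metric.ball (0 : Fin n → ℂ) (η / 2) ⊆ nearDiagonal n τ :=
      (Metric.ball_subset_ball (by linarith)).trans hRB
    have hmem : ∀ l ∈ Metric.ball (0 : Fin n → ℂ) (η / 2),
        l ∘ w ∈ Metric.ball (0 : Fin n → ℂ) (η / 2) := fun l hl => by
      rwa [mem_ball_zero_iff, norm_comp_perm, ← mem_ball_zero_iff]
    have hO' : IsOpen (Metric.ball (0 : Fin n → ℂ) (η / 2)) := Metric.isOpen_ball
    have := AhSFamily.eq_of_dense ((AhSFamily.const hO' (single w (1 : Ah n τ))).mul hO'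
      (AhSFamily.comp hg (g := permL w) (fun l _ => (permL w).analyticAt l) hmem))
      (hg.mul hO' (AhSFamily.const hO' (single w (1 : Ah n τ))))
      (subset_closure_regSet_inter hO' hsub) (fun l hl => by
        have h1 := hEq (permReg w ⟨l, hl.1⟩) (hmem l hl.2)
        have h2 := hEq ⟨l, hl.1⟩ hl.2
        refine (congrArg (single w 1 * ·) h1.symm).trans ?_
        rw [single_mul_hat, hF, h2]) 0 (Metric.mem_ball_self (half_pos hη0))
    simpa using this

end Limit

/-! ### Limits in the quantum and classical algebras -/

section ClassicalLimit

open SkewMonoidAlgebra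

variable {n : ℕ} {τ : UpperHalfPlane} {κ : ℂ}

theorem AhSFamily.hasLimit {ρ : ℝ} (hρ : 0 < ρ) {g : (Fin n → ℂ) → AhS n τ}
    (hg : AhSFamily (Metric.ball 0 ρ) g) {f : regSet n τ → AhS n τ}
    (h : ∀ l : regSet n τ, l.1 ∈ Metric.ball (0 : Fin n → ℂ) ρ → f l = g l.1) :
    HasLimit f (g 0) := by
  intro w k m x
  have hc := (hg.analyticOnNhd_coeffAt w k m x 0 (Metric.mem_ball_self hρ)).continuousAt
  have ht : Tendsto (fun l : regSet n τ => l.1) (toZero n τ) (𝓝 0) := tendsto_comap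
  refine (hc.tendsto.comp ht).congr' ?_
  filter_upwards [ht.eventually (Metric.ball_mem_nhds 0 hρ)] with l hl
  rw [h l hl]
  rfl

theorem coeff_eta0 (a : Ah n τ) (k : Fin n →₀ ℕ) : (eta0 a).coeff k = a.coeff k 0 := by
  refine (MvPolynomial.coeff_map (R := HolH n τ) _ a k).trans ?_
  rw [Ah.coeff, PowerSeries.coeff_zero_eq_constantCoeff_apply]

theorem coeff_coeff_eta0S (a : AhS n τ) (w : Equiv.Perm (Fin n)) (k : Fin n →₀ ℕ)
    (x : regSet n τ) : (((eta0S n τ a).coeff w).coeff k).1 x = coeffAt a w k 0 x := by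
  rw [coeff_eta0S, coeff_eta0]; rfl

/-- Passing to the classical limit commutes with `λ → 0`. -/
theorem HasLimit.eta0S {F : regSet n τ → AhS n τ} {a : AhS n τ} (h : HasLimit F a) :
    HasLimitC (fun l => eta0S n τ (F l)) (eta0S n τ a) := by
  intro w k x
  simp only [coeff_coeff_eta0S]
  exact h w k 0 x

theorem eta0S_hat (F : A0 n τ) (l : regSet n τ) :
    eta0S n τ (hat κ l F) = subst (ellDunklC κ l) (F.evalAt l) := by
  rw [hat_apply, map_subst (eta0S n τ) eta0S_smul]
  simp only [eta0S_ellDunkl]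

theorem limC_eq {F : regSet n τ → A0S n τ} {a : A0S n τ} (h : HasLimitC F a) : limC F = a := by
  have h' : ∃ a, HasLimitC F a := ⟨a, h⟩
  rw [limC, dif_pos h']
  exact h'.choose_spec.unique h

theorem limQ_eq {F : regSet n τ → AhS n τ} {a : AhS n τ} (h : HasLimit F a) : limQ F = a := by
  have h' : ∃ a, HasLimit F a := ⟨a, h⟩
  rw [limQ, dif_pos h']
  exact h'.choose_spec.unique h

/-- The rational Hamiltonian of a symmetric polynomial is symmetric. -/
theorem smul_ratHam {q : MvPolynomial (Fin n) ℂ}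
    (hq : ∀ w : Equiv.Perm (Fin n), MvPolynomial.rename w q = q) (w : Equiv.Perm (Fin n)) :
    w • ratHam τ κ q = ratHam τ κ q := by
  refine smul_res_eq_of_commute ?_
  have := subst_intertwine (ratDunkl_commute (τ := τ) κ) (ratDunkl_commute κ)
    (single_mul_ratDunkl κ w) q
  rwa [hq w] at this

theorem smul_res_eta0S {a : AhS n τ} {w : Equiv.Perm (Fin n)}
    (h : single w 1 * a = a * single w 1) : w • res (eta0S n τ a) = res (eta0S n τ a) := by
  refine smul_res_eq_of_commute ?_
  have := congrArg (eta0S n τ) h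
  rwa [map_mul, map_mul, eta0S_single,
    show eta0 (1 : Ah n τ) = 1 from map_one (eta0Hom n τ)] at this

end ClassicalLimit

/-! ### Mean values and the action on functions of the spectral parameter -/

section CircleMean

open SkewMonoidAlgebra

variable {n : ℕ} {τ : UpperHalfPlane} {κ : ℂ}

theorem Ah.coeff_add (a b : Ah n τ) (k : Fin n →₀ ℕ) (m : ℕ) :
    (a + b).coeff k m = a.coeff k m + b.coeff k m :=
  (congrArg (PowerSeries.coeff m) (MvPolynomial.coeff_add (R := HolH n τ) k a b)).trans
    (map_add (PowerSeries.coeff m) _ _)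

theorem coeffAt_add (a b : AhS n τ) (w : Equiv.Perm (Fin n)) (k : Fin n →₀ ℕ) (m : ℕ)
    (x : regSet n τ) : coeffAt (a + b) w k m x = coeffAt a w k m x + coeffAt b w k m x := by
  rw [coeffAt, SkewMonoidAlgebra.coeff_add, Finsupp.add_apply, Ah.coeff_add]
  rfl

theorem coeffAt_sum_smul {ι : Type*} (s : Finset ι) (c : ι → ℂ) (b : ι → AhS n τ)
    (w : Equiv.Perm (Fin n)) (k : Fin n →₀ ℕ) (m : ℕ) (x : regSet n τ) :
    coeffAt (∑ i ∈ s, c i • b i) w k m x = ∑ i ∈ s, c i * coeffAt (b i) w k m x := by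
  classical
  induction s using Finset.induction_on with
  | empty => rw [Finset.sum_empty, Finset.sum_empty]; rfl
  | insert i s hi ih =>
    rw [Finset.sum_insert hi, Finset.sum_insert hi, ← ih, coeffAt_add]
    rfl

theorem isCircleMean_sum_smul {ι : Type*} (s : Finset ι) {c : ι → ℂ → ℂ}
    (hc : ∀ i ∈ s, CircleIntegrable (c i) 0 1) (b : ι → AhS n τ) :
    IsCircleMean (fun z => ∑ i ∈ s, c i z • b i)
      (∑ i ∈ s, Real.circleAverage (c i) 0 1 • b i) := by
  intro w k m x
  simp only [coeffAt_sum_smul]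
  rw [Real.circleAverage_fun_sum]
  · refine Finset.sum_congr rfl fun i hi => ?_
    simp only [mul_comm _ (coeffAt (b i) w k m x)]
    exact (Real.circleAverage_fun_smul (a := coeffAt (b i) w k m x) (f := c i)).symm
  · intro i hi
    simp only [mul_comm _ (coeffAt (b i) w k m x)]
    exact (hc i hi).const_fun_smul (a := coeffAt (b i) w k m x)

theorem actFun_eq_sum {h : A0S n τ} {l : regSet n τ} {T : Finset (Fin n →₀ ℕ)}
    (hT : ∀ w, ∀ k ∉ T, ((h.coeff w).coeff k).1 l = 0) (G : regSet n τ → AhS n τ) :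
    actFun κ h G l = ∑ p ∈ Finset.univ ×ˢ T, ((h.coeff p.1).coeff p.2).1 l •
      (substEll κ l (MvPolynomial.monomial p.2 1) * (single p.1 1 * G (permReg p.1 l))) := by
  rw [Finset.sum_product, actFun]
  refine Finset.sum_congr rfl fun w _ => ?_
  rw [hat_eq_sum _ l (hT w), Finset.sum_mul]
  simp only [smul_mul_assoc]

/-- The action on functions of the spectral parameter commutes with mean values. -/
theorem actFun_isCircleMean {f : ℂ → AhS n τ} {S : Set ℂ} (hS : Metric.sphere (0 : ℂ) 1 ⊆ S)
    (hf : AhSFamily S f) {a : AhS n τ} (ha : IsCircleMean f a) (G : regSet n τ → AhS n τ)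
    (l : regSet n τ) : IsCircleMean (fun s => actFun κ (eta0S n τ (f s)) G l)
      (actFun κ (eta0S n τ a) G l) := by
  classical
  obtain ⟨T, hT⟩ := hf.exists_support
  let T' : Finset (Fin n →₀ ℕ) := Finset.univ.biUnion T
  have hT' : ∀ w, ∀ k ∉ T', ∀ s ∈ S, coeffAt (f s) w k 0 l = 0 := fun w k hk s hs =>
    hT w k (fun h => hk (Finset.mem_biUnion.mpr ⟨w, Finset.mem_univ w, h⟩)) 0 s hs l
  have hc : ∀ w k, CircleIntegrable (fun s => coeffAt (f s) w k 0 l) 0 1 := fun w k =>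
    ContinuousOn.circleIntegrable zero_le_one fun s hs =>
      (hf.analyticOnNhd_coeffAt w k 0 l s (hS hs)).continuousAt.continuousWithinAt
  have h := isCircleMean_sum_smul (Finset.univ ×ˢ T')
    (c := fun p s => coeffAt (f s) p.1 p.2 0 l) (fun p _ => hc p.1 p.2) fun p =>
      substEll κ l (MvPolynomial.monomial p.2 1) * (single p.1 1 * G (permReg p.1 l))
  intro w k m x
  rw [actFun_eq_sum (T := T') (h := eta0S n τ a)]
  · simp only [coeff_coeff_eta0S, ha _ _ _ l]
    rw [h w k m x]
    refine Real.circleAverage_congr_sphere fun s hs => ?_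
    rw [abs_one] at hs
    simp only
    rw [actFun_eq_sum (T := T') (h := eta0S n τ (f s))]
    · simp only [coeff_coeff_eta0S]
    · intro w k hk
      rw [coeff_coeff_eta0S, hT' w k hk s (hS hs)]
  · intro w k hk
    rw [coeff_coeff_eta0S, ha w k 0 l]
    refine (Real.circleAverage_congr_sphere (f₂ := fun _ => 0) fun s hs => ?_).trans
      (Real.circleAverage_const _ _ _)
    rw [abs_one] at hs
    exact hT' w k hk s (hS hs)

/-- On equivariant functions, multiplication by `Res(h)(λ, y(λ))` is the action of `h`. -/
theorem mulPreservesAnalytic_res {N : Set (Fin n → ℂ)} {h : A0S n τ}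
    (hh : PreservesAnalytic κ (Set.univ : Set ℂ) N fun _ => h) :
    MulPreservesAnalytic κ N (res h) := by
  intro G hG hGW
  obtain ⟨G', hG', H⟩ := hh (fun z => G z.2)
    (AhSFamily.comp hG (g := Prod.snd) (fun z _ => analyticAt_snd) fun z hz => hz.2)
  refine ⟨fun l => G' (0, l), AhSFamily.comp hG' (g := fun l => (0, l))
    (fun z _ => analyticAt_const.prod analyticAt_id) fun l hl => ⟨trivial, hl⟩, fun l hl => ?_⟩
  refine Eq.trans ?_ (H 0 trivial l hl)
  exact (actFun_of_equivariant κ h (G := fun l => G l.1) fun w => hGW w l.1 hl).symm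

/-- A circle mean of elements whose action preserves analyticity has the same property, on
equivariant functions. -/
theorem mulPreservesAnalytic_res_of_circleMean {N : Set (Fin n → ℂ)} (hN : IsOpen N)
    {f : ℂ → AhS n τ} {S : Set ℂ} (hS : Metric.sphere (0 : ℂ) 1 ⊆ S)
    (hf : AhSFamily S f) {a : AhS n τ} (ha : IsCircleMean f a)
    (hp : PreservesAnalytic κ S N fun s => eta0S n τ (f s)) :
    MulPreservesAnalytic κ N (res (eta0S n τ a)) := by
  intro G hG hGW
  obtain ⟨G', hG', H⟩ := hp (fun z => G z.2)
    (AhSFamily.comp hG (g := Prod.snd) (fun z _ => analyticAt_snd) fun z hz => hz.2)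
  obtain ⟨G'', hG'', H''⟩ := AhSFamily.exists_circleMean hN (Set.prod_mono_left hS) hG'
  refine ⟨G'', hG'', fun l hl => ?_⟩
  rw [← actFun_of_equivariant κ (eta0S n τ a) (G := fun l => G l.1) fun w => hGW w l.1 hl]
  refine AhS_ext fun w k m x => ?_
  rw [H'' l.1 hl w k m x, actFun_isCircleMean hS hf ha _ l w k m x]
  refine Real.circleAverage_congr_sphere fun s hs => ?_
  rw [abs_one] at hs
  exact congrArg (coeffAt · w k m x) (H s (hS hs) l hl)

/-- The classical limit of `F(ν, y(ν))` is a polynomial in the classical elliptic Dunkl operators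
with spectral parameter `ν`, so its action preserves analyticity; here `ν = s v`. -/
theorem preservesAnalytic_eta0S_hatExt {N : Set (Fin n → ℂ)} (hN : IsOpen N)
    (hN0 : N ⊆ nearDiagonal n τ) (hW : ∀ (w : Equiv.Perm (Fin n)), ∀ l ∈ N, l ∘ w ∈ N)
    (F : A0 n τ) (v : Fin n → ℂ) :
    PreservesAnalytic κ {s : ℂ | s • v ∈ regSet n τ} N fun s => eta0S n τ (hatExt κ F (s • v)) := by
  classical
  set S := {s : ℂ | s • v ∈ regSet n τ} with hSdef
  have hS : IsOpen S := (isOpen_regSet n τ).preimage (continuous_id.smul continuous_const)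
  rcases S.eq_empty_or_nonempty with hSe | ⟨s₀, hs₀⟩
  · rw [hSe]
    exact fun G hG => ⟨G, hG, fun e he => he.elim⟩
  -- `s v` as a regular point; its values outside `S` do not matter
  let ν : ℂ → regSet n τ := fun s => if h : s • v ∈ regSet n τ then ⟨s • v, h⟩ else ⟨s₀ • v, hs₀⟩
  have hν : ∀ s, ∀ h : s ∈ S, ν s = ⟨s • v, h⟩ := fun s h => dif_pos h
  have hline : ∀ s : ℂ, AnalyticAt ℂ (fun s : ℂ => s • v) s := fun s =>
    analyticAt_id.smul analyticAt_const
  have hνa : AnalyticOnNhd ℂ (fun s => (ν s).1) S := fun s hs => by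
    refine (hline s).congr ?_
    filter_upwards [hS.mem_nhds hs] with t ht
    rw [hν t ht]
  refine (PreservesAnalytic.subst hS hN hW
    (fun i => preservesAnalytic_ellDunklC (κ := κ) hS hN hN0 hW hνa i)
    (f := fun s => F.evalAt (ν s)) (MvPolynomial.support (R := Hol n τ) F) (fun s hs => ?_)
    fun k s hs => ?_).congr fun s hs => ?_
  · exact MvPolynomial.support_map_subset (R := Hol n τ) _ F
  · have h1 := AnalyticAt.comp (f := fun s : ℂ => s • v) ((F.coeff k).2 _ hs) (hline s)
    refine h1.congr ?_
    filter_upwards [hS.mem_nhds hs] with t ht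
    rw [coeff_evalAt, hν t ht]
    exact extZero_apply (F.coeff k).1 ⟨t • v, ht⟩
  · rw [← eta0S_hat, hν s hs, ← hatExt_apply]

end CircleMean

/-! ### Existence of the limits -/

section Existence

open SkewMonoidAlgebra

variable {n : ℕ} {τ : UpperHalfPlane} {κ : ℂ}

/-- The limit that defines the elliptic Hamiltonian exists. It is obtained from the limit `a` of
`F(λ, y(λ))` with `F` the rational Hamiltonian and quantum operators `y_i(λ)`, by passing to the
classical limit. The elliptic Hamiltonian is symmetric, and multiplication by its value at
`(λ, y(λ))` preserves analyticity, because it is a circle mean of residues of polynomials in Dunkl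
operators. -/
theorem exists_hasLimitC_ellFamily {q : MvPolynomial (Fin n) ℂ}
    (hq : ∀ w : Equiv.Perm (Fin n), MvPolynomial.rename w q = q) :
    ∃ a : AhS n τ, HasLimit (fun l => hat κ l (ratHam τ κ q)) a ∧
      HasLimitC (ellFamily τ κ q) (eta0S n τ a) ∧
      (∀ w : Equiv.Perm (Fin n), w • ellHam τ κ q = ellHam τ κ q) ∧
      ∀ N ⊆ nearDiagonal n τ, IsOpen N →
        (∀ (w : Equiv.Perm (Fin n)), ∀ l ∈ N, l ∘ w ∈ N) →
        MulPreservesAnalytic κ N (ellHam τ κ q) := by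
  obtain ⟨ρ, hρ, v, g, hg, hgl, hv, hmean, hcomm⟩ :=
    exists_extension_at_zero (κ := κ) (F := ratHam τ κ q) (smul_ratHam hq)
      fun N hN0 hN hW => mulPreservesAnalytic_res
        (PreservesAnalytic.subst isOpen_univ hN hW
          (fun i => preservesAnalytic_ratDunkl isOpen_univ hN hN0 hW i) q.support
          (fun _ _ => subset_rfl) fun _ => analyticOnNhd_const)
  have hlim := hg.hasLimit hρ hgl
  have hlimC : HasLimitC (ellFamily τ κ q) (eta0S n τ (g 0)) := by
    have := hlim.eta0S
    simp only [eta0S_hat] at this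
    exact this
  have hell : ellHam τ κ q = res (eta0S n τ (g 0)) := by rw [ellHam, limC_eq hlimC]
  refine ⟨g 0, hlim, hlimC, fun w => ?_, fun N hN0 hN hW => ?_⟩
  · rw [hell, smul_res_eta0S (hcomm w)]
  · rw [hell]
    refine mulPreservesAnalytic_res_of_circleMean hN (S := {s : ℂ | s • v ∈ regSet n τ}) hv ?_ hmean
      (preservesAnalytic_eta0S_hatExt hN hN0 hW _ v)
    exact AhSFamily.comp (hatExt_family _) (g := fun s : ℂ => s • v)
      (fun s _ => analyticAt_id.smul analyticAt_const) fun s hs => hs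

/-- The limit that defines the quantum Hamiltonian exists and commutes with permutations. -/
theorem exists_hasLimit_quantFamily {q : MvPolynomial (Fin n) ℂ}
    (hq : ∀ w : Equiv.Perm (Fin n), MvPolynomial.rename w q = q) :
    ∃ b : AhS n τ, HasLimit (quantFamily τ κ q) b ∧
      ∀ w : Equiv.Perm (Fin n), single w 1 * b = b * single w 1 := by
  obtain ⟨a, -, -, hW, hgood⟩ := exists_hasLimitC_ellFamily (τ := τ) (κ := κ) hq
  obtain ⟨ρ, hρ, v, g, hg, hgl, -, -, hcomm⟩ :=
    exists_extension_at_zero (κ := κ) (F := ellHam τ κ q) hW hgood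
  refine ⟨g 0, ?_, hcomm⟩
  have := hg.hasLimit hρ hgl
  simp only [hat_apply] at this
  exact this

end Existence

/-! ### Translation of the positions by periods -/

section Translation

open SkewMonoidAlgebra

variable {n : ℕ} {τ : UpperHalfPlane} {κ : ℂ}

theorem coeff_mul_eq_sum {R : Type*} [Ring R] [MulSemiringAction (Equiv.Perm (Fin n)) R]
    (a b : SkewMonoidAlgebra R (Equiv.Perm (Fin n))) (w : Equiv.Perm (Fin n)) :
    (a * b).coeff w = ∑ v, a.coeff v * v • b.coeff (v⁻¹ * w) := by
  rw [coeff_mul_left, sum_def]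
  exact Finsupp.sum_fintype _ _ fun v => zero_mul _

/-- An `S_n`-stable set of vectors `u` such that translation by `u` changes the differences
`x_i - x_j` by `0` or `±1`. -/
def quasiPeriods (n : ℕ) : Set (Fin n → ℂ) :=
  {u | ∀ i j, u i - u j = 0 ∨ u i - u j = 1 ∨ u i - u j = -1}

theorem comp_mem_quasiPeriods (w : Equiv.Perm (Fin n)) {u : Fin n → ℂ} (hu : u ∈ quasiPeriods n) :
    u ∘ w ∈ quasiPeriods n := fun i j => hu (w i) (w j)

theorem neg_mem_quasiPeriods {u : Fin n → ℂ} (hu : u ∈ quasiPeriods n) :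
    -u ∈ quasiPeriods n := fun i j => by
  have h : (-u) i - (-u) j = u j - u i := by simp only [Pi.neg_apply]; ring
  rw [h]
  exact hu j i

theorem add_mem_regSet {u : Fin n → ℂ} (hu : u ∈ quasiPeriods n) {x : Fin n → ℂ}
    (hx : x ∈ regSet n τ) : x + u ∈ regSet n τ := by
  intro i j hij h
  have h1 : (1 : ℂ) ∈ (periods τ).lattice := (periods τ).ω₁_mem_lattice
  have hu' : u i - u j ∈ (periods τ).lattice := by
    rcases hu i j with h | h | h <;> rw [h]
    · exact zero_mem _
    · exact h1
    · exact neg_mem h1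
  refine hx i j hij ?_
  have := sub_mem h hu'
  rwa [show (x + u) i - (x + u) j - (u i - u j) = x i - x j by
    simp only [Pi.add_apply]; ring] at this

/-- The regular point `x + u`. -/
def addReg {u : Fin n → ℂ} (hu : u ∈ quasiPeriods n) (x : regSet n τ) : regSet n τ :=
  ⟨x.1 + u, add_mem_regSet hu x.2⟩

/-- The factor `exp(-η ∑_i (u_i - u_{w(i)}) λ_i)`. -/
noncomputable def multiplier (η : ℂ) (l u : Fin n → ℂ) (w : Equiv.Perm (Fin n)) : ℂ :=
  Complex.exp (-η * ∑ i, (u i - u (w i)) * l i)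

theorem multiplier_one (η : ℂ) (l u : Fin n → ℂ) : multiplier η l u 1 = 1 := by
  simp [multiplier]

/-- The cocycle property, which makes the quasi-periodic elements a ring. -/
theorem multiplier_mul (η : ℂ) (l u : Fin n → ℂ) (v w : Equiv.Perm (Fin n)) :
    multiplier η l u (v * w) = multiplier η l u v * multiplier η l (u ∘ v) w := by
  rw [multiplier, multiplier, multiplier, ← Complex.exp_add, ← mul_add, ← Finset.sum_add_distrib]
  congr 2
  refine Finset.sum_congr rfl fun i _ => ?_
  simp only [Equiv.Perm.mul_apply, Function.comp_apply]
  ring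

theorem evalAt_zero (x : regSet n τ) : (0 : A0 n τ).evalAt x = 0 := map_zero (evalAtHom x)

theorem evalAt_one (x : regSet n τ) : (1 : A0 n τ).evalAt x = 1 := map_one (evalAtHom x)

theorem evalAt_add (F G : A0 n τ) (x : regSet n τ) :
    (F + G).evalAt x = F.evalAt x + G.evalAt x := map_add (evalAtHom x) F G

theorem evalAt_neg (F : A0 n τ) (x : regSet n τ) : (-F).evalAt x = -F.evalAt x :=
  map_neg (evalAtHom x) F

theorem evalAt_mul (F G : A0 n τ) (x : regSet n τ) :
    (F * G).evalAt x = F.evalAt x * G.evalAt x := map_mul (evalAtHom x) F G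

theorem evalAt_sum {ι : Type*} (s : Finset ι) (F : ι → A0 n τ) (x : regSet n τ) :
    (∑ i ∈ s, F i).evalAt x = ∑ i ∈ s, (F i).evalAt x := map_sum (evalAtHom x) F s

/-- The elements of `A_0 * S_n` whose coefficient at `w` is multiplied by `multiplier η λ u w` under
the translation by `u`. -/
def quasiPeriodicSubring (n : ℕ) (τ : UpperHalfPlane) (η : ℂ) (l : Fin n → ℂ) :
    Subring (A0S n τ) where
  carrier := {a | ∀ w u, ∀ hu : u ∈ quasiPeriods n, ∀ x : regSet n τ,
    (a.coeff w).evalAt (addReg hu x) = multiplier η l u w • (a.coeff w).evalAt x}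
  zero_mem' w u hu x := by
    rw [show (0 : A0S n τ).coeff w = 0 from rfl, evalAt_zero, evalAt_zero, smul_zero]
  one_mem' w u hu x := by
    rw [one_def, coeff_single_apply]
    split_ifs with h
    · rw [← h, evalAt_one, evalAt_one, multiplier_one, one_smul]
    · rw [evalAt_zero, evalAt_zero, smul_zero]
  add_mem' {a b} ha hb w u hu x := by
    rw [SkewMonoidAlgebra.coeff_add, Finsupp.add_apply, evalAt_add, evalAt_add, ha w u hu,
      hb w u hu, smul_add]
  neg_mem' {a} ha w u hu x := by
    rw [show (-a).coeff w = -a.coeff w from rfl, evalAt_neg, evalAt_neg, ha w u hu, smul_neg]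
  mul_mem' {a b} ha hb w u hu x := by
    rw [coeff_mul_eq_sum, evalAt_sum, evalAt_sum, Finset.smul_sum]
    refine Finset.sum_congr rfl fun v _ => ?_
    have h : permReg v (addReg hu x) = addReg (comp_mem_quasiPeriods v hu) (permReg v x) := rfl
    rw [evalAt_mul, evalAt_mul, evalAt_smul, evalAt_smul, h, ha v u hu, hb _ _ _, map_smul,
      smul_mul_smul_comm, ← multiplier_mul, mul_inv_cancel_left]

theorem smul_mem_quasiPeriodicSubring {η : ℂ} {l : Fin n → ℂ} (c : ℂ) {a : A0S n τ}
    (ha : a ∈ quasiPeriodicSubring n τ η l) : c • a ∈ quasiPeriodicSubring n τ η l := by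
  intro w u hu x
  rw [SkewMonoidAlgebra.coeff_smul, Finsupp.smul_apply, evalAt_smul_complex, evalAt_smul_complex,
    ha w u hu, smul_comm]

theorem single_mem_quasiPeriodicSubring {η : ℂ} {l : Fin n → ℂ} {w : Equiv.Perm (Fin n)} {F : A0 n τ}
    (h : ∀ u, ∀ hu : u ∈ quasiPeriods n, ∀ x : regSet n τ,
      F.evalAt (addReg hu x) = multiplier η l u w • F.evalAt x) :
    single w F ∈ quasiPeriodicSubring n τ η l := by
  intro v u hu x
  rw [coeff_single_apply]
  split_ifs with hvw
  · rw [← hvw, h u hu]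
  · rw [evalAt_zero, evalAt_zero, smul_zero]

theorem multiplier_swap (η : ℂ) (l u : Fin n → ℂ) {i j : Fin n} (hij : i ≠ j) :
    multiplier η l u (Equiv.swap i j) = Complex.exp (-η * ((u i - u j) * (l i - l j))) := by
  rw [multiplier, Finset.sum_eq_add i j hij]
  · rw [Equiv.swap_apply_left, Equiv.swap_apply_right]
    congr 2
    ring
  · intro k _ hk
    rw [Equiv.swap_apply_of_ne_of_ne hk.1 hk.2, sub_self, zero_mul]
  · simp
  · simp

theorem ellDunklC_mem_quasiPeriodicSubring {η : ℂ}
    (hη : ∀ μ z, phi τ μ (z + 1) = Complex.exp (-η * μ) * phi τ μ z) (l : regSet n τ) (i : Fin n) :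
    ellDunklC κ l i ∈ quasiPeriodicSubring n τ η l.1 := by
  refine sub_mem (single_mem_quasiPeriodicSubring fun u hu x => ?_)
    (smul_mem_quasiPeriodicSubring κ (sum_mem fun j _ =>
      single_mem_quasiPeriodicSubring fun u hu x => ?_))
  · rw [evalAt_p, evalAt_p, multiplier_one, one_smul]
  · rw [evalAt_ofHol, evalAt_ofHol, multiplier_swap _ _ _ j.2.symm, MvPolynomial.smul_eq_C_mul,
      ← MvPolynomial.C_mul]
    congr 1
    change phi τ _ ((x.1 + u) i - (x.1 + u) j.1) = _ * phi τ _ (x.1 i - x.1 j.1)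
    have h : (x.1 + u) i - (x.1 + u) j.1 = x.1 i - x.1 j.1 + (u i - u j.1) := by
      simp only [Pi.add_apply]; ring
    rw [h]
    rcases hu i j.1 with h | h | h <;> rw [h]
    · simp
    · rw [hη, one_mul]
    · have := hη (l.1 i - l.1 j.1) (x.1 i - x.1 j.1 + -1)
      rw [neg_add_cancel_right] at this
      rw [this, ← mul_assoc, ← Complex.exp_add, show -η * (-1 * (l.1 i - l.1 j.1))
        + -η * (l.1 i - l.1 j.1) = 0 by ring, Complex.exp_zero, one_mul]

theorem subst_mem_quasiPeriodicSubring {η : ℂ} {l : Fin n → ℂ} {y : Fin n → A0S n τ}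
    (hy : ∀ i, y i ∈ quasiPeriodicSubring n τ η l) (f : MvPolynomial (Fin n) ℂ) :
    subst y f ∈ quasiPeriodicSubring n τ η l := by
  refine sum_mem fun k _ => smul_mem_quasiPeriodicSubring _ (list_prod_mem fun a ha => ?_)
  obtain ⟨i, rfl⟩ := (List.mem_ofFn' _ _).mp ha
  exact pow_mem (hy i) _

/-- As `λ → 0` the multipliers tend to `1`, so the limit is periodic. -/
theorem evalAt_addReg_of_hasLimitC {η : ℂ} {F : regSet n τ → A0S n τ} {a : A0S n τ}
    (ha : HasLimitC F a) (hF : ∀ l, F l ∈ quasiPeriodicSubring n τ η l.1) (w : Equiv.Perm (Fin n))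
    {u : Fin n → ℂ} (hu : u ∈ quasiPeriods n) (x : regSet n τ) :
    (a.coeff w).evalAt (addReg hu x) = (a.coeff w).evalAt x := by
  refine MvPolynomial.ext _ _ fun k => ?_
  rw [coeff_evalAt, coeff_evalAt]
  refine tendsto_nhds_unique (ha w k (addReg hu x)) ?_
  have hm : Tendsto (fun l : regSet n τ => multiplier η l.1 u w) (toZero n τ) (𝓝 1) := by
    have hc : Continuous fun l : Fin n → ℂ => multiplier η l u w := by
      unfold multiplier; fun_prop
    have h0 : multiplier η 0 u w = 1 := by simp [multiplier]
    exact h0 ▸ (hc.tendsto 0).comp tendsto_comap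
  have := hm.mul (ha w k x)
  rw [one_mul] at this
  refine this.congr fun l => ?_
  have h := congrArg (MvPolynomial.coeff k) (hF l w u hu x)
  rw [MvPolynomial.coeff_smul, coeff_evalAt, coeff_evalAt] at h
  exact h.symm

end Translation

/-! ### Translation of the momenta -/

section MomentumShift

open SkewMonoidAlgebra

variable {n : ℕ} {τ : UpperHalfPlane} {κ : ℂ}

/-- The derivation `∑_i ∂/∂X_i`. -/
noncomputable def sumPderiv (n : ℕ) (R : Type*) [CommRing R] :
    Derivation R (MvPolynomial (Fin n) R) (MvPolynomial (Fin n) R) :=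
  MvPolynomial.mkDerivation R fun _ => 1

theorem sumPderiv_X {R : Type*} [CommRing R] (i : Fin n) :
    sumPderiv n R (MvPolynomial.X i) = 1 := MvPolynomial.mkDerivation_X _ _ _

theorem sumPderiv_C {R : Type*} [CommRing R] (c : R) :
    sumPderiv n R (MvPolynomial.C c) = 0 := MvPolynomial.derivation_C _ _

theorem sumPderiv_eq {R : Type*} [CommRing R] (f : MvPolynomial (Fin n) R) :
    sumPderiv n R f = ∑ i, MvPolynomial.pderiv i f := by
  induction f using MvPolynomial.induction_on with
  | C c => simp
  | add p q hp hq => simp only [map_add, hp, hq, Finset.sum_add_distrib]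
  | mul_X p i hp =>
    classical
    simp only [Derivation.leibniz, hp, sumPderiv_X, MvPolynomial.pderiv_X, smul_eq_mul,
      Finset.sum_add_distrib, Finset.mul_sum]
    simp [Pi.single_apply]

theorem sumPderiv_map {R S : Type*} [CommRing R] [CommRing S] (φ : R →+* S)
    (f : MvPolynomial (Fin n) R) :
    sumPderiv n S (MvPolynomial.map φ f) = MvPolynomial.map φ (sumPderiv n R f) := by
  simp only [sumPderiv_eq, MvPolynomial.pderiv_map, _root_.map_sum]

theorem sumPderiv_rename {R : Type*} [CommRing R] (w : Equiv.Perm (Fin n))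
    (f : MvPolynomial (Fin n) R) :
    sumPderiv n R (MvPolynomial.rename w f) = MvPolynomial.rename w (sumPderiv n R f) := by
  induction f using MvPolynomial.induction_on with
  | C c => rw [MvPolynomial.rename_C, sumPderiv_C, map_zero]
  | add p q hp hq => simp only [map_add, hp, hq]
  | mul_X p i hp =>
    simp only [Derivation.leibniz, map_mul, map_add, hp, sumPderiv_X, MvPolynomial.rename_X,
      smul_eq_mul, map_one]

/-- `∑_i ∂/∂p_i` on `A_0`. -/
noncomputable def A0.der (F : A0 n τ) : A0 n τ := sumPderiv n (Hol n τ) F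

theorem A0.der_zero : A0.der (0 : A0 n τ) = 0 := map_zero (sumPderiv n (Hol n τ))

theorem A0.der_one : A0.der (1 : A0 n τ) = 0 := Derivation.map_one_eq_zero (sumPderiv n (Hol n τ))

theorem A0.der_add (F G : A0 n τ) : (F + G).der = F.der + G.der :=
  map_add (sumPderiv n (Hol n τ)) F G

theorem A0.der_mul (F G : A0 n τ) : (F * G).der = F.der * G + F * G.der := by
  have key : ∀ F G : MvPolynomial (Fin n) (Hol n τ), sumPderiv n (Hol n τ) (F * G)
      = sumPderiv n (Hol n τ) F * G + F * sumPderiv n (Hol n τ) G := by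
    intro F G
    rw [Derivation.leibniz, smul_eq_mul, smul_eq_mul, add_comm, mul_comm G]
  exact key F G

theorem A0.der_sum {ι : Type*} (s : Finset ι) (F : ι → A0 n τ) :
    (∑ i ∈ s, F i).der = ∑ i ∈ s, (F i).der :=
  _root_.map_sum (AddMonoidHom.mk' A0.der A0.der_add) F s

theorem A0.der_perm (w : Equiv.Perm (Fin n)) (F : A0 n τ) : (w • F).der = w • F.der := by
  refine (sumPderiv_rename w _).trans (congrArg (MvPolynomial.rename w) (sumPderiv_map _ _))

theorem A0.der_smul (c : ℂ) (F : A0 n τ) : (c • F).der = c • F.der :=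
  Derivation.map_smul_of_tower (sumPderiv n (Hol n τ)) c F

theorem A0.der_p (i : Fin n) : (A0.p i : A0 n τ).der = 1 := sumPderiv_X i

theorem A0.der_ofHol (f : Hol n τ) : (A0.ofHol f).der = 0 := sumPderiv_C f

theorem evalAt_der (F : A0 n τ) (x : regSet n τ) :
    F.der.evalAt x = sumPderiv n ℂ (F.evalAt x) := (sumPderiv_map (Hol.eval x) F).symm

/-- `∑_i ∂/∂p_i` on the coefficients of elements of `A_0 * S_n`. -/
noncomputable def A0S.der (a : A0S n τ) : A0S n τ := ∑ w, single w (a.coeff w).der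

theorem A0S.coeff_der (a : A0S n τ) (w : Equiv.Perm (Fin n)) :
    (A0S.der a).coeff w = (a.coeff w).der := by
  classical
  have h : ∀ s : Finset (Equiv.Perm (Fin n)),
      (∑ v ∈ s, single v (a.coeff v).der : A0S n τ).coeff w
        = ∑ v ∈ s, (single v (a.coeff v).der : A0S n τ).coeff w := by
    intro s
    induction s using Finset.induction_on with
    | empty => rfl
    | insert v s hv ih =>
      rw [Finset.sum_insert hv, Finset.sum_insert hv, ← ih, SkewMonoidAlgebra.coeff_add,
        Finsupp.add_apply]
  rw [A0S.der, h, Finset.sum_eq_single w]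
  · rw [coeff_single_apply, if_pos rfl]
  · intro v _ hv
    rw [coeff_single_apply, if_neg hv]
  · simp

theorem A0S.der_add (a b : A0S n τ) : A0S.der (a + b) = A0S.der a + A0S.der b := by
  refine SkewMonoidAlgebra.ext fun w => ?_
  rw [A0S.coeff_der, SkewMonoidAlgebra.coeff_add, Finsupp.add_apply, A0.der_add,
    SkewMonoidAlgebra.coeff_add, Finsupp.add_apply, A0S.coeff_der, A0S.coeff_der]

theorem A0S.der_smul (c : ℂ) (a : A0S n τ) : A0S.der (c • a) = c • A0S.der a := by
  refine SkewMonoidAlgebra.ext fun w => ?_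
  rw [A0S.coeff_der, SkewMonoidAlgebra.coeff_smul, Finsupp.smul_apply, A0.der_smul,
    SkewMonoidAlgebra.coeff_smul, Finsupp.smul_apply, A0S.coeff_der]

theorem A0S.der_mul (a b : A0S n τ) : A0S.der (a * b) = A0S.der a * b + a * A0S.der b := by
  refine SkewMonoidAlgebra.ext fun w => ?_
  rw [A0S.coeff_der, coeff_mul_eq_sum, A0.der_sum, SkewMonoidAlgebra.coeff_add, Finsupp.add_apply,
    coeff_mul_eq_sum, coeff_mul_eq_sum, ← Finset.sum_add_distrib]
  simp only [A0S.coeff_der, A0.der_mul, A0.der_perm]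

theorem A0S.der_single (w : Equiv.Perm (Fin n)) (F : A0 n τ) :
    A0S.der (single w F) = single w F.der := by
  refine SkewMonoidAlgebra.ext fun v => ?_
  rw [A0S.coeff_der, coeff_single_apply, coeff_single_apply]
  split_ifs
  · rfl
  · exact A0.der_zero

theorem A0S.der_sum {ι : Type*} (s : Finset ι) (a : ι → A0S n τ) :
    A0S.der (∑ i ∈ s, a i) = ∑ i ∈ s, A0S.der (a i) :=
  _root_.map_sum (AddMonoidHom.mk' A0S.der A0S.der_add) a s

/-- The Dunkl operators satisfy `(∑_j ∂/∂p_j) y_i = 1`, so differentiation can be done before the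
substitution. -/
theorem A0S.der_subst {y : Fin n → A0S n τ} (hy : ∀ i j, Commute (y i) (y j))
    (hy1 : ∀ i, A0S.der (y i) = 1) (f : MvPolynomial (Fin n) ℂ) :
    A0S.der (subst y f) = subst y (sumPderiv n ℂ f) := by
  obtain ⟨φ, hφ, hX, hc⟩ := exists_ringHom_eq_subst y hy
  rw [← hφ, ← hφ]
  induction f using MvPolynomial.induction_on with
  | C c =>
    have e : (MvPolynomial.C c : MvPolynomial (Fin n) ℂ) = c • 1 := by
      rw [MvPolynomial.smul_eq_C_mul, mul_one]
    rw [sumPderiv_C, e, hc, A0S.der_smul, map_one, map_zero, one_def, A0S.der_single, A0.der_one,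
      single_zero, smul_zero]
  | add p q hp hq => rw [map_add, A0S.der_add, hp, hq, map_add, map_add]
  | mul_X p i hp =>
    rw [map_mul, A0S.der_mul, hp, hX, hy1, mul_one, Derivation.leibniz, sumPderiv_X, smul_eq_mul,
      smul_eq_mul, mul_one, map_add, mul_comm (MvPolynomial.X i), map_mul, hX, add_comm]

theorem A0S.der_ratDunkl (i : Fin n) : A0S.der (ratDunkl κ i : A0S n τ) = 1 := by
  rw [ratDunkl, sub_eq_add_neg, ← neg_smul, A0S.der_add, A0S.der_smul, A0S.der_sum, A0S.der_single,
    A0.der_p, Finset.sum_eq_zero, smul_zero, add_zero, one_def]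
  intro j _
  rw [A0S.der_single, A0.der_ofHol, single_zero]

theorem A0S.der_ellDunklC (l : regSet n τ) (i : Fin n) : A0S.der (ellDunklC κ l i) = 1 := by
  rw [ellDunklC, sub_eq_add_neg, ← neg_smul, A0S.der_add, A0S.der_smul, A0S.der_sum, A0S.der_single,
    A0.der_p, Finset.sum_eq_zero, smul_zero, add_zero, one_def]
  intro j _
  rw [A0S.der_single, A0.der_ofHol, single_zero]

theorem der_res (a : A0S n τ) : (res a).der = res (A0S.der a) := by
  rw [res, res, A0.der_sum]
  simp only [A0S.coeff_der]

theorem A0.coeff_der (F : A0 n τ) (k : Fin n →₀ ℕ) (x : regSet n τ) :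
    (F.der.coeff k).1 x
      = ∑ i, (F.coeff (k + Finsupp.single i 1)).1 x * ((k i : ℂ) + 1) := by
  rw [← coeff_evalAt, evalAt_der, sumPderiv_eq, MvPolynomial.coeff_sum]
  refine Finset.sum_congr rfl fun i _ => ?_
  rw [MvPolynomial.coeff_pderiv, coeff_evalAt]

/-- `∑_i ∂/∂p_i` acts on coefficients by finite sums, so it commutes with limits. -/
theorem A0S.der_eq_zero_of_hasLimitC {F : regSet n τ → A0S n τ} {a : A0S n τ} (ha : HasLimitC F a)
    (hF : ∀ l, A0S.der (F l) = 0) : A0S.der a = 0 := by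
  have h : HasLimitC (fun l => A0S.der (F l)) (A0S.der a) := by
    intro w k x
    simp only [A0S.coeff_der, A0.coeff_der]
    exact tendsto_finsetSum _ fun i _ => (ha w _ x).mul_const _
  simp only [hF] at h
  exact h.unique fun w k x => tendsto_const_nhds

end MomentumShift

/-! ### Symmetries of the Hamiltonians -/

section Invariance

variable {n : ℕ} {τ : UpperHalfPlane} {κ : ℂ}

theorem rename_xi (w : Equiv.Perm (Fin n)) (i : Fin n) :
    MvPolynomial.rename w (xi i) = xi (w i) := by
  rw [xi, xi, map_sub, map_mul, map_sum, MvPolynomial.rename_X, MvPolynomial.rename_C]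
  simp only [MvPolynomial.rename_X]
  rw [Equiv.sum_comp w fun j => (MvPolynomial.X j : MvPolynomial (Fin n) ℂ)]

theorem rename_of_mem_tracelessSymmetric {q : MvPolynomial (Fin n) ℂ}
    (hq : q ∈ tracelessSymmetric n) (w : Equiv.Perm (Fin n)) : MvPolynomial.rename w q = q := by
  obtain ⟨q₀, hq₀, rfl⟩ := hq
  have hs : MvPolynomial.rename w q₀ = q₀ := hq₀ w
  have h : (MvPolynomial.rename w).comp (MvPolynomial.aeval (R := ℂ) (xi (n := n)))
      = (MvPolynomial.aeval xi).comp (MvPolynomial.rename w) := by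
    refine MvPolynomial.algHom_ext fun i => ?_
    simp [rename_xi]
  have := AlgHom.congr_fun h q₀
  rw [AlgHom.comp_apply, AlgHom.comp_apply, hs] at this
  exact this

theorem sumPderiv_xi (i : Fin n) : sumPderiv n ℂ (xi i) = 0 := by
  have hn : (n : ℂ) ≠ 0 := Nat.cast_ne_zero.mpr (Fin.pos i).ne'
  have h : (MvPolynomial.C (n : ℂ)⁻¹ : MvPolynomial (Fin n) ℂ) * (n : MvPolynomial (Fin n) ℂ) = 1 := by
    rw [← map_natCast (MvPolynomial.C (R := ℂ) (σ := Fin n)), ← map_mul, inv_mul_cancel₀ hn, map_one]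
  rw [xi, map_sub, Derivation.leibniz, sumPderiv_C, map_sum]
  simp [sumPderiv_X, h]

theorem sumPderiv_of_mem_tracelessSymmetric {q : MvPolynomial (Fin n) ℂ}
    (hq : q ∈ tracelessSymmetric n) : sumPderiv n ℂ q = 0 := by
  obtain ⟨q₀, -, rfl⟩ := hq
  change sumPderiv n ℂ (MvPolynomial.aeval xi q₀) = 0
  induction q₀ using MvPolynomial.induction_on with
  | C c => rw [MvPolynomial.aeval_C]; exact sumPderiv_C c
  | add p q hp hq => rw [map_add, map_add, hp, hq, add_zero]
  | mul_X p i hp =>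
    rw [map_mul, Derivation.leibniz, hp, MvPolynomial.aeval_X, sumPderiv_xi, smul_zero, smul_zero,
      add_zero]

theorem subst_zero {B : Type*} [Ring B] [Module ℂ B] (y : Fin n → B) : subst y 0 = 0 := by
  simp [subst]

theorem der_ratHam {q : MvPolynomial (Fin n) ℂ} (hq : sumPderiv n ℂ q = 0) :
    (ratHam τ κ q).der = 0 := by
  rw [ratHam, der_res, A0S.der_subst (ratDunkl_commute κ) A0S.der_ratDunkl, hq, subst_zero, res_zero]

theorem der_subst_ellDunklC {F : A0 n τ} (hF : F.der = 0) (l : regSet n τ) :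
    A0S.der (subst (ellDunklC κ l) (F.evalAt l)) = 0 := by
  rw [A0S.der_subst (ellDunklC_commute κ l) (A0S.der_ellDunklC l), ← evalAt_der, hF, evalAt_zero,
    subst_zero]

theorem eta0_res (b : AhS n τ) : eta0 (res b) = res (eta0S n τ b) := by
  rw [res, res]
  refine (_root_.map_sum (eta0Hom n τ) _ _).trans (Finset.sum_congr rfl fun w _ => ?_)
  rw [coeff_eta0S]
  rfl

/-- The limits exist, and the Hamiltonian is invariant under permutations, under translations of
the positions by `quasiPeriods n` and under the simultaneous translation of the momenta. -/
theorem exists_limits_and_invariance {q : MvPolynomial (Fin n) ℂ} (hq : q ∈ tracelessSymmetric n) :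
    (∃ a, HasLimitC (ellFamily τ κ q) a) ∧ (∃ b, HasLimit (quantFamily τ κ q) b) ∧
      (∀ w : Equiv.Perm (Fin n), w • eta0 (quantHam τ κ q) = eta0 (quantHam τ κ q)) ∧
      (∀ u, ∀ hu : u ∈ quasiPeriods n, ∀ x : regSet n τ,
        (eta0 (quantHam τ κ q)).evalAt (addReg hu x) = (eta0 (quantHam τ κ q)).evalAt x) ∧
      (eta0 (quantHam τ κ q)).der = 0 := by
  have hren := rename_of_mem_tracelessSymmetric hq
  obtain ⟨a, -, haC, -, -⟩ := exists_hasLimitC_ellFamily (τ := τ) (κ := κ) hren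
  obtain ⟨b, hb, hcomm⟩ := exists_hasLimit_quantFamily (τ := τ) (κ := κ) hren
  have hbC : HasLimitC (fun l => subst (ellDunklC κ l) ((ellHam τ κ q).evalAt l)) (eta0S n τ b) := by
    have := hb.eta0S
    simp only [quantFamily, ← hat_apply, eta0S_hat] at this
    exact this
  have hH : eta0 (quantHam τ κ q) = res (eta0S n τ b) := by rw [quantHam, limQ_eq hb, eta0_res]
  have hell : (ellHam τ κ q).der = 0 := by
    rw [ellHam, limC_eq haC, der_res, A0S.der_eq_zero_of_hasLimitC haC
      (der_subst_ellDunklC (der_ratHam (sumPderiv_of_mem_tracelessSymmetric hq))), res_zero]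
  refine ⟨⟨_, haC⟩, ⟨b, hb⟩, fun w => ?_, fun u hu x => ?_, ?_⟩
  · rw [hH, smul_res_eta0S (hcomm w)]
  · obtain ⟨η, hη⟩ := exists_phi_add_period τ (periods τ).ω₁_mem_lattice
    rw [hH, res, evalAt_sum, evalAt_sum]
    exact Finset.sum_congr rfl fun w _ => evalAt_addReg_of_hasLimitC hbC
      (fun l => subst_mem_quasiPeriodicSubring (ellDunklC_mem_quasiPeriodicSubring hη l) _) w hu x
  · rw [hH, der_res, A0S.der_eq_zero_of_hasLimitC hbC (der_subst_ellDunklC hell), res_zero]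

end Invariance

/-! ### Functions on the phase space -/

section Functions

variable {n : ℕ} {τ : UpperHalfPlane}

theorem toFun_of_mem (F : A0 n τ) {x : Fin n → ℂ} (hx : x ∈ regSet n τ) (p : Fin n → ℂ) :
    F.toFun (x, p) = MvPolynomial.eval p (F.evalAt ⟨x, hx⟩) := dif_pos hx

theorem toFun_of_notMem (F : A0 n τ) {x : Fin n → ℂ} (hx : x ∉ regSet n τ) (p : Fin n → ℂ) :
    F.toFun (x, p) = 0 := dif_neg hx

theorem toFun_perm {F : A0 n τ} {w : Equiv.Perm (Fin n)} (hF : w • F = F) (x p : Fin n → ℂ) :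
    F.toFun (x ∘ w, p ∘ w) = F.toFun (x, p) := by
  by_cases hx : x ∈ regSet n τ
  · rw [toFun_of_mem F (comp_mem_regSet w hx), toFun_of_mem F hx]
    conv_rhs => rw [← hF]
    rw [evalAt_smul, MvPolynomial.eval_rename]
    rfl
  · have hx' : x ∘ w ∉ regSet n τ := fun h => hx (by
      have := comp_mem_regSet w⁻¹ h
      rwa [Function.comp_assoc, ← Equiv.Perm.coe_mul, mul_inv_cancel, Equiv.Perm.coe_one,
        Function.comp_id] at this)
    rw [toFun_of_notMem F hx, toFun_of_notMem F hx']

theorem toFun_add {F : A0 n τ} {u : Fin n → ℂ} (hu : u ∈ quasiPeriods n)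
    (hF : ∀ x : regSet n τ, F.evalAt (addReg hu x) = F.evalAt x) (x p : Fin n → ℂ) :
    F.toFun (x + u, p) = F.toFun (x, p) := by
  by_cases hx : x ∈ regSet n τ
  · rw [toFun_of_mem F (add_mem_regSet hu hx), toFun_of_mem F hx, ← hF ⟨x, hx⟩]
    rfl
  · have hx' : x + u ∉ regSet n τ := fun h => hx (by
      simpa using add_mem_regSet (neg_mem_quasiPeriods hu) h)
    rw [toFun_of_notMem F hx, toFun_of_notMem F hx']

theorem hasDerivAt_eval_add (f : MvPolynomial (Fin n) ℂ) (p : Fin n → ℂ) :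
    HasDerivAt (fun t : ℂ => MvPolynomial.eval (p + t • fun _ => (1 : ℂ)) f)
      (MvPolynomial.eval p (sumPderiv n ℂ f)) 0 := by
  induction f using MvPolynomial.induction_on with
  | C c => simpa [sumPderiv_C] using hasDerivAt_const (0 : ℂ) c
  | add f g hf hg => simpa using hf.fun_add hg
  | mul_X f i hf =>
    have h1 : HasDerivAt (fun t : ℂ => p i + t) 1 0 := by
      simpa using (hasDerivAt_id (0 : ℂ)).const_add (p i)
    have := hf.fun_mul h1
    simp only [Derivation.leibniz, map_mul, sumPderiv_X, smul_eq_mul, map_add, MvPolynomial.eval_X,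
      Pi.add_apply, Pi.smul_apply, mul_one]
    refine this.congr_deriv ?_
    simp [add_comm, mul_comm]

theorem differentiableAt_toFun (F : A0 n τ) {z : Phase n} (hz : z.1 ∈ regSet n τ) :
    DifferentiableAt ℂ F.toFun z := by
  have h : F.toFun =ᶠ[𝓝 z] fun z => ∑ k ∈ MvPolynomial.support (R := Hol n τ) F,
      extZero (F.coeff k).1 z.1 * ∏ i, z.2 i ^ k i := by
    filter_upwards [continuous_fst.continuousAt.preimage_mem_nhds
      ((isOpen_regSet n τ).mem_nhds hz)] with y hy
    refine (toFun_of_mem F hy y.2).trans ?_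
    rw [MvPolynomial.eval_eq']
    refine (Finset.sum_subset (MvPolynomial.support_map_subset (R := Hol n τ) _ F)
      fun k _ hk => ?_).trans (Finset.sum_congr rfl fun k _ => ?_)
    · rw [show (F.evalAt ⟨y.1, hy⟩).coeff k = 0 from MvPolynomial.notMem_support_iff.mp hk, zero_mul]
    · rw [coeff_evalAt, extZero_apply (F.coeff k).1 ⟨y.1, hy⟩]
  refine DifferentiableAt.congr_of_eventuallyEq ?_ h
  refine DifferentiableAt.fun_sum fun k _ => DifferentiableAt.mul ?_ ?_
  · exact DifferentiableAt.comp (g := extZero (F.coeff k).1) z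
      (Hol.differentiableAt (F.coeff k) ⟨z.1, hz⟩) differentiableAt_fst
  · fun_prop

end Functions

/-! ### The equilibrium -/

section Equilibrium

variable {n : ℕ} {τ : UpperHalfPlane}

theorem equilibriumPoint_mem (n : ℕ) (τ : UpperHalfPlane) :
    (equilibriumPoint n).1 ∈ regSet n τ := by
  intro i j hij hmem
  have hn : (0 : ℝ) < n := by exact_mod_cast Fin.pos i
  obtain ⟨a, b, hab⟩ := PeriodPair.mem_lattice.mp hmem
  have e : (equilibriumPoint n).1 i - (equilibriumPoint n).1 j
      = (((((i : ℕ) : ℝ) - (j : ℕ)) / n : ℝ) : ℂ) := by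
    simp only [equilibriumPoint]
    push_cast
    ring
  rw [e] at hab
  have him := congrArg Complex.im hab
  have hre := congrArg Complex.re hab
  simp only [periods, Complex.add_re, Complex.add_im, Complex.mul_re, Complex.mul_im,
    Complex.intCast_re, Complex.intCast_im, Complex.ofReal_re, Complex.ofReal_im, Complex.one_re,
    Complex.one_im] at him hre
  have hb : (b : ℝ) = 0 := by
    refine (mul_eq_zero.mp (?_ : (b : ℝ) * τ.im = 0)).resolve_right τ.im_pos.ne'
    simpa using him
  rw [hb] at hre
  have hre' : (a : ℝ) * n = ((i : ℕ) : ℝ) - (j : ℕ) := by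
    field_simp at hre
    simpa using hre
  have hz : a * (n : ℤ) = ((i : ℕ) : ℤ) - (j : ℕ) := by exact_mod_cast hre'
  have hd : ((i : ℕ) : ℤ) - (j : ℕ) = 0 :=
    Int.eq_zero_of_abs_lt_dvd (m := n) (Dvd.intro_left _ hz) (by
      have := i.2; have := j.2
      rw [abs_lt]; omega)
  exact hij (Fin.ext (by omega))

/-- A linear form that takes the same value on all basis vectors and vanishes on their sum is
zero on them. -/
theorem apply_single_eq_zero {m : ℕ} {L : (Fin (m + 1) → ℂ) →L[ℂ] ℂ}
    (hL : ∀ i, L (Pi.single (finRotate (m + 1) i) 1) = L (Pi.single i 1))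
    (h1 : L (fun _ => 1) = 0) (i : Fin (m + 1)) : L (Pi.single i 1) = 0 := by
  have h0 : ∀ i, L (Pi.single i 1) = L (Pi.single 0 1) := by
    intro i
    induction i using Fin.induction with
    | zero => rfl
    | succ i ih =>
      rw [← ih, ← hL i.castSucc]
      congr 2
      exact ((finRotate_apply _).trans Fin.coeSucc_eq_succ).symm
  have hs : L (fun _ => 1) = ∑ i, L (Pi.single i 1) := by
    rw [← _root_.map_sum, Finset.univ_sum_single]
  rw [h1, Finset.sum_congr rfl fun i _ => h0 i, Finset.sum_const, Finset.card_univ, Fintype.card_fin,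
    nsmul_eq_mul] at hs
  rw [h0]
  exact (mul_eq_zero.mp hs.symm).resolve_left (Nat.cast_ne_zero.mpr m.succ_ne_zero)

/-- The cyclic permutation moves `i/n` to `(i + 1)/n`, except for the last point `1`, which it moves
to `1/n = 1 + (1/n - 1)`. So it is a translation by `1/n`, up to periods. -/
theorem rotate_equilibriumPoint (m : ℕ) :
    (equilibriumPoint (m + 1)).1 ∘ finRotate (m + 1) - (equilibriumPoint (m + 1)).1
      ∈ quasiPeriods (m + 1) := by
  have hm : ((m + 1 : ℕ) : ℂ) ≠ 0 := Nat.cast_ne_zero.mpr m.succ_ne_zero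
  have h : ∀ i, ((equilibriumPoint (m + 1)).1 ∘ finRotate (m + 1) - (equilibriumPoint (m + 1)).1) i
      = 1 / (m + 1 : ℕ) ∨
      ((equilibriumPoint (m + 1)).1 ∘ finRotate (m + 1) - (equilibriumPoint (m + 1)).1) i
      = 1 / (m + 1 : ℕ) - 1 := by
    intro i
    simp only [Pi.sub_apply, Function.comp_apply, equilibriumPoint]
    rw [coe_finRotate]
    split_ifs with hi
    · right
      rw [hi, Fin.val_last]
      field_simp
      push_cast
      ring
    · left
      push_cast
      ring
  intro i j
  rcases h i with hi | hi <;> rcases h j with hj | hj <;> rw [hi, hj]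
  · left; ring
  · right; left; ring
  · right; right; ring
  · left; ring

/-- A function on the phase space with the symmetries of the Hamiltonians is stationary at the
equilibrium point: the point is fixed by a cyclic permutation of the particles followed by a
translation, and this symmetry permutes the partial derivatives transitively. -/
theorem isEquilibrium_of_invariant {F : A0 n τ} (hW : ∀ w : Equiv.Perm (Fin n), w • F = F)
    (hT : ∀ u, ∀ hu : u ∈ quasiPeriods n, ∀ x : regSet n τ, F.evalAt (addReg hu x) = F.evalAt x)
    (hD : F.der = 0) : IsEquilibrium F.toFun (equilibriumPoint n) := by
  have hmem := equilibriumPoint_mem n τ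
  have hdiff := differentiableAt_toFun F hmem
  refine ⟨hdiff, ?_⟩
  rcases n with _ | m
  · exact fun i => i.elim0
  set z := equilibriumPoint (m + 1) with hz
  set w := finRotate (m + 1) with hw
  set u := z.1 ∘ w - z.1 with hu
  have huq : u ∈ quasiPeriods (m + 1) := rotate_equilibriumPoint m
  let A : Phase (m + 1) →L[ℂ] Phase (m + 1) := (permL w).prodMap (permL w)
  have hF := hdiff.hasFDerivAt
  -- the affine map `y ↦ A y - (u, 0)` fixes `z` and preserves `F`, so `dF(z) ∘ A = dF(z)`
  have hfix : A z - (u, 0) = z := by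
    refine Prod.ext ?_ ?_
    · change z.1 ∘ w - u = z.1
      rw [hu, sub_sub_cancel]
    · change z.2 ∘ w - 0 = z.2
      rw [hz, sub_zero]
      rfl
  have hinv : ∀ y : Phase (m + 1), F.toFun (A y - (u, 0)) = F.toFun y := by
    intro y
    change F.toFun (y.1 ∘ w - u, y.2 ∘ w - 0) = _
    rw [sub_zero, sub_eq_add_neg, toFun_add (neg_mem_quasiPeriods huq) (hT _ _), toFun_perm (hW w)]
  have hcomp : HasFDerivAt (fun y => F.toFun (A y - (u, 0))) ((fderiv ℂ F.toFun z).comp A) z := by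
    refine HasFDerivAt.comp (g := F.toFun) (f := fun y => A y - (u, 0)) z ?_
      (A.hasFDerivAt.sub_const _)
    rwa [hfix]
  simp only [hinv] at hcomp
  have hAd := hF.unique hcomp
  have hsingle : ∀ i : Fin (m + 1), permL w (Pi.single (w i) 1) = Pi.single i 1 := by
    intro i
    ext j
    simp [permL, Pi.single_apply]
  -- translation of all positions by the same vector is one of the `quasiPeriods`
  have hxd : ∀ i, (fderiv ℂ F.toFun z).comp (ContinuousLinearMap.inl ℂ _ _) (Pi.single i 1) = 0 := by
    refine apply_single_eq_zero (fun i => ?_) ?_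
    · change fderiv ℂ F.toFun z (Pi.single (w i) 1, 0) = fderiv ℂ F.toFun z (Pi.single i 1, 0)
      rw [hAd]
      change fderiv ℂ F.toFun z (permL w (Pi.single (w i) 1), permL w 0) = _
      rw [hsingle, map_zero, ← hAd]
    · have h := (hF.hasLineDerivAt ((fun _ => 1, 0) : Phase (m + 1)))
      have hc : ∀ t : ℂ, F.toFun (z + t • ((fun _ => 1, 0) : Phase (m + 1))) = F.toFun z := by
        intro t
        have ht : (t • fun _ => (1 : ℂ) : Fin (m + 1) → ℂ) ∈ quasiPeriods (m + 1) := fun i j => by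
          left; simp
        refine Eq.trans ?_ (toFun_add ht (hT _ ht) z.1 z.2)
        congr 1
        refine Prod.ext rfl ?_
        change z.2 + t • 0 = z.2
        rw [smul_zero, add_zero]
      rw [HasLineDerivAt] at h
      simp only [hc] at h
      exact h.unique (hasDerivAt_const _ _)
  -- translation of all momenta is an infinitesimal symmetry by `hD`
  have hpd : ∀ i, (fderiv ℂ F.toFun z).comp (ContinuousLinearMap.inr ℂ _ _) (Pi.single i 1) = 0 := by
    refine apply_single_eq_zero (fun i => ?_) ?_
    · change fderiv ℂ F.toFun z (0, Pi.single (w i) 1) = fderiv ℂ F.toFun z (0, Pi.single i 1)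
      rw [hAd]
      change fderiv ℂ F.toFun z (permL w 0, permL w (Pi.single (w i) 1)) = _
      rw [hsingle, map_zero, ← hAd]
    · have h := (hF.hasLineDerivAt ((0, fun _ => 1) : Phase (m + 1)))
      have hc : ∀ t : ℂ, F.toFun (z + t • ((0, fun _ => 1) : Phase (m + 1)))
          = MvPolynomial.eval (z.2 + t • fun _ => (1 : ℂ)) (F.evalAt ⟨z.1, hmem⟩) := by
        intro t
        rw [← toFun_of_mem]
        congr 1
        refine Prod.ext ?_ rfl
        change z.1 + t • 0 = z.1
        rw [smul_zero, add_zero]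
      rw [HasLineDerivAt] at h
      simp only [hc] at h
      have h' := hasDerivAt_eval_add (F.evalAt ⟨z.1, hmem⟩) z.2
      rw [← evalAt_der, hD, evalAt_zero, map_zero] at h'
      exact h.unique h'
  exact fun i => ⟨hxd i, hpd i⟩

theorem IsEquilibrium.poisson_eq_zero {F : Phase n → ℂ} {z : Phase n} (h : IsEquilibrium F z)
    (G : Phase n → ℂ) : poisson F G z = 0 := by
  refine Finset.sum_eq_zero fun i _ => ?_
  rw [(h.2 i).1, (h.2 i).2, zero_mul, zero_mul, sub_zero]

end Equilibrium

end EllipticCM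

theorem mainTheorem7 (n : ℕ) (τ : UpperHalfPlane) (κ : ℂ) :
    (EllipticCM.equilibriumPoint n).1 ∈ EllipticCM.regSet n τ ∧
    ∀ q ∈ EllipticCM.tracelessSymmetric n,
      (∃ a, EllipticCM.HasLimitC (EllipticCM.ellFamily τ κ q) a) ∧
      (∃ b, EllipticCM.HasLimit (EllipticCM.quantFamily τ κ q) b) ∧
      EllipticCM.IsEquilibrium (EllipticCM.eta0 (EllipticCM.quantHam τ κ q)).toFun
        (EllipticCM.equilibriumPoint n) ∧
      ∀ G : EllipticCM.Phase n → ℂ, DifferentiableAt ℂ G (EllipticCM.equilibriumPoint n) →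
        EllipticCM.poisson (EllipticCM.eta0 (EllipticCM.quantHam τ κ q)).toFun G
          (EllipticCM.equilibriumPoint n) = 0 := by
  refine ⟨EllipticCM.equilibriumPoint_mem n τ, fun q hq => ?_⟩
  obtain ⟨ha, hb, hW, hT, hD⟩ := EllipticCM.exists_limits_and_invariance (τ := τ) (κ := κ) hq
  have h := EllipticCM.isEquilibrium_of_invariant hW hT hD
  exact ⟨ha, hb, h, fun G _ => h.poisson_eq_zero G⟩
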